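/- **Setting.** For an $n$-qubit Hermitian operator $H$ and $\beta\in\mathbb R$ let $\rho_\beta=e^{-\beta H}/\operatorname{tr}e^{-\beta H}$. Write $\langle A,B\rangle_s=\operatorname{tr}(A^\dagger\rho_\beta^{1-s}B\rho_\beta^{s})$. A map $\mathcal T(X)=\sum_j w_jK_jXK_j^\dagger$ with real weights $w_j$ satisfies $s$-detailed balance (with respect to $\rho_\beta$) if $\langle A,\mathcal T^\dagger(B)\rangle_s=\langle\mathcal T^\dagger(A),B\rangle_s$ for all $A,B$, where $\mathcal T^\dagger(X)=\sum_jw_jK_j^\dagger XK_j$. For a measurement $\mathcal M$ with Kraus operators $K_j$ and real outcomes $u_j$, and a state $\rho$, put $\mathbb E_\rho[\mathcal M]=\sum_ju_j\operatorname{tr}(K_j\rho K_j^\dagger)$, $\mathbb V_\rho[\mathcal M]=\sum_j(u_j-\mathbb E_\rho[\mathcal M])^2\operatorname{tr}(K_j\rho K_j^\dagger)$, $\operatorname{Cov}_\rho(\mathcal M)=\sum_{j,k}(u_j-\mathbb E_\rho[\mathcal M])(u_k-\mathbb E_\rho[\mathcal M])\operatorname{tr}(K_kK_j\rho K_j^\dagger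 K_k^\dagger)$, $\mathcal M(\rho)=\sum_jK_j\rho K_j^\dagger$, and $\widehat{\mathcal M}(X)=\sum_j(u_j-\mathbb E_{\rho_\beta}[\mathcal M])K_jXK_j^\dagger$. For an observable $O$ put $\mathbb V_\rho[O]=\operatorname{tr}(O^2\rho)-(\operatorname{tr}(O\rho))^2$. **The algorithm (Gaussian-filtered quantum phase estimation).** Let $m\ge1$ be an integer, $\gamma>0$, $\kappa\ge 1$, $N=2^{2m}$, $h=2^{-m}$, $\omega_j=\xi_j=(j-N/2)h$ for $0\le j<N$, and $\widehat g_\gamma(\xi)=(2\sqrt{2\pi}\,\gamma)^{1/2}e^{-4\pi^2\gamma^2\xi^2}$. On a readout register of $2m$ ancilla qubits prepare $|\widehat G\rangle=\frac1{C_h}\sum_{\ell=1}^{N-1}\sqrt h\,\widehat g_\gamma(\xi_\ell)|\ell\rangle$, where $C_h=(h\sum_{\ell=1}^{N-1}\widehat g_\gamma(\xi_\ell)^2)^{1/2}$; apply $W=\sum_{\ell=0}^{N-1}e^{-2\pi i\xi_\ell O/\kappa}\otimes|\ell\rangle\langle\ell|$ to the system and the readout register; apply $\mathcal F_s|\ell\rangle=\frac1{\sqrt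 N}\sum_{j=0}^{N-1}e^{2\pi i(\ell-N/2)(j-N/2)/N}|j\rangle$ to the readout register; measure it in the computational basis, obtaining $j$; and output $u_j=\kappa\omega_j$ if $|\omega_j|\le2$ and $u_j=0$ otherwise. Let $\mathcal M$ be the resulting measurement of the system, with Kraus operators $K_j=(I\otimes\langle j|)(I\otimes\mathcal F_s)W(I\otimes|\widehat G\rangle)$. **Theorem.** There are absolute constants $C>0$ and $d\in\mathbb N$ such that for all $\kappa\ge1$ and $\epsilon>0$, with $\log^+x=\max(0,\log x)$ and $L=1+\log\kappa+\log^+\epsilon^{-1}$, there are parameters $m\ge1$ and $\gamma>0$ with $\gamma^{-1}\le C\kappa L^{1/2}$ and $2^m\le C\gamma^{-1}L^{1/2}$, depending only on $\kappa$ and $\epsilon$, for which the following holds for every $n$, every inverse temperature $\beta\in\mathbb R$, every $n$-qubit Hermitian operator $H$, and every $n$-qubit observable (Hermitian operator) $O$ that commutes with $H$ and satisfies $\|O\|\le\kappa$. 1. *Implementation cost.* $\mathcal M$ is a quantum channel. Its unitary part, i.e. the map $|\Psi\rangle\otimes|0\rangle\mapsto\sum_jK_j|\Psi\rangle\otimes|j\rangle\otimes|0\rangle$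 (the last factor standing for additional work qubits, which return to $|0\rangle$), is implemented exactly by a circuit that depends only on $\kappa$ and $\epsilon$, and consists of two-qubit gates on the ancilla qubits and of evolutions $e^{-i\tau O}$ of the system, each controlled by one ancilla qubit. The number of all ancilla qubits is at most $C(1+\log\kappa+\log^+\log^+\epsilon^{-1})$ (with $\log^+0=0$), i.e. $\mathcal O(\log\kappa+\log\log\epsilon^{-1})$; the total evolution time $\sum|\tau|$ is at most $CL$, i.e. $\mathcal O(\log\kappa+\log\epsilon^{-1})$; and the number of all gates and controlled evolutions is at most $Cm^d$, i.e. $\operatorname{poly}(m)$. 2. *Expectation and variance.* $$|\mathbb E_{\rho_\beta}[\mathcal M]-\operatorname{tr}(\rho_\beta O)|\le\epsilon,\qquad|\mathbb V_{\rho_\beta}[\mathcal M]-\mathbb V_{\rho_\beta}[O]|\le C,\qquad|\operatorname{Cov}_{\rho_\beta}(\mathcal M)|\le\mathbb V_{\rho_\beta}[\mathcal M].$$ 3. *Fixed point and detailed balance.* $\mathcal M(\rho_\beta)=\rho_\beta$, and both $\mathcal M$ and $\widehat{\mathcal M}$ satisfy $s$-detailed balance with respect to $\rho_\beta$ for every $s\in[0,1]$.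 -/

import Mathlib

open Matrix
open scoped Kronecker

noncomputable section

namespace GQPE

/-- Operators on a Hilbert space with orthonormal basis indexed by `S`. -/
abbrev Op (S : Type) := Matrix S S ℂ

/-- Computational basis of `n` qubits. -/
abbrev QubitBasis (n : ℕ) := Fin n → Bool

section General

variable {S : Type} [Fintype S] [DecidableEq S]

/-- The operator (spectral) norm, for the Euclidean norm on `ℂ^S`. -/
def opNorm (A : Op S) : ℝ := ‖Matrix.toEuclideanCLM (n := S) (𝕜 := ℂ) A‖

/-- The unitary evolution `exp(-i τ A)`. -/
def evolution (τ : ℝ) (A : Op S) : Op S :=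
  NormedSpace.exp ((-(Complex.I * (τ : ℂ))) • A)

/-- The Gibbs state `exp(-β H) / tr exp(-β H)`. -/
def gibbs (β : ℝ) (H : Op S) : Op S :=
  (Matrix.trace (NormedSpace.exp ((-(β : ℂ)) • H)))⁻¹ • NormedSpace.exp ((-(β : ℂ)) • H)

/-- The real power `ρ^s` of a positive definite operator, by functional calculus. -/
def opPow (ρ : Op S) (s : ℝ) : Op S := cfc (fun x : ℝ => x ^ s) ρ

/-- The weighted inner product `⟨A, B⟩_s = tr(A† ρ^{1-s} B ρ^s)`. -/
def weightedInner (ρ : Op S) (s : ℝ) (A B : Op S) : ℂ :=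
  Matrix.trace (Aᴴ * opPow ρ (1 - s) * B * opPow ρ s)

/-- Expectation `tr(ρ A)` of a (Hermitian) operator. -/
def obsExp (ρ A : Op S) : ℝ := (Matrix.trace (ρ * A)).re

/-- Variance `tr(A² ρ) - (tr(A ρ))²` of a (Hermitian) operator. -/
def obsVar (ρ A : Op S) : ℝ := obsExp ρ (A * A) - obsExp ρ A ^ 2

/-- The map `X ↦ ∑ⱼ wⱼ Kⱼ X Kⱼ†`. -/
def krausMap {J : Type} [Fintype J] (w : J → ℝ) (K : J → Op S) (X : Op S) : Op S :=
  ∑ j, (w j : ℂ) • (K j * X * (K j)ᴴ)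

/-- The Heisenberg-picture (Hilbert–Schmidt dual) map `X ↦ ∑ⱼ wⱼ Kⱼ† X Kⱼ`. -/
def krausDual {J : Type} [Fintype J] (w : J → ℝ) (K : J → Op S) (X : Op S) : Op S :=
  ∑ j, (w j : ℂ) • ((K j)ᴴ * X * K j)

/-- `s`-detailed balance with respect to `ρ` of the map `krausMap w K`: its dual is self-adjoint
for the weighted inner product. -/
def DetailedBalance {J : Type} [Fintype J] (ρ : Op S) (s : ℝ) (w : J → ℝ) (K : J → Op S) : Prop :=
  ∀ A B : Op S,
    weightedInner ρ s A (krausDual w K B) = weightedInner ρ s (krausDual w K A) B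

end General

/-- A measurement: Kraus operators `kraus j`, together with the real outcome `outcome j` that is
reported when the `j`-th Kraus operator has been applied. -/
structure Measurement (S : Type) (J : Type) where
  kraus : J → Op S
  outcome : J → ℝ

namespace Measurement

variable {S J : Type} [Fintype S] [DecidableEq S] [Fintype J] (M : Measurement S J)

/-- `∑ⱼ Kⱼ† Kⱼ = 1`, so that the Kraus operators define a quantum channel. -/
def IsComplete : Prop := ∑ j, (M.kraus j)ᴴ * M.kraus j = 1

/-- The channel `ρ ↦ ∑ⱼ Kⱼ ρ Kⱼ†`. -/
def channel (ρ : Op S) : Op S := krausMap (fun _ => 1) M.kraus ρ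

/-- Probability of the index `j` when measuring `ρ`. -/
def prob (ρ : Op S) (j : J) : ℝ := (Matrix.trace (M.kraus j * ρ * (M.kraus j)ᴴ)).re

/-- Probability of the index `j` and then `k` in two successive measurements of `ρ`. -/
def prob₂ (ρ : Op S) (j k : J) : ℝ :=
  (Matrix.trace (M.kraus k * M.kraus j * ρ * (M.kraus j)ᴴ * (M.kraus k)ᴴ)).re

/-- Expectation of the outcome. -/
def expect (ρ : Op S) : ℝ := ∑ j, M.outcome j * M.prob ρ j

/-- Variance of the outcome. -/
def variance (ρ : Op S) : ℝ := ∑ j, (M.outcome j - M.expect ρ) ^ 2 * M.prob ρ j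

/-- Covariance of the outcomes of two successive measurements. -/
def covariance (ρ : Op S) : ℝ :=
  ∑ j, ∑ k, (M.outcome j - M.expect ρ) * (M.outcome k - M.expect ρ) * M.prob₂ ρ j k

/-- `s`-detailed balance of the channel. -/
def ChannelDetailedBalance (ρ : Op S) (s : ℝ) : Prop :=
  DetailedBalance ρ s (fun _ => 1) M.kraus

/-- `s`-detailed balance of the centred, outcome-weighted map
`X ↦ ∑ⱼ (uⱼ - E_ρ) Kⱼ X Kⱼ†`. -/
def HatDetailedBalance (ρ : Op S) (s : ℝ) : Prop :=
  DetailedBalance ρ s (fun j => M.outcome j - M.expect ρ) M.kraus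

end Measurement

/-! ### The Gaussian-filtered phase estimation algorithm -/

/-- Basis of the readout register of `2m` qubits, `N = 2^{2m}`. -/
abbrev Readout (m : ℕ) := Fin (2 ^ (2 * m))

/-- The step size `h = 2^{-m}`. -/
def step (m : ℕ) : ℝ := ((2 : ℝ) ^ m)⁻¹

/-- The centred index `j - N/2`. -/
def centred (m : ℕ) (j : Readout m) : ℝ := (j.val : ℝ) - (2 : ℝ) ^ (2 * m) / 2

/-- The grid points `ω_j = ξ_j = (j - N/2) h`. -/
def node (m : ℕ) (j : Readout m) : ℝ := centred m j * step m

/-- `ĝ_γ(ξ) = (2 √(2π) γ)^{1/2} exp(-4π²γ²ξ²)`, the Fourier transform of the Gaussian filter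
`g_γ(ω) = (γ √(2π))^{-1/2} exp(-ω²/(4γ²))`. -/
def gaussHat (γ ξ : ℝ) : ℝ :=
  Real.sqrt (2 * Real.sqrt (2 * Real.pi) * γ) * Real.exp (-(4 * Real.pi ^ 2 * γ ^ 2 * ξ ^ 2))

/-- The normalization `C = (h ∑_{ℓ=1}^{N-1} |ĝ_γ(ξ_ℓ)|²)^{1/2}`. -/
def normConst (m : ℕ) (γ : ℝ) : ℝ :=
  Real.sqrt (step m * ∑ ℓ : Readout m, if ℓ.val = 0 then 0 else gaussHat γ (node m ℓ) ^ 2)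

/-- Amplitudes of the Gaussian resource state; the amplitude of `ℓ = 0` is `0`. -/
def resourceState (m : ℕ) (γ : ℝ) (ℓ : Readout m) : ℂ :=
  if ℓ.val = 0 then 0
  else ((Real.sqrt (step m) * gaussHat γ (node m ℓ) / normConst m γ : ℝ) : ℂ)

/-- The shifted quantum Fourier transform on the readout register. -/
def shiftedQFT (m : ℕ) : Matrix (Readout m) (Readout m) ℂ :=
  Matrix.of fun j ℓ =>
    ((1 / Real.sqrt ((2 : ℝ) ^ (2 * m)) : ℝ) : ℂ) *
      Complex.exp (2 * (Real.pi : ℂ) * Complex.I *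
        ((centred m ℓ * centred m j / (2 : ℝ) ^ (2 * m) : ℝ) : ℂ))

section Algorithm

variable {S : Type} [Fintype S] [DecidableEq S]

/-- The select operator `∑_ℓ exp(-2πi ξ_ℓ A) ⊗ |ℓ⟩⟨ℓ|`. -/
def selectEvolution (m : ℕ) (A : Op S) : Matrix (S × Readout m) (S × Readout m) ℂ :=
  Matrix.blockDiagonal fun ℓ => evolution (2 * Real.pi * node m ℓ) A

/-- The Kraus operator of the readout `j`:
`(I ⊗ ⟨j|) (I ⊗ F_s) W (I ⊗ |Ĝ⟩)`, with `W` the select operator of `O/κ`. -/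
def algKraus (m : ℕ) (γ κ : ℝ) (O : Op S) (j : Readout m) : Op S :=
  Matrix.of fun x y =>
    ∑ ℓ : Readout m,
      (((1 : Op S) ⊗ₖ shiftedQFT m) * selectEvolution m (((κ⁻¹ : ℝ) : ℂ) • O)) (x, j) (y, ℓ)
        * resourceState m γ ℓ

/-- The raw readout: `ω_j` if `|ω_j| ≤ 2`, and `0` otherwise. -/
def rawOutcome (m : ℕ) (j : Readout m) : ℝ :=
  if -2 ≤ node m j ∧ node m j ≤ 2 then node m j else 0

/-- The measurement performed by the algorithm: the reported outcome is `κ` times the raw one. -/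
def measurement (m : ℕ) (γ κ : ℝ) (O : Op S) : Measurement S (Readout m) where
  kraus := algKraus m γ κ O
  outcome := fun j => κ * rawOutcome m j

end Algorithm

/-! ### Circuits -/

/-- Embedding of a two-qubit operator, acting on the qubits `e 0` and `e 1`, into the space of all
qubits in `Q`. -/
def liftGate {Q : Type} [Fintype Q] [DecidableEq Q] (e : Fin 2 ↪ Q) (U : Op (Fin 2 → Bool)) :
    Op (Q → Bool) :=
  Matrix.of fun z z' =>
    if ∀ q, q ∉ Set.range e → z q = z' q then U (fun i => z (e i)) (fun i => z' (e i)) else 0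

/-- Instructions of a circuit with ancilla qubits `Q` and black-box access to the time evolution of
an observable on the system: an arbitrary two-qubit gate on two ancillas, or, controlled by one
ancilla, the evolution of the system for time `τ` (of either sign). -/
inductive Instr (Q : Type)
  | gate (e : Fin 2 ↪ Q) (U : Matrix.unitaryGroup (Fin 2 → Bool) ℂ) : Instr Q
  | ctrlEvolve (c : Q) (τ : ℝ) : Instr Q

/-- Evolution time used by one instruction. -/
def Instr.time {Q : Type} : Instr Q → ℝ
  | .gate _ _ => 0
  | .ctrlEvolve _ τ => |τ|

/-- Total evolution time used by a circuit. -/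
def circuitTime {Q : Type} (c : List (Instr Q)) : ℝ := (c.map Instr.time).sum

section Circuit

variable {S Q : Type} [Fintype S] [DecidableEq S] [Fintype Q] [DecidableEq Q]

/-- The operator of one instruction, for the observable `O`. -/
def Instr.toOp (O : Op S) : Instr Q → Op (S × (Q → Bool))
  | .gate e U => (1 : Op S) ⊗ₖ liftGate e (U : Op (Fin 2 → Bool))
  | .ctrlEvolve c τ => Matrix.blockDiagonal fun z => if z c = true then evolution τ O else 1

/-- The operator of a circuit; the head of the list is applied first. -/
def circuitOp (O : Op S) : List (Instr Q) → Op (S × (Q → Bool))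
  | [] => 1
  | g :: c => circuitOp O c * g.toOp O

/-- The ancilla basis state with the readout register in state `j` (in binary) and `w` further work
qubits in state `0`. -/
def ancillaString (m w : ℕ) (j : Readout m) : Fin (2 * m) ⊕ Fin w → Bool :=
  Sum.elim (fun b => Nat.testBit j.val b.val) (fun _ => false)

/-- The circuit, started with all ancillas in state `0`, maps `|Ψ⟩ ⊗ |0⟩` to
`∑ⱼ Kⱼ |Ψ⟩ ⊗ |j⟩ ⊗ |0⟩`; measuring the readout register then realizes the Kraus operators `Kⱼ`. -/
def Implements (m w : ℕ) (c : List (Instr (Fin (2 * m) ⊕ Fin w))) (O : Op S)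
    (K : Readout m → Op S) : Prop :=
  ∀ (x y : S) (z : Fin (2 * m) ⊕ Fin w → Bool),
    circuitOp O c (x, z) (y, fun _ => false) =
      ∑ j : Readout m, if z = ancillaString m w j then K j x y else 0

end Circuit

end GQPE

end

/-! Statistics. Diagonalise `O` with eigenvalues `lam i`. Every Kraus operator is a function of `O`:
on an eigenvector with `x = lam i / κ` it acts by the number `ampl m γ x j`, a Fourier sum of the
Gaussian weights. Reflection `ℓ ↦ N - ℓ` preserves these weights and `ℓ = 0` has weight zero, so the
sine part cancels and the number is real. The Kraus operators are therefore Hermitian and commute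
with `H`, hence with `ρ_β` and its powers, which gives the fixed point and detailed balance
(`detailedBalance_of_commute`). Completeness is Parseval for the shifted Fourier transform
(`sum_ampl_sq`). The outcome distribution is a mixture over eigenvectors, weighted by the
populations of `ρ_β`. Given the eigenvector, successive outcomes are independent, so the covariance
bound is Cauchy–Schwarz (`mixture_covariance_le`). Mean and variance reduce to the first two moments
of the raw outcome, uniformly in `x ∈ [-1, 1]` (`rawOutcome_moments`).

These moments come from Poisson summation. The Fourier sum is, up to truncation, a Gaussian in `ω_j
- x` periodised over the length `2^m` of the grid; truncation, aliases and tails beyond `1/κ` are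
all exponentially small (`abs_gaussSum_sub_sum_le`). What remains of the mean error is the first
moment of a Gaussian on a shifted lattice, which Poisson summation turns into a sine series without
constant term (`exists_hasSum_mul_exp_neg_sq`). The bias is thus exponentially small although the
spread is only of order one after scaling by `κ`.

Circuit. The Fourier transform and the controlled evolutions follow the binary digits of `ℓ`. The
delicate point is the exact preparation of the Gaussian. In sign-magnitude form `|ℓ - N/2| = ∑ v_p
b_p` with `v_p ≥ 0`, so `exp(-a(∑ v_p b_p)²)` is a product of single-bit factors, prepared as a
product state, and of pair factors `exp(-2a v_p v_q b_p b_q) ≤ 1`, which are cosines of rotations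
into a recorded failure branch (`FilterInv.step`). The success probability is at least `1/4`
(`success_probability`); an additional qubit lowers it to exactly `1/4`, and then a single round of
amplitude amplification is exact (`amplify`).

The widths `2^r ≈ κ√L` and `2^q ≈ √L` make every error at most a polynomial in `κ` and `L` times
`exp(-64L)`, where `L` is `logFactor`. -/

noncomputable section

namespace GQPE

/-! ### Single-qubit operators whose matrix depends on the other qubits -/

section Blocks

variable {Q : Type} [Fintype Q] [DecidableEq Q]

/-- The operator acting on the qubit `t` by the matrix `u z`, where `z` is the string of all
qubits; `u` is meant not to depend on `z t`. -/
def blockOp (t : Q) (u : (Q → Bool) → Matrix Bool Bool ℂ) : Op (Q → Bool) :=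
  Matrix.of fun z z' => if ∀ q, q ≠ t → z q = z' q then u z (z t) (z' t) else 0

/-- Independence of the value of the qubit `t`. -/
def IndepOf {α : Type} (t : Q) (f : (Q → Bool) → α) : Prop :=
  ∀ z b, f (Function.update z t b) = f z

omit [Fintype Q] in
theorem agree_off_iff (t : Q) (z z' : Q → Bool) :
    (∀ q, q ≠ t → z q = z' q) ↔ z' = Function.update z t (z' t) := by
  constructor
  · intro h
    funext q
    by_cases hq : q = t
    · subst hq; simp
    · simp [hq, h q hq]
  · intro h q hq
    rw [h]; simp [hq]

theorem sum_agree_off (t : Q) (z : Q → Bool) (F : (Q → Bool) → ℂ) :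
    (∑ z' : Q → Bool, if ∀ q, q ≠ t → z q = z' q then F z' else 0)
      = ∑ b : Bool, F (Function.update z t b) := by
  rw [← Finset.sum_filter]
  symm
  apply Finset.sum_bij (fun b _ => Function.update z t b)
  · intro b _
    simp only [Finset.mem_filter, Finset.mem_univ, true_and]
    intro q hq; simp [hq]
  · intro b _ b' _ h
    simpa using congrFun h t
  · intro z' hz'
    simp only [Finset.mem_filter, Finset.mem_univ, true_and] at hz'
    exact ⟨z' t, Finset.mem_univ _, ((agree_off_iff t z z').1 hz').symm⟩
  · intros; rfl

theorem blockOp_mulVec (t : Q) (u : (Q → Bool) → Matrix Bool Bool ℂ) (ψ : (Q → Bool) → ℂ)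
    (z : Q → Bool) :
    (blockOp t u *ᵥ ψ) z = ∑ b : Bool, u z (z t) b * ψ (Function.update z t b) := by
  simp only [Matrix.mulVec, dotProduct, blockOp, Matrix.of_apply, ite_mul, zero_mul]
  rw [sum_agree_off t z (fun z' => u z (z t) (z' t) * ψ z')]
  simp

theorem blockOp_mul_apply (t : Q) (u : (Q → Bool) → Matrix Bool Bool ℂ) (M : Op (Q → Bool))
    (z z' : Q → Bool) :
    (blockOp t u * M) z z' = ∑ b : Bool, u z (z t) b * M (Function.update z t b) z' := by
  have := blockOp_mulVec t u (fun y => M y z') z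
  rw [← this]; rfl

/-- Since `v` ignores the target, both factors use the same block along each fibre over the other
qubits, and the product is a product of 2×2 matrices fibre by fibre. -/
theorem blockOp_mul (t : Q) (u v : (Q → Bool) → Matrix Bool Bool ℂ) (hv : IndepOf t v) :
    blockOp t u * blockOp t v = blockOp t (fun z => u z * v z) := by
  ext z z'
  rw [blockOp_mul_apply]
  simp only [blockOp, Matrix.of_apply]
  by_cases h : ∀ q, q ≠ t → z q = z' q
  · have h' : ∀ b : Bool, ∀ q, q ≠ t → Function.update z t b q = z' q := by
      intro b q hq; simp [hq, h q hq]
    rw [if_pos h, Matrix.mul_apply]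
    refine Finset.sum_congr rfl fun b _ => ?_
    rw [if_pos (h' b), hv]; simp
  · rw [if_neg h]
    refine Finset.sum_eq_zero fun b _ => ?_
    rw [if_neg, mul_zero]
    intro h'
    exact h fun q hq => by simpa [hq] using h' q hq

/-- Any qubit can be taken as the target of a diagonal operator, which brings phases and
single-qubit gates into one block calculus. -/
theorem blockOp_diagonal (t : Q) (d : (Q → Bool) → ℂ) :
    blockOp t (fun z => Matrix.diagonal fun b => d (Function.update z t b))
      = Matrix.diagonal d := by
  ext z z'
  simp only [blockOp, Matrix.of_apply]
  by_cases h : ∀ q, q ≠ t → z q = z' q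
  · rw [if_pos h]
    by_cases hb : z t = z' t
    · have : z' = z := by
        rw [(agree_off_iff t z z').1 h, ← hb]; simp
      subst this; simp
    · rw [Matrix.diagonal_apply_ne _ hb, Matrix.diagonal_apply_ne]
      rintro rfl; exact hb rfl
  · rw [if_neg h, Matrix.diagonal_apply_ne]
    rintro rfl; exact h fun _ _ => rfl

theorem blockOp_one (t : Q) : blockOp t (fun _ => 1) = (1 : Op (Q → Bool)) := by
  have := blockOp_diagonal t (fun _ : Q → Bool => (1 : ℂ))
  simpa using this

theorem blockOp_conjTranspose (t : Q) (u : (Q → Bool) → Matrix Bool Bool ℂ) (hu : IndepOf t u) :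
    (blockOp t u)ᴴ = blockOp t (fun z => (u z)ᴴ) := by
  ext z z'
  simp only [blockOp, Matrix.of_apply, Matrix.conjTranspose_apply]
  by_cases h : ∀ q, q ≠ t → z q = z' q
  · have h' : ∀ q, q ≠ t → z' q = z q := fun q hq => (h q hq).symm
    rw [if_pos h, if_pos h', (agree_off_iff t z z').1 h, hu]
  · have h' : ¬ ∀ q, q ≠ t → z' q = z q := fun h' => h fun q hq => (h' q hq).symm
    rw [if_neg h, if_neg h', star_zero]

theorem blockOp_isUnitary (t : Q) (u : (Q → Bool) → Matrix Bool Bool ℂ) (hu : IndepOf t u)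
    (h : ∀ z, u z ∈ Matrix.unitaryGroup Bool ℂ) :
    blockOp t u ∈ Matrix.unitaryGroup (Q → Bool) ℂ := by
  rw [Matrix.mem_unitaryGroup_iff, Matrix.star_eq_conjTranspose, blockOp_conjTranspose t u hu,
    blockOp_mul]
  · rw [← blockOp_one t]
    congr 1; funext z
    exact (Matrix.mem_unitaryGroup_iff).1 (h z)
  · intro z b; simp only [hu z b]

/-- The bit flip. -/
def flipMat : Matrix Bool Bool ℂ := Matrix.of fun a b => if a = b then 0 else 1

/-- The Hadamard matrix. -/
def hadamard : Matrix Bool Bool ℂ :=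
  Matrix.of fun a b => ((1 / Real.sqrt 2 : ℝ) : ℂ) * if a && b then -1 else 1

theorem flipMat_mul_self : flipMat * flipMat = 1 := by
  ext a b
  cases a <;> cases b <;> simp [flipMat, Matrix.mul_apply]

theorem inv_sqrt_two_mul_self :
    ((1 / Real.sqrt 2 : ℝ) : ℂ) * ((1 / Real.sqrt 2 : ℝ) : ℂ) = 1 / 2 := by
  rw [← Complex.ofReal_mul, div_mul_div_comm, Real.mul_self_sqrt (by norm_num)]
  norm_num

theorem hadamard_mul_self : hadamard * hadamard = 1 := by
  ext a b
  have h := inv_sqrt_two_mul_self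
  cases a <;> cases b <;> simp [hadamard, Matrix.mul_apply] at h ⊢ <;> rw [h] <;> norm_num

theorem hadamard_conjTranspose : hadamardᴴ = hadamard := by
  ext a b
  cases a <;> cases b <;> simp [hadamard, Matrix.conjTranspose_apply]

theorem hadamard_mem : hadamard ∈ Matrix.unitaryGroup Bool ℂ := by
  rw [Matrix.mem_unitaryGroup_iff, Matrix.star_eq_conjTranspose, hadamard_conjTranspose,
    hadamard_mul_self]

theorem flipMat_mem : flipMat ∈ Matrix.unitaryGroup Bool ℂ := by
  rw [Matrix.mem_unitaryGroup_iff, Matrix.star_eq_conjTranspose]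
  have : flipMatᴴ = flipMat := by
    ext a b
    cases a <;> cases b <;> simp [flipMat, Matrix.conjTranspose_apply]
  rw [this, flipMat_mul_self]

theorem diagonal_mem_unitary {ι : Type} [Fintype ι] [DecidableEq ι] (d : ι → ℂ)
    (h : ∀ i, d i * star (d i) = 1) : Matrix.diagonal d ∈ Matrix.unitaryGroup ι ℂ := by
  rw [Matrix.mem_unitaryGroup_iff, Matrix.star_eq_conjTranspose, Matrix.diagonal_conjTranspose,
    Matrix.diagonal_mul_diagonal, ← Matrix.diagonal_one]
  congr 1; funext i; exact h i

/-- Flip the qubit `t` when `g z` holds. -/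
def flipOp (t : Q) (g : (Q → Bool) → Bool) : Op (Q → Bool) :=
  blockOp t fun z => if g z then flipMat else 1

theorem flipOp_mulVec (t : Q) (g : (Q → Bool) → Bool) (ψ : (Q → Bool) → ℂ) (z : Q → Bool) :
    (flipOp t g *ᵥ ψ) z = ψ (Function.update z t (xor (z t) (g z))) := by
  rw [flipOp, blockOp_mulVec]
  cases hg : g z <;> cases hz : z t <;> simp [flipMat]

theorem flipOp_mul_apply (t : Q) (g : (Q → Bool) → Bool) (M : Op (Q → Bool)) (z z' : Q → Bool) :
    (flipOp t g * M) z z' = M (Function.update z t (xor (z t) (g z))) z' := by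
  have := flipOp_mulVec t g (fun y => M y z') z
  rw [← this]; rfl

theorem flipOp_mul_self (t : Q) (g : (Q → Bool) → Bool) (hg : IndepOf t g) :
    flipOp t g * flipOp t g = 1 := by
  rw [flipOp, blockOp_mul, ← blockOp_one t]
  · congr 1; funext z
    split_ifs <;> simp [flipMat_mul_self]
  · intro z b; simp only [hg z b]

theorem flipOp_conjTranspose (t : Q) (g : (Q → Bool) → Bool) (hg : IndepOf t g) :
    (flipOp t g)ᴴ = flipOp t g := by
  rw [flipOp, blockOp_conjTranspose]
  · congr 1; funext z
    have : flipMatᴴ = flipMat := by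
      ext a b
      cases a <;> cases b <;> simp [flipMat, Matrix.conjTranspose_apply]
    split_ifs <;> simp [this]
  · intro z b; simp only [hg z b]

/-- Conjugating a diagonal operator by a controlled flip permutes its entries. -/
theorem flipOp_conj_diagonal (t : Q) (g : (Q → Bool) → Bool) (hg : IndepOf t g)
    (d : (Q → Bool) → ℂ) :
    flipOp t g * Matrix.diagonal d * flipOp t g
      = Matrix.diagonal fun z => d (Function.update z t (xor (z t) (g z))) := by
  have h : flipOp t g * Matrix.diagonal d
      = (Matrix.diagonal fun z => d (Function.update z t (xor (z t) (g z)))) * flipOp t g := by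
    ext z z'
    rw [flipOp_mul_apply, Matrix.diagonal_mul]
    have := flipOp_mul_apply t g 1 z z'
    rw [mul_one] at this
    rw [this, Matrix.diagonal_apply, Matrix.one_apply]
    split_ifs <;> simp
  rw [h, Matrix.mul_assoc, flipOp_mul_self t g hg, Matrix.mul_one]

/-- Links `liftGate` to the block calculus, so that later circuit identities can be checked on 2×2
matrices. -/
theorem blockOp_two (u : Bool → Matrix Bool Bool ℂ) (e : Fin 2 ↪ Q) :
    liftGate e (blockOp (1 : Fin 2) fun y => u (y 0)) = blockOp (e 1) fun z => u (z (e 0)) := by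
  ext z z'
  simp only [liftGate, blockOp, Matrix.of_apply]
  have hr : ∀ q, q ∉ Set.range e ↔ (q ≠ e 0 ∧ q ≠ e 1) := by
    intro q
    simp only [Set.mem_range, Fin.exists_fin_two, not_or]
    tauto
  have h01 : e 0 ≠ e 1 := fun h => absurd (e.injective h) (by decide)
  by_cases h : ∀ q, q ≠ e 1 → z q = z' q
  · rw [if_pos h, if_pos, if_pos]
    · intro q hq
      have : q = 0 := by omega
      subst this
      exact h _ h01
    · intro q hq
      exact h q ((hr q).1 hq).2
  · rw [if_neg h]
    split_ifs with h1 h2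
    · exfalso
      apply h
      intro q hq
      by_cases hq0 : q = e 0
      · rw [hq0]; exact h2 0 (by decide)
      · exact h1 q ((hr q).2 ⟨hq0, hq⟩)
    · rfl
    · rfl

end Blocks

/-! ### Products of two-qubit gates: controlled phases and Toffoli gates -/

section Synthesis

variable {Q : Type} [Fintype Q] [DecidableEq Q]

/-- A two-qubit gate together with the qubits it acts on. -/
abbrev Gate (Q : Type) := (Fin 2 ↪ Q) × Matrix.unitaryGroup (Fin 2 → Bool) ℂ

/-- The operator of a list of gates; the head is applied first. -/
def gateProd : List (Gate Q) → Op (Q → Bool)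
  | [] => 1
  | g :: l => gateProd l * liftGate g.1 (g.2 : Op (Fin 2 → Bool))

theorem gateProd_append (l l' : List (Gate Q)) :
    gateProd (l ++ l') = gateProd l' * gateProd l := by
  induction l with
  | nil => simp [gateProd]
  | cons g l ih => simp [gateProd, ih, Matrix.mul_assoc]

/-- `M` is a product of at most `k` two-qubit gates. -/
def Synth (k : ℕ) (M : Op (Q → Bool)) : Prop :=
  ∃ l : List (Gate Q), l.length ≤ k ∧ gateProd l = M

theorem Synth.one : Synth 0 (1 : Op (Q → Bool)) := ⟨[], by simp, rfl⟩

theorem Synth.mono {k k' : ℕ} {M : Op (Q → Bool)} (h : Synth k M) (hk : k ≤ k') : Synth k' M := by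
  obtain ⟨l, hl, hM⟩ := h
  exact ⟨l, hl.trans hk, hM⟩

theorem Synth.mul {k k' : ℕ} {M M' : Op (Q → Bool)} (h : Synth k M) (h' : Synth k' M') :
    Synth (k + k') (M * M') := by
  obtain ⟨l, hl, rfl⟩ := h
  obtain ⟨l', hl', rfl⟩ := h'
  exact ⟨l' ++ l, by simp; omega, gateProd_append _ _⟩

/-- The embedding of two distinct qubits. -/
def pairEmb (c t : Q) (h : c ≠ t) : Fin 2 ↪ Q where
  toFun := ![c, t]
  inj' := by
    intro i j hij
    fin_cases i <;> fin_cases j <;> simp_all [eq_comm]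

/-- The source of all gates used below. A single-qubit gate is the case of constant `u`, with `c` a
spectator, because only two-qubit gates are available. -/
theorem Synth.block {c t : Q} (h : c ≠ t) (u : Bool → Matrix Bool Bool ℂ)
    (hu : ∀ b, u b ∈ Matrix.unitaryGroup Bool ℂ) :
    Synth 1 (blockOp t fun z => u (z c)) := by
  refine ⟨[(pairEmb c t h, ⟨blockOp (1 : Fin 2) fun y => u (y 0), ?_⟩)], by simp, ?_⟩
  · apply blockOp_isUnitary
    · intro z b; simp
    · intro z; exact hu _
  · simp only [gateProd, Matrix.one_mul]
    rw [blockOp_two]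
    rfl

omit [Fintype Q] in
theorem indep_apply {c t : Q} (h : c ≠ t) {α : Type} (u : Bool → α) :
    IndepOf t fun z : Q → Bool => u (z c) := by
  intro z b; simp [h]

theorem exp_I_mul_star (φ : ℝ) :
    Complex.exp (φ * Complex.I) * star (Complex.exp (φ * Complex.I)) = 1 := by
  have := Complex.mul_conj (Complex.exp (φ * Complex.I))
  rw [Complex.normSq_eq_norm_sq, Complex.norm_exp_ofReal_mul_I] at this
  simpa using this

theorem Synth.diag {c t : Q} (h : c ≠ t) (d : Bool → Bool → ℂ)
    (hd : ∀ a b, d a b * star (d a b) = 1) :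
    Synth 1 (Matrix.diagonal fun z : Q → Bool => d (z c) (z t)) := by
  have := Synth.block h (fun a => Matrix.diagonal (d a))
    (fun a => diagonal_mem_unitary _ (hd a))
  convert this using 1
  rw [← blockOp_diagonal t]
  congr 1; funext z
  simp [h]

/-- The phase `exp(iφ)` on the condition `p`. -/
def phaseIf (φ : ℝ) (p : Prop) [Decidable p] : ℂ :=
  if p then Complex.exp (φ * Complex.I) else 1

theorem phaseIf_mul_star (φ : ℝ) (p : Prop) [Decidable p] :
    phaseIf φ p * star (phaseIf φ p) = 1 := by
  unfold phaseIf
  split_ifs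
  · exact exp_I_mul_star φ
  · simp

theorem phaseIf_neg (φ : ℝ) (p : Prop) [Decidable p] :
    star (phaseIf φ p) = phaseIf (-φ) p := by
  unfold phaseIf
  split_ifs
  · change (starRingEnd ℂ) _ = _
    rw [← Complex.exp_conj]; simp
  · simp

theorem Synth.flip {c t : Q} (h : c ≠ t) (v : Bool) :
    Synth 1 (flipOp t fun z => z c == v) := by
  refine Synth.block h (fun b => if (b == v) = true then flipMat else 1) fun b => ?_
  split_ifs
  · exact flipMat_mem
  · exact one_mem _

/-- Doubly controlled phases from two-qubit gates. -/
theorem Synth.ccphase {c q t : Q} (hcq : c ≠ q) (hct : c ≠ t) (hqt : q ≠ t) (v : Bool) (φ : ℝ) :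
    Synth 5 (Matrix.diagonal fun z : Q → Bool =>
      phaseIf φ (z c = true ∧ z q = v ∧ z t = true)) := by
  -- On bits, `[c][q = v] = ([c] + [q = v] - [c xor q = v]) / 2`. Multiplied by `[t]`, each term is
  -- a two-qubit phase, the last one after a controlled flip of `q`.
  have h1 := Synth.diag hct (fun a b => phaseIf (φ / 2) (a = true ∧ b = true))
    (fun a b => phaseIf_mul_star _ _)
  have h2 := Synth.diag hqt (fun a b => phaseIf (φ / 2) (a = v ∧ b = true))
    (fun a b => phaseIf_mul_star _ _)
  have h3 := Synth.diag hqt (fun a b => phaseIf (-φ / 2) (a = v ∧ b = true))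
    (fun a b => phaseIf_mul_star _ _)
  have hf := Synth.flip hcq true
  have h4 := (hf.mul h3).mul hf
  rw [flipOp_conj_diagonal q _ (indep_apply hcq fun b => b == true)] at h4
  have h5 := (h1.mul h2).mul h4
  rw [Matrix.diagonal_mul_diagonal, Matrix.diagonal_mul_diagonal] at h5
  refine (congrArg (Synth 5) (congrArg Matrix.diagonal (funext fun z => ?_))).mpr h5
  have e1 : Complex.exp (φ * Complex.I)
      = Complex.exp (((φ : ℂ) / 2) * Complex.I) * Complex.exp (((φ : ℂ) / 2) * Complex.I) := by
    rw [← Complex.exp_add]; congr 1; ring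
  have e2 : Complex.exp (((φ : ℂ) / 2) * Complex.I) * Complex.exp ((-(φ : ℂ) / 2) * Complex.I)
      = 1 := by
    rw [← Complex.exp_add, ← Complex.exp_zero]; congr 1; ring
  cases hc : z c <;> cases hq : z q <;> cases ht : z t <;> cases v <;>
    simp [phaseIf, hqt.symm, ht, e1, e2]

theorem hadamard_conj_sign (p : Prop) [Decidable p] :
    hadamard * (Matrix.diagonal fun b : Bool => phaseIf Real.pi (p ∧ b = true)) * hadamard
      = if p then flipMat else 1 := by
  have h := inv_sqrt_two_mul_self
  split_ifs with hp
  · ext a b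
    cases a <;> cases b <;>
      simp [hadamard, Matrix.mul_apply, phaseIf, hp, flipMat, Matrix.diagonal_apply] at h ⊢ <;>
      (rw [h]; norm_num)
  · simp [phaseIf, hp, hadamard_mul_self]

/-- The Toffoli gate with a control of either polarity. -/
theorem Synth.toffoli {c q t : Q} (hcq : c ≠ q) (hct : c ≠ t) (hqt : q ≠ t) (v : Bool) :
    Synth 7 (flipOp t fun z => z c && (z q == v)) := by
  -- A flip of `t` is its sign phase conjugated by the Hadamard matrix, so only the phase needs
  -- controls.
  have hH : Synth 1 (blockOp t fun _ : Q → Bool => hadamard) :=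
    Synth.block hct (fun _ => hadamard) (fun _ => hadamard_mem)
  have h := (hH.mul (Synth.ccphase hcq hct hqt v Real.pi)).mul hH
  convert h using 1
  rw [← blockOp_diagonal t, blockOp_mul, blockOp_mul]
  · unfold flipOp
    congr 1; funext z
    have := hadamard_conj_sign (z c = true ∧ z q = v)
    simp only [Function.update_self, Function.update_of_ne hct, Function.update_of_ne hqt]
    rw [show (fun b : Bool => phaseIf Real.pi (z c = true ∧ z q = v ∧ b = true))
      = fun b : Bool => phaseIf Real.pi ((z c = true ∧ z q = v) ∧ b = true) from by
        funext b; unfold phaseIf; simp only [and_assoc], this]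
    simp
  · intro z b; rfl
  · intro z b; simp

end Synthesis

end GQPE

end

noncomputable section

namespace GQPE

/-! ### Circuits with work qubits that return to zero -/

section CleanSynthesis

variable {P : Type} [Fintype P] [DecidableEq P] {W : ℕ}

/-- `N` acts as `M` on the qubits `P` when the work qubits are in state `0`, and leaves the work
qubits in state `0`. -/
def CleanExt (N : Op (P ⊕ Fin W → Bool)) (M : Op (P → Bool)) : Prop :=
  ∀ z z' : P ⊕ Fin W → Bool, (∀ j, z' (Sum.inr j) = false) →
    N z z' = if ∀ j, z (Sum.inr j) = false then M (z ∘ Sum.inl) (z' ∘ Sum.inl) else 0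

theorem sum_clean {P R β : Type} [Fintype P] [DecidableEq P] [Fintype R] [DecidableEq R]
    [AddCommMonoid β] [∀ z : P ⊕ R → Bool, Decidable (∀ j, z (Sum.inr j) = false)]
    (F : (P ⊕ R → Bool) → β) :
    (∑ z, if ∀ j, z (Sum.inr j) = false then F z else 0)
      = ∑ x : P → Bool, F (Sum.elim x fun _ => false) := by
  rw [← Finset.sum_filter]
  symm
  apply Finset.sum_bij (fun x _ => Sum.elim x fun _ => false)
  · intro x _; simp
  · intro x _ x' _ h
    funext i
    simpa using congrFun h (Sum.inl i)
  · intro z hz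
    simp only [Finset.mem_filter, Finset.mem_univ, true_and] at hz
    refine ⟨z ∘ Sum.inl, Finset.mem_univ _, ?_⟩
    funext i
    rcases i with i | i <;> simp [hz]
  · intros; rfl

/-- On clean input `N'` produces only strings with clean work qubits, and these index exactly the
columns of `N` that are known. -/
theorem CleanExt.mul {N N' : Op (P ⊕ Fin W → Bool)} {M M' : Op (P → Bool)}
    (h : CleanExt N M) (h' : CleanExt N' M') : CleanExt (N * N') (M * M') := by
  intro z z' hz'
  rw [Matrix.mul_apply]
  have : ∀ y, N z y * N' y z' = if ∀ j, y (Sum.inr j) = false then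
      N z y * M' (y ∘ Sum.inl) (z' ∘ Sum.inl) else 0 := by
    intro y
    rw [h' y z' hz']
    split_ifs <;> simp
  simp_rw [this]
  rw [sum_clean fun y => N z y * M' (y ∘ Sum.inl) (z' ∘ Sum.inl)]
  have h2 : ∀ x : P → Bool, N z (Sum.elim x fun _ => false)
      = if ∀ j, z (Sum.inr j) = false then M (z ∘ Sum.inl) x else 0 := by
    intro x
    rw [h _ _ (by simp)]
    simp
  simp_rw [h2]
  split_ifs with hz
  · rw [Matrix.mul_apply]
    simp
  · simp

omit [DecidableEq P] in
theorem CleanExt.one : CleanExt (1 : Op (P ⊕ Fin W → Bool)) (1 : Op (P → Bool)) := by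
  intro z z' hz'
  rw [Matrix.one_apply, Matrix.one_apply]
  by_cases h : z = z'
  · subst h; simp [hz']
  · rw [if_neg h]
    split_ifs with h1 h2
    · exfalso; apply h
      funext i
      rcases i with i | i
      · exact congrFun h2 i
      · rw [h1, hz']
    · rfl
    · rfl

theorem CleanExt.block (t : P) (u : (P → Bool) → Matrix Bool Bool ℂ) :
    CleanExt (W := W) (blockOp (Sum.inl t) fun z => u (z ∘ Sum.inl)) (blockOp t u) := by
  intro z z' hz'
  simp only [blockOp, Matrix.of_apply, Function.comp_apply]
  by_cases h : ∀ j, z (Sum.inr j) = false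
  · rw [if_pos h]
    refine if_congr ?_ rfl rfl
    constructor
    · intro h1 q hq
      exact h1 _ (by simpa using hq)
    · intro h1 q hq
      rcases q with q | q
      · exact h1 q (by simpa using hq)
      · rw [h, hz']
  · rw [if_neg h, if_neg]
    intro h1
    apply h
    intro j
    rw [h1 _ (by simp), hz']

/-- `M` is unitary, and `M` and its adjoint are implemented on the qubits `P` by at most `k`
two-qubit gates, using `W` work qubits which start and end in state `0`. -/
def CleanSynth (W k : ℕ) (M : Op (P → Bool)) : Prop :=
  M ∈ Matrix.unitaryGroup (P → Bool) ℂ ∧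
    (∃ N : Op (P ⊕ Fin W → Bool), Synth k N ∧ CleanExt N M) ∧
      ∃ N : Op (P ⊕ Fin W → Bool), Synth k N ∧ CleanExt N Mᴴ

theorem CleanSynth.mono {k k' : ℕ} {M : Op (P → Bool)} (h : CleanSynth W k M) (hk : k ≤ k') :
    CleanSynth W k' M := by
  obtain ⟨h0, ⟨N, h1, h2⟩, N', h3, h4⟩ := h
  exact ⟨h0, ⟨N, h1.mono hk, h2⟩, N', h3.mono hk, h4⟩

theorem CleanSynth.one : CleanSynth W 0 (1 : Op (P → Bool)) :=
  ⟨one_mem _, ⟨1, Synth.one, CleanExt.one⟩, 1, Synth.one, by simpa using CleanExt.one⟩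

theorem CleanSynth.mul {k k' : ℕ} {M M' : Op (P → Bool)} (h : CleanSynth W k M)
    (h' : CleanSynth W k' M') : CleanSynth W (k + k') (M * M') := by
  obtain ⟨h0, ⟨N, h1, h2⟩, N₁, h3, h4⟩ := h
  obtain ⟨h0', ⟨N', h1', h2'⟩, N₁', h3', h4'⟩ := h'
  refine ⟨mul_mem h0 h0', ⟨N * N', h1.mul h1', h2.mul h2'⟩, N₁' * N₁, ?_, ?_⟩
  · rw [add_comm]; exact h3'.mul h3
  · rw [Matrix.conjTranspose_mul]; exact h4'.mul h4

theorem CleanSynth.conjTranspose {k : ℕ} {M : Op (P → Bool)} (h : CleanSynth W k M) :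
    CleanSynth W k Mᴴ := by
  obtain ⟨h0, h1, h2⟩ := h
  exact ⟨(⟨M, h0⟩ : Matrix.unitaryGroup (P → Bool) ℂ)⁻¹.2, h2,
    by rwa [Matrix.conjTranspose_conjTranspose]⟩

theorem CleanSynth.block {c t : P} (h : c ≠ t) (u : Bool → Matrix Bool Bool ℂ)
    (hu : ∀ b, u b ∈ Matrix.unitaryGroup Bool ℂ) :
    CleanSynth W 1 (blockOp t fun z => u (z c)) := by
  have h' : (Sum.inl c : P ⊕ Fin W) ≠ Sum.inl t := by simpa using h
  refine ⟨blockOp_isUnitary t _ (indep_apply h u) fun z => hu _, ⟨_, Synth.block h' u hu, ?_⟩,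
    ⟨_, Synth.block h' (fun b => (u b)ᴴ) fun b => ?_, ?_⟩⟩
  · exact CleanExt.block t fun z => u (z c)
  · have := (⟨u b, hu b⟩ : Matrix.unitaryGroup Bool ℂ)⁻¹.2
    exact this
  · rw [blockOp_conjTranspose t _ (indep_apply h u)]
    exact CleanExt.block t fun z => (u (z c))ᴴ

theorem CleanSynth.flip {c t : P} (h : c ≠ t) (v : Bool) :
    CleanSynth W 1 (flipOp t fun z => z c == v) := by
  refine CleanSynth.block h (fun b => if (b == v) = true then flipMat else 1) fun b => ?_
  split_ifs
  · exact flipMat_mem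
  · exact one_mem _

theorem CleanSynth.diag {c t : P} (h : c ≠ t) (d : Bool → Bool → ℂ)
    (hd : ∀ a b, d a b * star (d a b) = 1) :
    CleanSynth W 1 (Matrix.diagonal fun z : P → Bool => d (z c) (z t)) := by
  have := CleanSynth.block (W := W) h (fun a => Matrix.diagonal (d a))
    (fun a => diagonal_mem_unitary _ (hd a))
  convert this using 1
  rw [← blockOp_diagonal t]
  congr 1; funext z
  simp [h]

/-- A chain of Toffoli gates: the phase controlled by the work qubit `c` and a list of literals. -/
theorem exists_synth_phase_chain [Nonempty P] (φ : ℝ) (l : List (P × Bool)) :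
    ∀ (k : ℕ), k + l.length ≤ W → ∀ c : Fin W, c.val < k →
      ∃ d : (P ⊕ Fin W → Bool) → ℂ, Synth (14 * l.length + 1) (Matrix.diagonal d) ∧
        ∀ z, (∀ j : Fin W, k ≤ j.val → z (Sum.inr j) = false) →
          d z = phaseIf φ (z (Sum.inr c) = true ∧ ∀ p ∈ l, z (Sum.inl p.1) = p.2) := by
  induction l with
  | nil =>
    intro k _ c _
    obtain ⟨p⟩ := ‹Nonempty P›
    refine ⟨_, Synth.diag (c := Sum.inl p) (t := Sum.inr c) (by simp)
      (fun _ b => phaseIf φ (b = true)) (fun _ _ => phaseIf_mul_star _ _), ?_⟩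
    intro z _
    simp [phaseIf]
  | cons a l ih =>
    intro k hk c hc
    simp only [List.length_cons] at hk
    -- The first unused work qubit stores the conjunction of `c` with the first literal and acts as
    -- control for the remaining ones; the second Toffoli gate erases it.
    let t : Fin W := ⟨k, by omega⟩
    obtain ⟨d, hd, hd'⟩ := ih (k + 1) (by omega) t (by simp [t])
    have hct : (Sum.inr c : P ⊕ Fin W) ≠ Sum.inr t := by
      simp only [ne_eq, Sum.inr.injEq, t, Fin.ext_iff]; omega
    have hqt : (Sum.inl a.1 : P ⊕ Fin W) ≠ Sum.inr t := by simp
    have hT := Synth.toffoli (c := (Sum.inr c : P ⊕ Fin W)) (q := Sum.inl a.1) (t := Sum.inr t)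
      (by simp) hct hqt a.2
    have h := (hT.mul hd).mul hT
    rw [flipOp_conj_diagonal _ _ (by intro z b; simp [hct])] at h
    refine ⟨_, h.mono (by simp only [List.length_cons]; omega), ?_⟩
    intro z hz
    rw [hd']
    · simp only [Function.update_self, hz t (by simp [t]), List.forall_mem_cons, phaseIf]
      refine if_congr ?_ rfl rfl
      simp [and_assoc]
    · intro j hj
      have hjt : j ≠ t := by
        rintro rfl; simp [t] at hj
      rw [Function.update_of_ne (by simpa using hjt)]
      exact hz j (by omega)

/-- Phases controlled by arbitrarily many literals. -/
theorem CleanSynth.mcphase [Nonempty P] (φ : ℝ) (l : List (P × Bool)) (hl : l.length + 1 ≤ W) :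
    CleanSynth W (14 * l.length + 3)
      (Matrix.diagonal fun z : P → Bool => phaseIf φ (∀ p ∈ l, z p.1 = p.2)) := by
  have key : ∀ φ : ℝ, ∃ N : Op (P ⊕ Fin W → Bool), Synth (14 * l.length + 3) N ∧
      CleanExt N (Matrix.diagonal fun z : P → Bool => phaseIf φ (∀ p ∈ l, z p.1 = p.2)) := by
    intro φ
    let c : Fin W := ⟨0, by omega⟩
    obtain ⟨d, hd, hd'⟩ := exists_synth_phase_chain (P := P) φ l 1 (by omega) c (by simp [c])
    obtain ⟨p⟩ := ‹Nonempty P›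
    -- The chain needs an initial control that holds, so one work qubit is raised to `1` and lowered
    -- again at the end.
    have hX : Synth 1 (flipOp (Sum.inr c : P ⊕ Fin W) fun _ => true) :=
      Synth.block (c := Sum.inl p) (by simp) (fun _ => flipMat) (fun _ => flipMat_mem)
    have h := (hX.mul hd).mul hX
    rw [flipOp_conj_diagonal _ _ (by intro z b; rfl)] at h
    refine ⟨_, h.mono (by omega), ?_⟩
    intro z z' hz'
    rw [Matrix.diagonal_apply, Matrix.diagonal_apply]
    by_cases hzz : z = z'
    · subst hzz
      rw [if_pos rfl, if_pos hz', if_pos rfl, hd']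
      · simp [phaseIf, hz']
      · intro j hj
        have hjc : j ≠ c := by
          rintro rfl; simp [c] at hj
        rw [Function.update_of_ne (by simpa using hjc)]
        exact hz' j
    · rw [if_neg hzz]
      split_ifs with h1 h2
      · exfalso; apply hzz
        funext i
        rcases i with i | i
        · exact congrFun h2 i
        · rw [h1, hz']
      · rfl
      · rfl
  refine ⟨diagonal_mem_unitary _ fun z => phaseIf_mul_star _ _, key φ, ?_⟩
  obtain ⟨N, h1, h2⟩ := key (-φ)
  refine ⟨N, h1, ?_⟩
  rw [Matrix.diagonal_conjTranspose]
  have : (star fun z : P → Bool => phaseIf φ (∀ p ∈ l, z p.1 = p.2))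
      = fun z => phaseIf (-φ) (∀ p ∈ l, z p.1 = p.2) :=
    funext fun z => phaseIf_neg φ (∀ p ∈ l, z p.1 = p.2)
  rw [this]
  exact h2

end CleanSynthesis

end GQPE

end

/-! ### Controlled rotations, product states and exact amplitude amplification -/

noncomputable section

namespace GQPE

/-- The plane rotation by the angle `φ`. -/
def rotMat (φ : ℝ) : Matrix Bool Bool ℂ :=
  Matrix.of fun a b =>
    if a = b then ((Real.cos φ : ℝ) : ℂ) else if a then ((Real.sin φ : ℝ) : ℂ) else
      ((-Real.sin φ : ℝ) : ℂ)

/-- The eigenbasis of the plane rotations. -/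
def rotBasis : Matrix Bool Bool ℂ :=
  Matrix.of fun a b => ((1 / Real.sqrt 2 : ℝ) : ℂ) *
    if a then (if b then Complex.I else -Complex.I) else 1

theorem rotBasis_mem : rotBasis ∈ Matrix.unitaryGroup Bool ℂ := by
  rw [Matrix.mem_unitaryGroup_iff]
  have h := inv_sqrt_two_mul_self
  have h2 : ((Real.sqrt 2 : ℝ) : ℂ)⁻¹ * ((Real.sqrt 2 : ℝ) : ℂ)⁻¹ = 1 / 2 := by simpa using h
  ext a b
  cases a <;> cases b <;>
    simp [rotBasis, Matrix.mul_apply, Matrix.star_apply] <;>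
    ring_nf <;> simp [pow_two, h2]

theorem rotBasis_conj (φ : ℝ) :
    rotBasis * (Matrix.diagonal fun b : Bool => Complex.exp (((if b then -φ else φ : ℝ) : ℂ) * Complex.I))
      * rotBasisᴴ = rotMat φ := by
  have h := inv_sqrt_two_mul_self
  have h2 : ((Real.sqrt 2 : ℝ) : ℂ)⁻¹ ^ 2 = 1 / 2 := by rw [pow_two]; simpa using h
  ext a b
  cases a <;> cases b <;>
    simp [rotBasis, Matrix.mul_apply, rotMat, Matrix.diagonal_apply, Complex.cos, Complex.sin] <;>
    ring_nf <;> simp only [Complex.I_sq, h2] <;> ring_nf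

theorem rotMat_mem (φ : ℝ) : rotMat φ ∈ Matrix.unitaryGroup Bool ℂ := by
  rw [← rotBasis_conj]
  refine mul_mem (mul_mem rotBasis_mem (diagonal_mem_unitary _ fun b => exp_I_mul_star _)) ?_
  exact (⟨rotBasis, rotBasis_mem⟩ : Matrix.unitaryGroup Bool ℂ)⁻¹.2

section

variable {P : Type} [Fintype P] [DecidableEq P] {W : ℕ}

/-- The rotation of the qubit `t` by the angle `φ`, controlled by the literals `l`. -/
def ctlRot (t : P) (l : List (P × Bool)) (φ : ℝ) : Op (P → Bool) :=
  blockOp t fun z : P → Bool => if ∀ p ∈ l, z p.1 = p.2 then rotMat φ else 1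

/-- Rotations controlled by arbitrarily many literals. -/
theorem CleanSynth.mcrot (c t : P) (hct : c ≠ t) (φ : ℝ) (l : List (P × Bool))
    (hl : l.length + 2 ≤ W) (ht : ∀ p ∈ l, p.1 ≠ t) :
    CleanSynth W (28 * l.length + 36) (ctlRot t l φ) := by
  unfold ctlRot
  have : Nonempty P := ⟨c⟩
  -- In the eigenbasis of the rotations only the phases `exp(±iφ)` need controls. The change of
  -- basis is applied unconditionally and cancels when a literal fails.
  have hS := CleanSynth.block (W := W) hct (fun _ => rotBasis) (fun _ => rotBasis_mem)
  have h1 := CleanSynth.mcphase (W := W) φ ((t, false) :: l) hl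
  have h2 := CleanSynth.mcphase (W := W) (-φ) ((t, true) :: l) hl
  have hS' := hS.conjTranspose
  rw [blockOp_conjTranspose t _ (fun z b => rfl)] at hS'
  have h := (hS.mul (h1.mul h2)).mul hS'
  rw [Matrix.diagonal_mul_diagonal, ← blockOp_diagonal t, blockOp_mul _ _ _ (fun z b => by simp),
    blockOp_mul _ _ _ (fun z b => rfl)] at h
  refine (congrArg (CleanSynth W (28 * l.length + 36)) ?_).mpr
    (h.mono (by simp only [List.length_cons]; omega))
  congr 1; funext z
  have hl' : ∀ b, (∀ p ∈ l, Function.update z t b p.1 = p.2) ↔ ∀ p ∈ l, z p.1 = p.2 := by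
    intro b
    refine forall₂_congr fun p hp => ?_
    rw [Function.update_of_ne (ht p hp)]
  simp only [List.forall_mem_cons, Function.update_self, hl', phaseIf]
  split_ifs with hz
  · rw [← rotBasis_conj]
    congr 3
    funext b
    have hz' : (∀ p ∈ l, z p.1 = p.2) ↔ True := iff_true_intro hz
    simp only [hz']
    cases b <;> simp
  · simp only [hz, and_false, if_false, mul_one]
    have := (Matrix.mem_unitaryGroup_iff).1 rotBasis_mem
    rw [Matrix.star_eq_conjTranspose] at this
    simp [this]

/-- A product of real single-qubit states. -/
def productState (φ : P → ℝ) (z : P → Bool) : ℂ :=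
  ∏ q, if z q then ((Real.sin (φ q) : ℝ) : ℂ) else ((Real.cos (φ q) : ℝ) : ℂ)

/-- The all-zero basis vector. -/
def zeroKet (P : Type) [Fintype P] : (P → Bool) → ℂ := Pi.single (fun _ => false) 1

omit [DecidableEq P] in
theorem productState_zero :
    productState (fun _ : P => 0) = zeroKet P := by
  unfold zeroKet
  funext z
  rw [Pi.single_apply]
  split_ifs with h
  · subst h; simp [productState]
  · have : ∃ q, z q = true := by
      by_contra! hc
      exact h (funext fun q => by simpa using hc q)
    obtain ⟨q, hq⟩ := this
    exact Finset.prod_eq_zero (Finset.mem_univ q) (by simp [hq])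

theorem rot_productState (φ : P → ℝ) (q : P) (hq : φ q = 0) (θ : ℝ) :
    blockOp q (fun _ => rotMat θ) *ᵥ productState φ = productState (Function.update φ q θ) := by
  funext z
  have hup : ∀ (φ : P → ℝ) (z : P → Bool), productState φ z
      = (if z q then ((Real.sin (φ q) : ℝ) : ℂ) else ((Real.cos (φ q) : ℝ) : ℂ)) *
        ∏ p ∈ Finset.univ.erase q,
          if z p then ((Real.sin (φ p) : ℝ) : ℂ) else ((Real.cos (φ p) : ℝ) : ℂ) := by
    intro φ z
    exact (Finset.mul_prod_erase _ _ (Finset.mem_univ q)).symm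
  rw [blockOp_mulVec, Fintype.sum_bool, hup, hup φ, hup (Function.update φ q θ)]
  have e1 : ∀ b, (∏ p ∈ Finset.univ.erase q,
        if Function.update z q b p then ((Real.sin (φ p) : ℝ) : ℂ) else ((Real.cos (φ p) : ℝ) : ℂ))
      = ∏ p ∈ Finset.univ.erase q,
        if z p then ((Real.sin (φ p) : ℝ) : ℂ) else ((Real.cos (φ p) : ℝ) : ℂ) := by
    intro b
    refine Finset.prod_congr rfl fun p hp => ?_
    rw [Function.update_of_ne (Finset.ne_of_mem_erase hp)]
  have e2 : (∏ p ∈ Finset.univ.erase q,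
        if z p then ((Real.sin (Function.update φ q θ p) : ℝ) : ℂ)
          else ((Real.cos (Function.update φ q θ p) : ℝ) : ℂ))
      = ∏ p ∈ Finset.univ.erase q,
        if z p then ((Real.sin (φ p) : ℝ) : ℂ) else ((Real.cos (φ p) : ℝ) : ℂ) := by
    refine Finset.prod_congr rfl fun p hp => ?_
    rw [Function.update_of_ne (Finset.ne_of_mem_erase hp)]
  rw [e1, e1, e2]
  simp only [Function.update_self, hq, Real.sin_zero, Real.cos_zero]
  cases z q <;> simp [rotMat]

theorem exists_cleanSynth_productState (φ : P → ℝ) (hP : ∀ q : P, ∃ c, c ≠ q) :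
    ∃ M : Op (P → Bool), CleanSynth W (Fintype.card P) M ∧
      M *ᵥ zeroKet P = productState φ := by
  have key : ∀ s : Finset P, ∃ M : Op (P → Bool), CleanSynth W s.card M ∧
      M *ᵥ zeroKet P = productState fun q => if q ∈ s then φ q else 0 := by
    intro s
    induction s using Finset.induction_on with
    | empty => exact ⟨1, CleanSynth.one, by simpa using productState_zero.symm⟩
    | insert q s hq ih =>
      obtain ⟨M, hM, hM'⟩ := ih
      obtain ⟨c, hc⟩ := hP q
      refine ⟨_, ((CleanSynth.block hc (fun _ => rotMat (φ q)) fun _ => rotMat_mem _).mul hM).mono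
        (by rw [Finset.card_insert_of_notMem hq]; omega), ?_⟩
      rw [← Matrix.mulVec_mulVec, hM', rot_productState _ _ (by simp [hq])]
      congr 1
      funext p
      by_cases hp : p = q
      · subst hp; simp
      · simp [hp]
  obtain ⟨M, hM, hM'⟩ := key Finset.univ
  exact ⟨M, hM, by simpa using hM'⟩

/-- The reflection about the all-zero basis vector. -/
def reflectZero (P : Type) [Fintype P] : Op (P → Bool) :=
  Matrix.diagonal fun z => if z = fun _ => false then -1 else 1

theorem CleanSynth.reflectZero [Nonempty P] (hW : Fintype.card P + 1 ≤ W) :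
    CleanSynth W (14 * Fintype.card P + 3) (reflectZero P) := by
  have hS₀ := CleanSynth.mcphase (P := P) (W := W) Real.pi
    ((Finset.univ : Finset P).toList.map fun q => (q, false)) (by simpa using hW)
  rw [List.length_map, Finset.length_toList, Finset.card_univ] at hS₀
  refine (congrArg (CleanSynth W (14 * Fintype.card P + 3)) ?_).mpr hS₀
  unfold GQPE.reflectZero
  congr 1; funext z
  unfold phaseIf
  rw [Complex.exp_pi_mul_I]
  refine if_congr ?_ rfl rfl
  simp only [List.mem_map, Finset.mem_toList, Finset.mem_univ, true_and, forall_exists_index,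
    forall_apply_eq_imp_iff]
  exact ⟨fun h q => congrFun h q, fun h => funext h⟩

/-- One round of amplitude amplification is exact when the good subspace has weight `1/4`. -/
theorem amplify (V Sg : Op (P → Bool)) (hV : V ∈ Matrix.unitaryGroup (P → Bool) ℂ)
    (good : (P → Bool) → Bool)
    (hSg : Sg = Matrix.diagonal fun z => if good z then 1 else -1)
    (hp : ∑ z, (if good z then ‖(V *ᵥ zeroKet P) z‖ ^ 2 else 0) = 1 / 4) :
    (V * reflectZero P * Vᴴ * Sg * V) *ᵥ zeroKet P = fun z =>
      if good z then 2 * (V *ᵥ zeroKet P) z else 0 := by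
  set e₀ := zeroKet P with he₀
  set ψ := V *ᵥ e₀ with hψ
  have hVV : V * Vᴴ = 1 := (Matrix.mem_unitaryGroup_iff).1 hV
  have hVV' : Vᴴ * V = 1 := (Matrix.mem_unitaryGroup_iff').1 hV
  have hψcol : ∀ z, ψ z = V z fun _ => false := by
    intro z
    simp [hψ, he₀, zeroKet]
  have hnorm : ∑ z, ‖ψ z‖ ^ 2 = (1 : ℝ) := by
    have := congrFun (congrFun hVV' fun _ => false) fun _ => false
    rw [Matrix.mul_apply, Matrix.one_apply_eq] at this
    have h2 : (((∑ z, ‖ψ z‖ ^ 2 : ℝ)) : ℂ) = 1 := by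
      rw [← this]; push_cast
      refine Finset.sum_congr rfl fun z _ => ?_
      rw [Matrix.conjTranspose_apply, ← hψcol, ← Complex.conj_mul']; rfl
    exact_mod_cast h2
  set χ := Sg *ᵥ ψ with hχ
  have hχz : ∀ z, χ z = (if good z then 1 else -1) * ψ z := by
    intro z; rw [hχ, hSg, Matrix.mulVec_diagonal]
  -- The overlap of `ψ` with its sign-flipped copy `χ` is `2 · 1/4 - 1 = -1/2`, so reflecting about
  -- `ψ` yields `χ + ψ`: twice `ψ` on good strings and zero on bad ones.
  have h0 : (Vᴴ *ᵥ χ) (fun _ => false) = -(1 / 2) := by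
    have h1 : (Vᴴ *ᵥ χ) (fun _ => false)
        = ((∑ z, (if good z then ‖ψ z‖ ^ 2 else 0) * 2 - ∑ z, ‖ψ z‖ ^ 2 : ℝ) : ℂ) := by
      rw [← Finset.sum_sub_distrib]
      push_cast
      simp only [Matrix.mulVec, dotProduct]
      refine Finset.sum_congr rfl fun z _ => ?_
      rw [Matrix.conjTranspose_apply, ← hψcol, hχz]
      have := Complex.conj_mul' (ψ z)
      have h3 : star (ψ z) * ψ z = (‖ψ z‖ : ℂ) ^ 2 := this
      split_ifs
      · rw [one_mul, h3]; push_cast; ring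
      · rw [neg_one_mul, mul_neg, h3]; push_cast; ring
    rw [h1, ← Finset.sum_mul, hp, hnorm]
    push_cast; norm_num
  have hS : reflectZero P *ᵥ (Vᴴ *ᵥ χ) = Vᴴ *ᵥ χ + e₀ := by
    funext z
    rw [reflectZero, Matrix.mulVec_diagonal, Pi.add_apply, he₀, zeroKet, Pi.single_apply]
    split_ifs with hz
    · rw [hz, h0]; norm_num
    · simp
  simp only [← Matrix.mulVec_mulVec, ← hψ, ← hχ, hS]
  rw [Matrix.mulVec_add, Matrix.mulVec_mulVec, hVV, Matrix.one_mulVec, ← hψ]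
  funext z
  rw [Pi.add_apply, hχz]
  split_ifs <;> ring

end

end GQPE

end

/-! ### Filtering a product state by pairwise damping -/

noncomputable section

namespace GQPE

/-- Labels of the flag qubits: two registers of `n` qubits which record a failed filter step, one
qubit marking failure (`false`) and one qubit for tuning the success probability (`true`). -/
abbrev Flag (n : ℕ) := (Fin n ⊕ Fin n) ⊕ Bool

/-- Data register of `n` qubits together with the flags. -/
abbrev Core (n : ℕ) := Fin n ⊕ Flag n

namespace Core

variable {n : ℕ}

/-- The data qubits. -/
abbrev dat (i : Fin n) : Core n := Sum.inl i
/-- The first register of failure records. -/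
abbrev recA (i : Fin n) : Core n := Sum.inr (Sum.inl (Sum.inl i))
/-- The second register of failure records. -/
abbrev recB (i : Fin n) : Core n := Sum.inr (Sum.inl (Sum.inr i))
/-- The failure mark. -/
abbrev dead : Core n := Sum.inr (Sum.inr false)
/-- The tuning qubit. -/
abbrev tune : Core n := Sum.inr (Sum.inr true)

/-- Set the failure mark and the failure record `(i, j)` to `v`. -/
def setRec (i j : Fin n) (v : Bool) (z : Core n → Bool) : Core n → Bool :=
  Function.update (Function.update (Function.update z dead v) (recA i) v) (recB j) v

theorem setRec_recA (i j k : Fin n) (v : Bool) (z : Core n → Bool) :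
    setRec i j v z (recA k) = if k = i then v else z (recA k) := by
  by_cases h : k = i
  · subst h; simp [setRec]
  · simp [setRec, h]

theorem setRec_recB (i j k : Fin n) (v : Bool) (z : Core n → Bool) :
    setRec i j v z (recB k) = if k = j then v else z (recB k) := by
  by_cases h : k = j
  · subst h; simp [setRec]
  · simp [setRec, h]

theorem setRec_dead (i j : Fin n) (v : Bool) (z : Core n → Bool) :
    setRec i j v z dead = v := by
  simp [setRec]

/-- The literals controlling the filter step `(i, j)`. -/
def stepLits (i j : Fin n) : List (Core n × Bool) :=
  [(recA i, false), (recB j, false), (dat i, true), (dat j, true)]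

/-- The filter step `(i, j)`: if the data qubits `i` and `j` are set, rotate between the states
without failure and with a failure recorded at `(i, j)`. -/
def stepOp (i j : Fin n) (φ : ℝ) : Op (Core n → Bool) :=
  (flipOp (recA i) fun z => z dead == true) * ((flipOp (recB j) fun z => z dead == true) *
    (ctlRot dead (stepLits i j) φ *
      ((flipOp (recB j) fun z => z dead == true) * flipOp (recA i) fun z => z dead == true)))

theorem stepOp_cleanSynth {W : ℕ} (hW : 6 ≤ W) (i j : Fin n) (φ : ℝ) :
    CleanSynth W 152 (stepOp i j φ) := by
  have ha := CleanSynth.flip (W := W) (c := (dead : Core n)) (t := recA i) (by simp) true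
  have hb := CleanSynth.flip (W := W) (c := (dead : Core n)) (t := recB j) (by simp) true
  have hr := CleanSynth.mcrot (W := W) (recA i) (dead : Core n) (by simp) φ (stepLits i j)
    (by simpa [stepLits] using hW) (by simp [stepLits])
  have hlen : (stepLits i j).length = 4 := rfl
  rw [hlen] at hr
  have h := ha.mul (hb.mul (hr.mul (hb.mul ha)))
  rw [stepOp]
  exact h

/-- Conjugation by the flips turns the rotation of `dead` into a rotation in the plane of a string
without failure and its copy with `dead`, `recA i` and `recB j` all set. If the records disagree
with the mark, the control fails and the flips cancel. -/
theorem stepOp_mulVec (i j : Fin n) (φ : ℝ) (ψ : (Core n → Bool) → ℂ) (z : Core n → Bool) :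
    (stepOp i j φ *ᵥ ψ) z =
      if z (dat i) = true ∧ z (dat j) = true ∧ z (recA i) = z dead ∧ z (recB j) = z dead then
        (if z dead then ((Real.sin φ : ℝ) : ℂ) * ψ (setRec i j false z) + ((Real.cos φ : ℝ) : ℂ) * ψ z
          else ((Real.cos φ : ℝ) : ℂ) * ψ z - ((Real.sin φ : ℝ) : ℂ) * ψ (setRec i j true z))
      else ψ z := by
  have hset : z (recA i) = z dead → z (recB j) = z dead →
      setRec i j (z dead) z = z := by
    intro h1 h2
    funext q
    by_cases hb : q = recB j
    · subst hb; simp [setRec, h2]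
    by_cases ha : q = recA i
    · subst ha; simp [setRec, h1]
    by_cases hd : q = dead
    · subst hd; simp [setRec]
    simp [setRec, ha, hb]
  simp only [stepOp, ← Matrix.mulVec_mulVec]
  rw [flipOp_mulVec, flipOp_mulVec, ctlRot, blockOp_mulVec]
  simp only [flipOp_mulVec, Fintype.sum_bool]
  set y := Function.update (Function.update z (recA i) (xor (z (recA i)) (z dead == true)))
    (recB j) (xor (Function.update z (recA i) (xor (z (recA i)) (z dead == true)) (recB j))
      (Function.update z (recA i) (xor (z (recA i)) (z dead == true)) dead == true)) with hy
  have hyd : y dead = z dead := by simp [hy]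
  have hya : y (recA i) = xor (z (recA i)) (z dead) := by simp [hy]
  have hyb : y (recB j) = xor (z (recB j)) (z dead) := by simp [hy]
  have hyx : ∀ k, y (dat k) = z (dat k) := by intro k; simp [hy]
  have hback : ∀ b : Bool,
      (Function.update (Function.update (Function.update y dead b) (recB j)
        (xor (Function.update y dead b (recB j)) (Function.update y dead b dead == true))) (recA i)
        (xor (Function.update (Function.update y dead b) (recB j)
          (xor (Function.update y dead b (recB j)) (Function.update y dead b dead == true)) (recA i))
          (Function.update (Function.update y dead b) (recB j)
          (xor (Function.update y dead b (recB j)) (Function.update y dead b dead == true)) dead == true)))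
      = Function.update (Function.update (Function.update z dead b) (recA i)
          (xor (xor (z (recA i)) (z dead)) b)) (recB j) (xor (xor (z (recB j)) (z dead)) b) := by
    intro b
    funext q
    by_cases hb : q = recB j
    · subst hb; simp [hyb]
    by_cases ha : q = recA i
    · subst ha; simp [hya]
    by_cases hd : q = dead
    · subst hd; simp
    simp [ha, hb, hd, hy]
  rw [hback, hback]
  have hc : (∀ p ∈ stepLits i j, y p.1 = p.2) ↔
      (z (dat i) = true ∧ z (dat j) = true ∧ z (recA i) = z dead ∧ z (recB j) = z dead) := by
    simp only [stepLits, List.forall_mem_cons, hya, hyb, hyx]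
    cases z (recA i) <;> cases z (recB j) <;> cases z dead <;> simp
  have hid : ∀ b, b = z dead → Function.update (Function.update (Function.update z dead b) (recA i)
          (xor (xor (z (recA i)) (z dead)) b)) (recB j) (xor (xor (z (recB j)) (z dead)) b) = z := by
    rintro _ rfl
    funext q
    by_cases hb : q = recB j
    · subst hb; simp
    simp [hb]
  by_cases h : z (dat i) = true ∧ z (dat j) = true ∧ z (recA i) = z dead ∧ z (recB j) = z dead
  · rw [if_pos (hc.2 h), if_pos h, hyd]
    obtain ⟨_, _, h3, h4⟩ := h
    rw [h3, h4]
    simp only [Bool.xor_self, Bool.false_xor]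
    change rotMat φ (z dead) true * ψ (setRec i j true z) + rotMat φ (z dead) false *
      ψ (setRec i j false z) = _
    have := hset h3 h4
    cases hz : z dead
    · rw [hz] at this; rw [this]; simp [rotMat]; ring
    · rw [hz] at this; rw [this]; simp [rotMat]; ring
  · rw [if_neg (fun h' => h (hc.1 h')), if_neg h, hyd]
    cases hz : z dead
    · rw [← hz, hid (z dead) rfl, hz]; simp
    · rw [← hz, hid (z dead) rfl, hz]; simp

/-- The state before and between filter steps: without failure mark there is no failure record,
records occur only for the steps `T` already performed, and the failure-free amplitudes are `α`. -/
structure FilterInv (T : Finset (Fin n × Fin n)) (α ψ : (Core n → Bool) → ℂ) : Prop where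
  clean : ∀ z, z dead = false → (∃ i, z (recA i) = true ∨ z (recB i) = true) → ψ z = 0
  fresh : ∀ z i j, (i, j) ∉ T → z (recA i) = true → z (recB j) = true → ψ z = 0
  alive : ∀ z, z dead = false → (∀ i, z (recA i) = false) → (∀ i, z (recB i) = false) → ψ z = α z

/-- A new step meets an empty failed branch: strings with both records `i` and `j` set have
amplitude zero as long as `(i, j) ∉ T`. Nothing flows back, so the failure-free amplitude only picks
up the cosine. Marking a pair by one qubit in each of two registers takes `2n` qubits instead of
`n²`. -/
theorem FilterInv.step {T : Finset (Fin n × Fin n)} {α ψ : (Core n → Bool) → ℂ}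
    (h : FilterInv T α ψ) (i j : Fin n) (hij : (i, j) ∉ T) (φ : ℝ) :
    FilterInv (insert (i, j) T)
      (fun z => (if z (dat i) = true ∧ z (dat j) = true then ((Real.cos φ : ℝ) : ℂ) else 1) * α z)
      (stepOp i j φ *ᵥ ψ) := by
  have hup : ∀ z, ψ (setRec i j true z) = 0 := fun z =>
    h.fresh _ i j hij (by rw [setRec_recA, if_pos rfl]) (by rw [setRec_recB, if_pos rfl])
  refine ⟨?_, ?_, ?_⟩
  · intro z hz hrec
    rw [stepOp_mulVec, h.clean z hz hrec, hup, hz]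
    simp
  · intro z k l hkl hk hl
    simp only [Finset.mem_insert, not_or, Prod.mk.injEq] at hkl
    have h1 : ψ z = 0 := h.fresh z k l hkl.2 hk hl
    -- Erasing the record `(i, j)` leaves `k` or `l` recorded because `(k, l) ≠ (i, j)`, and an
    -- unmarked string with a record has amplitude zero.
    have h2 : ψ (setRec i j false z) = 0 := by
      apply h.clean _ (setRec_dead _ _ _ _)
      by_cases hki : k = i
      · refine ⟨l, Or.inr ?_⟩
        rw [setRec_recB, if_neg fun hlj => hkl.1 ⟨hki, hlj⟩, hl]
      · refine ⟨k, Or.inl ?_⟩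
        rw [setRec_recA, if_neg hki, hk]
    rw [stepOp_mulVec, h1, h2, hup]
    simp
  · intro z hz hA hB
    rw [stepOp_mulVec, hup, h.alive z hz hA hB, hz]
    simp only [hA, hB, and_true]
    split_ifs <;> simp_all

theorem exists_cleanSynth_filter {W : ℕ} (hW : 6 ≤ W) (φ : Fin n × Fin n → ℝ)
    (T : Finset (Fin n × Fin n)) :
    ∃ M : Op (Core n → Bool), CleanSynth W (152 * T.card) M ∧
      ∀ α ψ : (Core n → Bool) → ℂ, FilterInv ∅ α ψ →
        FilterInv T (fun z => (∏ p ∈ T, if z (dat p.1) = true ∧ z (dat p.2) = true then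
          ((Real.cos (φ p) : ℝ) : ℂ) else 1) * α z) (M *ᵥ ψ) := by
  induction T using Finset.induction_on with
  | empty => exact ⟨1, CleanSynth.one, fun α ψ h => by simpa using h⟩
  | insert p T hp ih =>
    obtain ⟨M, hM, hM'⟩ := ih
    refine ⟨_, ((stepOp_cleanSynth hW p.1 p.2 (φ p)).mul hM).mono
      (by rw [Finset.card_insert_of_notMem hp]; omega), ?_⟩
    intro α ψ h
    have := (hM' α ψ h).step p.1 p.2 hp (φ p)
    rw [← Matrix.mulVec_mulVec]
    convert this using 1
    funext z
    rw [Finset.prod_insert hp, mul_assoc]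

/-- Move every amplitude with all data qubits set to the failed subspace. -/
def excludeOp : Op (Core n → Bool) :=
  ctlRot dead ((List.finRange n).map fun i => ((dat i : Core n), true)) (Real.pi / 2)

theorem excludeOp_cleanSynth {W : ℕ} (hW : n + 2 ≤ W) :
    CleanSynth W (28 * n + 36) (excludeOp : Op (Core n → Bool)) := by
  have := CleanSynth.mcrot (W := W) (tune : Core n) dead (by simp) (Real.pi / 2)
    ((List.finRange n).map (fun i => ((dat i : Core n), true))) (by simpa using hW)
    (by simp)
  rw [List.length_map, List.length_finRange] at this
  exact this

/-- A quarter turn moves the all-one amplitude entirely into the failed branch. No record is set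
there, so the condition of every filter step fails on it and it stays put. -/
theorem excludeOp_productState (φ : Core n → ℝ) (hA : ∀ i, φ (recA i) = 0)
    (hB : ∀ i, φ (recB i) = 0) (hD : φ dead = 0) :
    FilterInv ∅ (fun z => if ∀ i, z (dat i) = true then 0 else productState φ z)
      (excludeOp *ᵥ productState φ) := by
  have hzero : ∀ (z : Core n → Bool) q, φ q = 0 → z q = true → productState φ z = 0 := by
    intro z q hq hz
    exact Finset.prod_eq_zero (Finset.mem_univ q) (by simp [hq, hz])
  have hval : ∀ z, (excludeOp *ᵥ productState φ) z
      = (if ∀ i, z (dat i) = true then rotMat (Real.pi / 2) else 1) (z dead) false *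
        productState φ (Function.update z dead false) := by
    intro z
    rw [excludeOp, ctlRot, blockOp_mulVec, Fintype.sum_bool,
      hzero (Function.update z dead true) dead hD (by simp), mul_zero, zero_add]
    simp
  refine ⟨?_, ?_, ?_⟩
  · rintro z hz ⟨i, hi | hi⟩
    · rw [hval, hzero _ (recA i) (hA i) (by simpa using hi), mul_zero]
    · rw [hval, hzero _ (recB i) (hB i) (by simpa using hi), mul_zero]
  · intro z i j _ hi _
    rw [hval, hzero _ (recA i) (hA i) (by simpa using hi), mul_zero]
  · intro z hz _ _
    have : Function.update z dead false = z := by rw [← hz]; simp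
    rw [hval, this, hz]
    split_ifs
    · simp [rotMat]
    · simp

/-- Exact preparation of a product state filtered by pairwise damping factors, with the all-one
string excluded. -/
theorem exists_prepare {W : ℕ} (hW : 3 * n + 6 ≤ W) (θ : Fin n → ℝ)
    (φ : Fin n × Fin n → ℝ) (A : (Fin n → Bool) → ℝ)
    (hA : ∀ x, A x = (∏ p ∈ Finset.univ.filter (fun p : Fin n × Fin n => p.1 < p.2),
        if x p.1 = true ∧ x p.2 = true then Real.cos (φ p) else 1) *
      if ∀ i, x i = true then 0 else ∏ i, if x i then Real.sin (θ i) else Real.cos (θ i))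
    (hp : 1 / 4 ≤ ∑ x, A x ^ 2) :
    ∃ M : Op (Core n → Bool), CleanSynth W (1000 * (n + 1) ^ 2) M ∧
      M *ᵥ zeroKet (Core n) = fun z => if ∀ f, z (Sum.inr f) = false then
        ((A (z ∘ Sum.inl) / Real.sqrt (∑ x, A x ^ 2) : ℝ) : ℂ) else 0 := by
  set p : ℝ := ∑ x, A x ^ 2 with hpdef
  have hp0 : 0 < p := by linarith
  -- The amplitude of the tuning qubit that reduces the success probability from `p ≥ 1/4` to
  -- exactly `1/4`. Amplification then doubles `A c` to `A / √p`.
  set c : ℝ := 1 / (2 * Real.sqrt p) with hc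
  have hsq : 0 < Real.sqrt p := Real.sqrt_pos.2 hp0
  have hc0 : 0 < c := by positivity
  have hsq2 : 1 / 2 ≤ Real.sqrt p := by
    apply Real.le_sqrt_of_sq_le; norm_num; linarith
  have hc1 : c ≤ 1 := by
    rw [hc, div_le_one (by positivity)]; linarith
  let τ : ℝ := Real.arccos c
  have hτ : Real.cos τ = c := Real.cos_arccos (by linarith) hc1
  let Φ : Core n → ℝ := Sum.elim θ (Sum.elim (fun _ => 0) fun b => if b then τ else 0)
  obtain ⟨M₁, hM₁, hM₁'⟩ := exists_cleanSynth_productState (W := W) Φ (by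
    intro q
    by_cases h : q = dead
    · exact ⟨tune, by rw [h]; simp⟩
    · exact ⟨dead, fun h' => h h'.symm⟩)
  have hM₂ := excludeOp_cleanSynth (n := n) (W := W) (by omega)
  have hI := excludeOp_productState Φ (fun _ => rfl) (fun _ => rfl) rfl
  obtain ⟨M₃, hM₃, hM₃'⟩ := exists_cleanSynth_filter (W := W) (by omega) φ
    (Finset.univ.filter fun p : Fin n × Fin n => p.1 < p.2)
  have hF := hM₃' _ _ hI
  set V := M₃ * (excludeOp * M₁) with hVdef
  have hV : CleanSynth W (152 * (n * n) + (28 * n + 36 + (3 * n + 2))) V := by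
    refine (hM₃.mul (hM₂.mul hM₁)).mono ?_
    have h1 : (Finset.univ.filter fun p : Fin n × Fin n => p.1 < p.2).card ≤ n * n := by
      refine (Finset.card_le_univ _).trans ?_
      simp
    have h2 : Fintype.card (Core n) = 3 * n + 2 := by
      simp; ring
    rw [h2]
    have := Nat.mul_le_mul_left 152 h1
    omega
  have hVψ : V *ᵥ zeroKet (Core n) = M₃ *ᵥ (excludeOp *ᵥ productState Φ) := by
    rw [hVdef, ← Matrix.mulVec_mulVec, ← Matrix.mulVec_mulVec, hM₁']
  have hgood : ∀ z : Core n → Bool, z dead = false → z tune = false →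
      (V *ᵥ zeroKet (Core n)) z = if ∀ f, z (Sum.inr f) = false then
        ((A (z ∘ Sum.inl) * c : ℝ) : ℂ) else 0 := by
    intro z hz ht
    rw [hVψ]
    split_ifs with hf
    · rw [hF.alive z hz (fun i => hf _) (fun i => hf _), hA]
      have hprod : productState Φ z
          = ((∏ i, if z (dat i) then Real.sin (θ i) else Real.cos (θ i) : ℝ) : ℂ) * (c : ℂ) := by
        rw [productState, Fintype.prod_sum_type, Fintype.prod_sum_type, Fintype.prod_bool]
        simp only [hf, Φ, Sum.elim_inl, Sum.elim_inr, ← hτ]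
        push_cast
        simp
        exact Or.inl (Finset.prod_congr rfl fun i _ => by split_ifs <;> simp)
      simp only [hprod, Function.comp_apply]
      push_cast
      split_ifs
      · simp
      · rw [mul_assoc]
        congr 1
        · refine Finset.prod_congr rfl fun p _ => ?_
          split_ifs <;> simp
        · push_cast; rfl
    · push Not at hf
      obtain ⟨f, hf⟩ := hf
      apply hF.clean z hz
      rcases f with (f | f) | f
      · exact ⟨f, Or.inl (by simpa using hf)⟩
      · exact ⟨f, Or.inr (by simpa using hf)⟩
      · cases f
        · exact absurd hz hf
        · exact absurd ht hf
  have hSg := CleanSynth.diag (W := W) (c := (dead : Core n)) (t := tune) (by simp)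
    (fun a b => if (!a && !b) = true then 1 else -1) (by
      intro a b; split_ifs <;> simp)
  have hS₀ := CleanSynth.reflectZero (P := Core n) (W := W) (by simp; omega)
  have hsum : ∑ z : Core n → Bool, (if (!z dead && !z tune) = true then
      ‖(V *ᵥ zeroKet (Core n)) z‖ ^ 2 else 0) = 1 / 4 := by
    have h1 : ∀ z : Core n → Bool, (if (!z dead && !z tune) = true then
        ‖(V *ᵥ zeroKet (Core n)) z‖ ^ 2 else 0)
        = if ∀ f, z (Sum.inr f) = false then (A (z ∘ Sum.inl) * c) ^ 2 else 0 := by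
      intro z
      by_cases hz : (!z dead && !z tune) = true
      · have hz' : z dead = false ∧ z tune = false := by simpa using hz
        rw [if_pos hz, hgood z hz'.1 hz'.2]
        split_ifs
        · rw [Complex.norm_real, Real.norm_eq_abs, sq_abs]
        · simp
      · rw [if_neg hz, if_neg]
        exact fun h => hz (by simp [h])
    rw [Finset.sum_congr rfl fun z _ => h1 z, sum_clean fun z => (A (z ∘ Sum.inl) * c) ^ 2]
    simp only [Sum.elim_comp_inl, mul_pow]
    rw [← Finset.sum_mul, ← hpdef, hc, div_pow, mul_pow, Real.sq_sqrt hp0.le]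
    field_simp
    norm_num
  have hamp := amplify V _ hV.1 (fun z : Core n → Bool => !z dead && !z tune)
    rfl hsum
  refine ⟨_, ((((hV.mul hS₀).mul hV.conjTranspose).mul hSg).mul hV).mono ?_, ?_⟩
  · have h2 : Fintype.card (Core n) = 3 * n + 2 := by
      simp; ring
    rw [h2]
    ring_nf
    nlinarith
  · rw [hamp]
    funext z
    by_cases hz : (!z dead && !z tune) = true
    · have hz' : z dead = false ∧ z tune = false := by simpa using hz
      rw [if_pos hz, hgood z hz'.1 hz'.2]
      split_ifs
      · rw [hc]; push_cast; field_simp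
      · simp
    · rw [if_neg hz, if_neg]
      exact fun h => hz (by simp [h])

end Core

end GQPE

end

noncomputable section

namespace GQPE

/-! ### Relabelling of qubits -/

section Transport

variable {Q Q' : Type} [Fintype Q] [DecidableEq Q] [Fintype Q'] [DecidableEq Q']

theorem liftGate_trans (e : Q ≃ Q') (f : Fin 2 ↪ Q) (U : Op (Fin 2 → Bool))
    (z z' : Q' → Bool) :
    liftGate (f.trans e.toEmbedding) U z z' = liftGate f U (z ∘ e) (z' ∘ e) := by
  simp only [liftGate, Matrix.of_apply, Function.comp_apply]
  refine if_congr ?_ rfl rfl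
  constructor
  · intro h q hq
    refine h (e q) ?_
    rintro ⟨i, hi⟩
    exact hq ⟨i, e.injective hi⟩
  · intro h q hq
    have := h (e.symm q) ?_
    · simpa using this
    · rintro ⟨i, hi⟩
      exact hq ⟨i, by simp [hi]⟩

/-- Relabelling the qubits. -/
theorem Synth.relabel (e : Q ≃ Q') {k : ℕ} {M : Op (Q → Bool)} (h : Synth k M) :
    Synth k (Matrix.of fun z z' : Q' → Bool => M (z ∘ e) (z' ∘ e)) := by
  obtain ⟨l, hl, rfl⟩ := h
  refine ⟨l.map fun g => (g.1.trans e.toEmbedding, g.2), by simpa using hl, ?_⟩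
  clear hl
  induction l with
  | nil =>
    ext z z'
    simp only [List.map_nil, gateProd, Matrix.of_apply, Matrix.one_apply]
    refine if_congr ?_ rfl rfl
    exact ⟨fun h => by rw [h], fun h => e.surjective.injective_comp_right h⟩
  | cons g l ih =>
    ext z z'
    simp only [List.map_cons, gateProd, Matrix.of_apply, Matrix.mul_apply]
    rw [ih]
    refine Fintype.sum_equiv (Equiv.arrowCongr e.symm (Equiv.refl Bool)) _ _ fun y => ?_
    rw [liftGate_trans]
    rfl

end Transport

/-! ### Binary digits of a readout index -/

section Binary

/-- The value of a bit as a real number. -/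
def bitVal (b : Bool) : ℝ := if b then 1 else 0

/-- The binary digits of a readout index. -/
def bitsOf (m : ℕ) (j : Readout m) : Fin (2 * m) → Bool := fun b => Nat.testBit j.val b.val

theorem sum_testBit (x n : ℕ) :
    ∑ b : Fin n, bitVal (Nat.testBit x b.val) * 2 ^ b.val = ((x % 2 ^ n : ℕ) : ℝ) := by
  induction n with
  | zero => simp [Nat.mod_one]
  | succ n ih =>
    rw [Fin.sum_univ_castSucc]
    simp only [Fin.val_castSucc, Fin.val_last]
    rw [ih, Nat.mod_pow_succ]
    have h : bitVal (Nat.testBit x n) = ((x / 2 ^ n % 2 : ℕ) : ℝ) := by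
      rw [Nat.testBit_eq_decide_div_mod_eq]
      rcases Nat.mod_two_eq_zero_or_one (x / 2 ^ n) with h | h <;> simp [bitVal, h]
    rw [h]; push_cast; ring

theorem sum_bitsOf (m : ℕ) (j : Readout m) :
    ∑ b, bitVal (bitsOf m j b) * 2 ^ b.val = (j.val : ℝ) := by
  have := sum_testBit j.val (2 * m)
  rwa [Nat.mod_eq_of_lt j.isLt] at this

theorem bitsOf_injective (m : ℕ) : Function.Injective (bitsOf m) := by
  intro j j' h
  have h1 := sum_bitsOf m j
  rw [h, sum_bitsOf] at h1
  exact Fin.ext (by exact_mod_cast h1.symm)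

theorem bitsOf_bijective (m : ℕ) : Function.Bijective (bitsOf m) := by
  rw [Fintype.bijective_iff_injective_and_card]
  exact ⟨bitsOf_injective m, by simp⟩

end Binary

/-! ### The shifted Fourier transform as a circuit -/

section Fourier

variable {R : Type} [Fintype R] [DecidableEq R] {n : ℕ}

/-- Contribution of the qubit `q`, with output bit `y q`, to the phase of the Fourier transform. -/
def fourierTerm (y x : Fin n ⊕ R → Bool) (q : Fin n) : ℝ :=
  (∑ p ∈ Finset.univ.filter (fun p => q ≤ p),
      bitVal (y (Sum.inl q)) * bitVal (x (Sum.inl p)) * (2 ^ q.val / 2 ^ (p.val + 1)))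
    - bitVal (y (Sum.inl q)) * 2 ^ q.val / 2
    - bitVal (x (Sum.inl q)) * 2 ^ (n - 1 - q.val) / 2

/-- `exp(2πi t)`. -/
def unitPhase (t : ℝ) : ℂ := Complex.exp (((2 * Real.pi * t : ℝ) : ℂ) * Complex.I)

theorem unitPhase_add (s t : ℝ) : unitPhase (s + t) = unitPhase s * unitPhase t := by
  unfold unitPhase
  rw [← Complex.exp_add]; congr 1; push_cast; ring

theorem unitPhase_mul_star (t : ℝ) : unitPhase t * star (unitPhase t) = 1 := exp_I_mul_star _

theorem unitPhase_zero : unitPhase 0 = 1 := by simp [unitPhase]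

theorem unitPhase_int (k : ℤ) : unitPhase k = 1 := by
  unfold unitPhase
  rw [Complex.exp_eq_one_iff]
  exact ⟨k, by push_cast; ring⟩

theorem unitPhase_sum {ι : Type} (s : Finset ι) (f : ι → ℝ) :
    unitPhase (∑ i ∈ s, f i) = ∏ i ∈ s, unitPhase (f i) := by
  classical
  induction s using Finset.induction_on with
  | empty => simp [unitPhase_zero]
  | insert a s ha ih => rw [Finset.sum_insert ha, Finset.prod_insert ha, unitPhase_add, ih]

/-- The single-qubit gate of the shifted Fourier transform at the qubit `q`. -/
def fourierGate (n : ℕ) (q : Fin n) : Matrix Bool Bool ℂ :=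
  Matrix.of fun b b' => ((1 / Real.sqrt 2 : ℝ) : ℂ) * unitPhase
    (bitVal b * bitVal b' / 2 - bitVal b * 2 ^ q.val / 2 - bitVal b' * 2 ^ (n - 1 - q.val) / 2)

/-- The gate is a Hadamard matrix between two diagonal phases, which carry the shift by `N/2` of the
two indices. -/
theorem fourierGate_mem (q : Fin n) : fourierGate n q ∈ Matrix.unitaryGroup Bool ℂ := by
  have : fourierGate n q = (Matrix.diagonal fun b => unitPhase (-(bitVal b * 2 ^ q.val / 2)))
      * hadamard * Matrix.diagonal fun b => unitPhase (-(bitVal b * 2 ^ (n - 1 - q.val) / 2)) := by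
    ext b b'
    rw [Matrix.mul_diagonal, Matrix.diagonal_mul]
    simp only [fourierGate, hadamard, Matrix.of_apply]
    rw [sub_eq_add_neg, sub_eq_add_neg, unitPhase_add, unitPhase_add]
    have : unitPhase (bitVal b * bitVal b' / 2) = if (b && b') = true then -1 else 1 := by
      have hh : unitPhase (1 / 2) = -1 := by
        unfold unitPhase
        rw [← Complex.exp_pi_mul_I]; congr 1; push_cast; ring
      rw [one_div] at hh
      cases b <;> cases b' <;> simp [bitVal, unitPhase_zero, hh]
    rw [this]; ring
  rw [this]
  exact mul_mem (mul_mem (diagonal_mem_unitary _ fun b => unitPhase_mul_star _) hadamard_mem)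
    (diagonal_mem_unitary _ fun b => unitPhase_mul_star _)

/-- The controlled phases between the qubit `q` and the later ones. -/
def fourierPhases (q : Fin n) (z : Fin n ⊕ R → Bool) : ℂ :=
  unitPhase (∑ p ∈ Finset.univ.filter (fun p => q < p),
      bitVal (z (Sum.inl q)) * bitVal (z (Sum.inl p)) * (2 ^ q.val / 2 ^ (p.val + 1)))

theorem fourierPhases_synth (q : Fin n) :
    Synth n (Matrix.diagonal (fourierPhases (R := R) q)) := by
  have key : ∀ s : Finset (Fin n), (∀ p ∈ s, q < p) →
      Synth s.card (Matrix.diagonal fun z : Fin n ⊕ R → Bool => unitPhase (∑ p ∈ s,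
        bitVal (z (Sum.inl q)) * bitVal (z (Sum.inl p)) * (2 ^ q.val / 2 ^ (p.val + 1)))) := by
    intro s
    induction s using Finset.induction_on with
    | empty =>
      intro _
      have := Synth.one (Q := Fin n ⊕ R)
      simpa [unitPhase_zero] using this
    | insert p s hp ih =>
      intro hs
      have h1 := ih fun p' hp' => hs p' (Finset.mem_insert_of_mem hp')
      have hqp : q < p := hs p (Finset.mem_insert_self _ _)
      have h2 := Synth.diag (Q := Fin n ⊕ R) (c := Sum.inl q) (t := Sum.inl p)
        (by simpa using hqp.ne)
        (fun a b => unitPhase (bitVal a * bitVal b * (2 ^ q.val / 2 ^ (p.val + 1))))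
        fun a b => unitPhase_mul_star _
      have h3 := h2.mul h1
      rw [Matrix.diagonal_mul_diagonal] at h3
      rw [Finset.card_insert_of_notMem hp, add_comm]
      simp_rw [Finset.sum_insert hp, unitPhase_add]
      exact h3
  have := key (Finset.univ.filter fun p => q < p) (by simp)
  exact this.mono ((Finset.card_le_univ _).trans (by simp))

/-- The first `r` layers of the Fourier circuit, path by path. -/
def fourierPartial (r : ℕ) : Op (Fin n ⊕ R → Bool) :=
  Matrix.of fun y x =>
    if (∀ p : Fin n, r ≤ p.val → y (Sum.inl p) = x (Sum.inl p)) ∧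
        ∀ i, y (Sum.inr i) = x (Sum.inr i) then
      ∏ q ∈ Finset.univ.filter (fun q : Fin n => q.val < r),
        (((1 / Real.sqrt 2 : ℝ) : ℂ) * unitPhase (fourierTerm y x q))
    else 0

/-- Before layer `r`, the qubits below `r` hold output bits and the others still hold input bits.
Hence only one intermediate string contributes, and the controlled phases read the input bits of
later qubits, as `fourierTerm` requires. -/
theorem fourierPartial_succ (r : Fin n) :
    fourierPartial (R := R) (r.val + 1) = Matrix.diagonal (fourierPhases r) *
      ((blockOp (Sum.inl r) fun _ => fourierGate n r) * fourierPartial (n := n) r.val) := by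
  ext y x
  rw [Matrix.diagonal_mul, blockOp_mul_apply]
  have hsupp : ∀ b, fourierPartial r.val (Function.update y (Sum.inl r) b) x
      = if b = x (Sum.inl r) then
          if (∀ p : Fin n, r.val + 1 ≤ p.val → y (Sum.inl p) = x (Sum.inl p)) ∧
            ∀ i, y (Sum.inr i) = x (Sum.inr i) then
          ∏ q ∈ Finset.univ.filter (fun q : Fin n => q.val < r),
            (((1 / Real.sqrt 2 : ℝ) : ℂ) * unitPhase (fourierTerm y x q)) else 0
        else 0 := by
    intro b
    simp only [fourierPartial, Matrix.of_apply]
    by_cases hb : b = x (Sum.inl r)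
    · rw [if_pos hb]
      refine if_congr ?_ ?_ rfl
      · refine and_congr ?_ (by simp)
        constructor
        · intro h p hp
          have := h p (by omega)
          rwa [Function.update_of_ne] at this
          simp only [ne_eq, Sum.inl.injEq]
          rintro rfl; omega
        · intro h p hp
          by_cases hpr : p = r
          · subst hpr; simpa using hb
          · rw [Function.update_of_ne (by simpa using hpr)]
            refine h p ?_
            have : p.val ≠ r.val := fun h' => hpr (Fin.ext h')
            omega
      · refine Finset.prod_congr rfl fun q hq => ?_
        have hqr : q ≠ r := by
          rintro rfl; simp at hq
        simp [fourierTerm, hqr]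
    · rw [if_neg hb, if_neg]
      intro h
      exact hb (by simpa using h.1 r le_rfl)
  simp_rw [hsupp]
  rw [Finset.sum_eq_single (x (Sum.inl r)) (by intro b _ hb; simp [hb]) (by simp)]
  simp only [fourierPartial, Matrix.of_apply, if_true]
  by_cases h : (∀ p : Fin n, r.val + 1 ≤ p.val → y (Sum.inl p) = x (Sum.inl p)) ∧
            ∀ i, y (Sum.inr i) = x (Sum.inr i)
  · rw [if_pos h, if_pos h]
    have hs : (Finset.univ.filter fun q : Fin n => q.val < r.val + 1)
        = insert r (Finset.univ.filter fun q : Fin n => q.val < r.val) := by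
      ext q
      simp only [Finset.mem_filter, Finset.mem_univ, true_and, Finset.mem_insert, Fin.ext_iff]
      omega
    rw [hs, Finset.prod_insert (by simp), ← mul_assoc]
    congr 1
    have hs2 : (Finset.univ.filter fun p : Fin n => r ≤ p)
        = insert r (Finset.univ.filter fun p : Fin n => r < p) := by
      ext q
      simp only [Finset.mem_filter, Finset.mem_univ, true_and, Finset.mem_insert, Fin.ext_iff,
        Fin.le_def, Fin.lt_def]
      omega
    have hph : fourierPhases r y = unitPhase (∑ p ∈ Finset.univ.filter (fun p => r < p),
      bitVal (y (Sum.inl r)) * bitVal (x (Sum.inl p)) * (2 ^ r.val / 2 ^ (p.val + 1))) := by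
      unfold fourierPhases
      congr 1
      refine Finset.sum_congr rfl fun p hp => ?_
      rw [h.1 p (Nat.succ_le_of_lt (Finset.mem_filter.1 hp).2)]
    rw [hph]
    simp only [fourierGate, Matrix.of_apply]
    rw [mul_left_comm, ← unitPhase_add]
    congr 2
    unfold fourierTerm
    rw [hs2, Finset.sum_insert (by simp), pow_succ]
    have : (2 : ℝ) ^ r.val ≠ 0 := by positivity
    field_simp
    ring
  · rw [if_neg h, if_neg h, mul_zero, mul_zero]

theorem fourierPartial_synth [Nonempty R] (r : ℕ) (hr : r ≤ n) :
    Synth (r * (n + 1)) (fourierPartial (n := n) (R := R) r) := by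
  induction r with
  | zero =>
    refine (congrArg (Synth _) ?_).mpr (Synth.one.mono (Nat.zero_le _))
    ext y x
    simp only [fourierPartial, Matrix.of_apply, Nat.zero_le, forall_true_left, Matrix.one_apply,
      Nat.not_lt_zero, Finset.filter_false, Finset.prod_empty]
    refine if_congr ?_ rfl rfl
    constructor
    · rintro ⟨h1, h2⟩
      funext i
      rcases i with i | i
      · exact h1 i
      · exact h2 i
    · rintro rfl; exact ⟨fun _ => rfl, fun _ => rfl⟩
  | succ r ih =>
    have h := fourierPartial_succ (R := R) (⟨r, hr⟩ : Fin n)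
    simp only at h
    rw [h]
    obtain ⟨i⟩ := ‹Nonempty R›
    have hg := Synth.block (Q := Fin n ⊕ R) (c := Sum.inr i) (t := Sum.inl ⟨r, hr⟩) (by simp)
      (fun _ => fourierGate n ⟨r, hr⟩) fun _ => fourierGate_mem _
    refine ((fourierPhases_synth _).mul (hg.mul (ih (by omega)))).mono ?_
    ring_nf
    omega

end Fourier

end GQPE

end

noncomputable section

namespace GQPE

/-! ### Digit encodings of the centred index -/

section Encoding

variable {m : ℕ}

/-- The digits of `ℓ`, most significant first. -/
def inBits (m : ℕ) (l : Readout m) : Fin (2 * m) → Bool := fun p => bitsOf m l p.rev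

/-- The digits of `ℓ`, most significant first, the leading one negated. -/
def encBits (m : ℕ) (l : Readout m) : Fin (2 * m) → Bool :=
  fun p => if p.val = 0 then !inBits m l p else inBits m l p

/-- Sign and magnitude of `ℓ - N/2`: the leading bit marks negative values, and the weighted sum
of all bits, with weights `signWeight`, is `|ℓ - N/2|`. -/
def signBits (m : ℕ) (hm : 0 < 2 * m) (l : Readout m) : Fin (2 * m) → Bool :=
  fun p => if p.val = 0 then encBits m l p else xor (encBits m l p) (encBits m l ⟨0, hm⟩)

/-- The weights of the bits in the sign-magnitude encoding. -/
def signWeight (m : ℕ) (p : Fin (2 * m)) : ℝ :=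
  if p.val = 0 then 1 else 2 ^ (2 * m - 1 - p.val)

theorem sum_inBits (l : Readout m) :
    ∑ p, bitVal (inBits m l p) * 2 ^ (2 * m - 1 - p.val) = (l.val : ℝ) := by
  rw [← sum_bitsOf m l]
  refine Fintype.sum_equiv Fin.revPerm _ _ fun p => ?_
  simp only [inBits, Fin.revPerm_apply, Fin.val_rev]
  congr 2
  omega

theorem signBits_bijective (hm : 0 < 2 * m) : Function.Bijective (signBits m hm) := by
  rw [Fintype.bijective_iff_injective_and_card]
  refine ⟨?_, by simp⟩
  intro l l' h
  apply bitsOf_injective m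
  have h0 : encBits m l ⟨0, hm⟩ = encBits m l' ⟨0, hm⟩ := by
    simpa [signBits] using congrFun h ⟨0, hm⟩
  have h1 : ∀ p, inBits m l p = inBits m l' p := by
    intro p
    by_cases hp : p.val = 0
    · have : p = ⟨0, hm⟩ := Fin.ext hp
      subst this
      simpa [encBits] using h0
    · have := congrFun h p
      rw [signBits, signBits, if_neg hp, if_neg hp, h0] at this
      generalize encBits m l' ⟨0, hm⟩ = b at this
      rw [encBits, encBits, if_neg hp, if_neg hp] at this
      simpa using this
  funext p
  simpa [inBits] using h1 p.rev

theorem sum_pow_weights (m : ℕ) :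
    ∑ p : Fin (2 * m), (2 : ℝ) ^ (2 * m - 1 - p.val) = 2 ^ (2 * m) - 1 := by
  have h : ∑ p : Fin (2 * m), (2 : ℝ) ^ (2 * m - 1 - p.val) = ∑ p : Fin (2 * m), (2 : ℝ) ^ p.val := by
    refine Fintype.sum_equiv Fin.revPerm _ _ fun p => ?_
    simp only [Fin.revPerm_apply, Fin.val_rev]
    congr 1; omega
  rw [h, Fin.sum_univ_eq_sum_range (fun i => (2 : ℝ) ^ i), geom_sum_eq (by norm_num)]
  norm_num

theorem sum_split_leading (hm : 0 < 2 * m) (f : Fin (2 * m) → ℝ) :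
    ∑ p, f p = f ⟨0, hm⟩ + ∑ p ∈ Finset.univ.erase ⟨0, hm⟩, f p :=
  (Finset.add_sum_erase _ _ (Finset.mem_univ _)).symm

theorem val_ne_zero_of_mem_erase (hm : 0 < 2 * m) {p : Fin (2 * m)}
    (hp : p ∈ Finset.univ.erase (⟨0, hm⟩ : Fin (2 * m))) : p.val ≠ 0 := by
  intro h
  exact (Finset.ne_of_mem_erase hp) (Fin.ext h)

theorem two_pow_pred (hm : 0 < 2 * m) : (2 : ℝ) ^ (2 * m) = 2 * 2 ^ (2 * m - 1) := by
  rw [← pow_succ']; congr 1; omega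

/-- If the leading digit is 1, the other digits represent `ℓ - N/2`. If it is 0, their complements
represent `N/2 - 1 - ℓ`, and the unit weight of the sign bit supplies the missing 1. -/
theorem sq_sum_signBits (hm : 0 < 2 * m) (l : Readout m) :
    (∑ p, signWeight m p * bitVal (signBits m hm l p)) ^ 2 = centred m l ^ 2 := by
  have h1 := sum_inBits l
  have h2 := sum_pow_weights m
  rw [sum_split_leading hm] at h1 h2
  rw [sum_split_leading hm]
  have hN := two_pow_pred hm
  unfold centred
  simp only [Nat.sub_zero] at h1 h2
  cases ht : inBits m l ⟨0, hm⟩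
  · have hs : ∀ p ∈ Finset.univ.erase (⟨0, hm⟩ : Fin (2 * m)),
        signWeight m p * bitVal (signBits m hm l p)
          = 2 ^ (2 * m - 1 - p.val) - bitVal (inBits m l p) * 2 ^ (2 * m - 1 - p.val) := by
      intro p hp
      have hp0 := val_ne_zero_of_mem_erase hm hp
      simp only [signWeight, signBits, encBits, if_neg hp0, ht]
      cases inBits m l p <;> simp [bitVal]
    rw [Finset.sum_congr rfl hs, Finset.sum_sub_distrib]
    simp only [signWeight, signBits, encBits, ht, if_true]
    rw [ht] at h1
    simp only [bitVal, Bool.not_false, if_true, Bool.false_eq_true, if_false, zero_mul, zero_add]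
      at h1 ⊢
    rw [h1]
    have h3 : ∑ p ∈ Finset.univ.erase (⟨0, hm⟩ : Fin (2 * m)), (2 : ℝ) ^ (2 * m - 1 - p.val)
      = 2 ^ (2 * m) - 1 - 2 ^ (2 * m - 1) := by linarith
    rw [h3, hN]
    ring
  · have hs : ∀ p ∈ Finset.univ.erase (⟨0, hm⟩ : Fin (2 * m)),
        signWeight m p * bitVal (signBits m hm l p)
          = bitVal (inBits m l p) * 2 ^ (2 * m - 1 - p.val) := by
      intro p hp
      have hp0 := val_ne_zero_of_mem_erase hm hp
      simp only [signWeight, signBits, encBits, if_neg hp0, ht]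
      cases inBits m l p <;> simp [bitVal]
    rw [Finset.sum_congr rfl hs]
    simp only [signWeight, signBits, encBits, ht, if_true]
    rw [ht] at h1
    simp only [bitVal, Bool.not_true, if_true, Bool.false_eq_true, if_false, one_mul, mul_zero,
      zero_add] at h1 ⊢
    rw [hN]
    congr 1
    linarith

/-- The magnitude `N/2` occurs only at `ℓ = 0`. The vanishing amplitude of the resource state
therefore sits on the all-one string, which the preparation excludes. -/
theorem signBits_all_iff (hm : 0 < 2 * m) (l : Readout m) :
    (∀ p, signBits m hm l p = true) ↔ l.val = 0 := by
  constructor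
  · intro h
    have h0 : encBits m l ⟨0, hm⟩ = true := by simpa [signBits] using h ⟨0, hm⟩
    have h1 : ∀ p, inBits m l p = false := by
      intro p
      by_cases hp : p.val = 0
      · have : p = ⟨0, hm⟩ := Fin.ext hp
        subst this
        simpa [encBits] using h0
      · have := h p
        rw [signBits, if_neg hp, h0, encBits, if_neg hp] at this
        simpa using this
    have h2 := sum_inBits l
    simp only [h1, bitVal, Bool.false_eq_true, if_false, zero_mul, Finset.sum_const_zero] at h2
    exact_mod_cast h2.symm
  · intro h p
    simp [signBits, encBits, inBits, bitsOf, h]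

/-- The evolution angle, in units of the step, controlled by the qubit `p`. -/
def selectWeight (m : ℕ) (p : Fin (2 * m)) : ℝ :=
  (if p.val = 0 then -1 else 1) * 2 ^ (2 * m - 1 - p.val)

/-- This is two's complement: the negated leading digit has weight `-N/2`. The centred index is then
linear in the bits, so each qubit can control its own evolution. -/
theorem sum_encBits (hm : 0 < 2 * m) (l : Readout m) :
    ∑ p, bitVal (encBits m l p) * selectWeight m p = centred m l := by
  have h1 := sum_inBits l
  have hN := two_pow_pred hm
  rw [sum_split_leading hm] at h1 ⊢
  unfold centred
  rw [← h1, hN, add_sub_right_comm]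
  congr 1
  · simp only [encBits, selectWeight, if_true, Nat.sub_zero]
    cases inBits m l ⟨0, hm⟩ <;> simp [bitVal]
  · refine Finset.sum_congr rfl fun p hp => ?_
    have hp0 := val_ne_zero_of_mem_erase hm hp
    simp [encBits, selectWeight, hp0]

end Encoding

/-! ### Matching the Fourier circuit with the matrix of the transform -/

section FourierIndex

variable {m : ℕ} {R : Type} [Fintype R] [DecidableEq R]

omit [Fintype R] [DecidableEq R] in
theorem fourier_phase_eq (hm : 0 < m) (j l : Readout m) (y x : Fin (2 * m) ⊕ R → Bool)
    (hy : y ∘ Sum.inl = bitsOf m j) (hx : x ∘ Sum.inl = inBits m l) :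
    unitPhase (∑ q, fourierTerm y x q) = unitPhase (centred m l * centred m j / 2 ^ (2 * m)) := by
  have hy' : ∀ q, y (Sum.inl q) = bitsOf m j q := fun q => congrFun hy q
  have hx' : ∀ q, x (Sum.inl q) = inBits m l q := fun q => congrFun hx q
  have hj := sum_bitsOf m j
  have hl := sum_inBits l
  set B : Fin (2 * m) → Fin (2 * m) → ℝ := fun q p =>
    bitVal (bitsOf m j q) * bitVal (inBits m l p) * (2 ^ q.val / 2 ^ (p.val + 1)) with hB
  have h1 : ∑ q, fourierTerm y x q
      = (∑ q, ∑ p ∈ Finset.univ.filter (fun p => q ≤ p), B q p) - (j.val : ℝ) / 2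
        - (l.val : ℝ) / 2 := by
    simp only [fourierTerm, hy', hx', Finset.sum_sub_distrib]
    rw [← hj, ← hl, Finset.sum_div, Finset.sum_div]
  have h2 : (j.val : ℝ) * l.val / 2 ^ (2 * m) = ∑ q, ∑ p, B q p := by
    rw [← hj, ← hl, Finset.sum_mul_sum, Finset.sum_div]
    refine Finset.sum_congr rfl fun q _ => ?_
    rw [Finset.sum_div]
    refine Finset.sum_congr rfl fun p _ => ?_
    have : (2 : ℝ) ^ (2 * m) = 2 ^ (2 * m - 1 - p.val) * 2 ^ (p.val + 1) := by
      rw [← pow_add]; congr 1; have := p.isLt; omega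
    rw [this, hB]
    have h3 : (2 : ℝ) ^ (2 * m - 1 - p.val) ≠ 0 := by positivity
    field_simp
  have h3 : ∑ q, ∑ p, B q p = (∑ q, ∑ p ∈ Finset.univ.filter (fun p => q ≤ p), B q p)
      + ∑ q, ∑ p ∈ Finset.univ.filter (fun p => ¬ q ≤ p), B q p := by
    rw [← Finset.sum_add_distrib]
    refine Finset.sum_congr rfl fun q _ => ?_
    rw [Finset.sum_filter_add_sum_filter_not]
  -- For `p < q` the coefficient `2^q / 2^(p+1)` is an integer, so these pairs contribute no phase
  -- and need no gate.
  have h4 : unitPhase (∑ q, ∑ p ∈ Finset.univ.filter (fun p => ¬ q ≤ p), B q p) = 1 := by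
    rw [unitPhase_sum]
    refine Finset.prod_eq_one fun q _ => ?_
    rw [unitPhase_sum]
    refine Finset.prod_eq_one fun p hp => ?_
    have hpq : p.val + 1 ≤ q.val := by
      have := (Finset.mem_filter.1 hp).2
      rw [Fin.le_def] at this; omega
    have h5 : (2 : ℝ) ^ q.val / 2 ^ (p.val + 1) = 2 ^ (q.val - (p.val + 1)) := by
      rw [div_eq_iff (by positivity), ← pow_add]; congr 1; omega
    simp only [hB, h5]
    cases bitsOf m j q <;> cases inBits m l p <;>
      simp only [bitVal, if_true, Bool.false_eq_true, if_false, zero_mul, mul_zero, one_mul,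
        unitPhase_zero]
    have := unitPhase_int (2 ^ (q.val - (p.val + 1)))
    push_cast at this
    exact this
  -- The constant `N/4` produced by the two shifts is an integer because `m ≥ 1`.
  have h6 : unitPhase ((2 : ℝ) ^ (2 * m) / 4) = 1 := by
    have := unitPhase_int (2 ^ (2 * m - 2))
    rw [← this]
    congr 1
    push_cast
    rw [div_eq_iff (by norm_num), show (4 : ℝ) = 2 ^ 2 by norm_num, ← pow_add]
    congr 1; omega
  have h7 : centred m l * centred m j / 2 ^ (2 * m) = (∑ q, fourierTerm y x q)
      + ((∑ q, ∑ p ∈ Finset.univ.filter (fun p => ¬ q ≤ p), B q p) + (2 : ℝ) ^ (2 * m) / 4) := by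
    rw [h1]
    have h8 := h2.trans h3
    have h9 : centred m l * centred m j / 2 ^ (2 * m)
        = (j.val : ℝ) * l.val / 2 ^ (2 * m) - (j.val : ℝ) / 2 - (l.val : ℝ) / 2
          + (2 : ℝ) ^ (2 * m) / 4 := by
      unfold centred
      field_simp
      ring
    rw [h9, h8]; ring
  rw [h7, unitPhase_add _ (_ + _), unitPhase_add _ (_ / 4), h4, h6]
  simp

omit [DecidableEq R] in
theorem fourierPartial_apply (hm : 0 < m) (j l : Readout m) (y x : Fin (2 * m) ⊕ R → Bool)
    (hy : y ∘ Sum.inl = bitsOf m j) (hx : x ∘ Sum.inl = inBits m l) :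
    fourierPartial (2 * m) y x
      = if ∀ i, y (Sum.inr i) = x (Sum.inr i) then shiftedQFT m j l else 0 := by
  simp only [fourierPartial, Matrix.of_apply]
  refine if_congr ?_ ?_ rfl
  · constructor
    · exact fun h => h.2
    · exact fun h => ⟨fun p hp => absurd p.isLt (by omega), h⟩
  · have : (Finset.univ.filter fun q : Fin (2 * m) => q.val < 2 * m) = Finset.univ := by
      ext q; simp
    rw [this, Finset.prod_mul_distrib, ← unitPhase_sum, fourier_phase_eq hm j l y x hy hx]
    simp only [shiftedQFT, Matrix.of_apply, Finset.prod_const, Finset.card_univ, Fintype.card_fin]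
    congr 1
    · rw [← Complex.ofReal_pow]
      congr 1
      rw [div_pow, one_pow, pow_mul, Real.sq_sqrt (by norm_num), pow_mul']
      rw [Real.sqrt_sq (by positivity)]
    · unfold unitPhase
      congr 1
      push_cast; ring

end FourierIndex

end GQPE

end

noncomputable section

namespace GQPE

/-! ### Gaussians in weighted sums of bits -/

section Gaussian

/-- Splits the exponent of the Gaussian into single-bit terms and one term for each unordered pair.
-/
theorem sq_sum_eq_sum_lt {n : ℕ} (f : Fin n → ℝ) :
    (∑ i, f i) ^ 2 = ∑ i, f i ^ 2 +
      2 * ∑ p ∈ Finset.univ.filter (fun p : Fin n × Fin n => p.1 < p.2), f p.1 * f p.2 := by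
  have h1 : (∑ i, f i) ^ 2 = ∑ p : Fin n × Fin n, f p.1 * f p.2 := by
    rw [pow_two, Finset.sum_mul_sum, Fintype.sum_prod_type]
  have h2 : ∑ p : Fin n × Fin n, f p.1 * f p.2
      = ∑ p ∈ Finset.univ.filter (fun p : Fin n × Fin n => p.1 < p.2), f p.1 * f p.2
        + (∑ p ∈ Finset.univ.filter (fun p : Fin n × Fin n => p.2 < p.1), f p.1 * f p.2
        + ∑ p ∈ Finset.univ.filter (fun p : Fin n × Fin n => p.1 = p.2), f p.1 * f p.2) := by
    simp only [Finset.sum_filter, ← Finset.sum_add_distrib]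
    refine Finset.sum_congr rfl fun p _ => ?_
    rcases lt_trichotomy p.1 p.2 with h | h | h
    · simp [h, h.ne, h.not_gt]
    · simp [h]
    · simp [h, h.ne', h.not_gt]
  have h3 : ∑ p ∈ Finset.univ.filter (fun p : Fin n × Fin n => p.2 < p.1), f p.1 * f p.2
      = ∑ p ∈ Finset.univ.filter (fun p : Fin n × Fin n => p.1 < p.2), f p.1 * f p.2 := by
    simp only [Finset.sum_filter]
    refine Fintype.sum_equiv (Equiv.prodComm _ _) _ _ fun p => ?_
    simp [mul_comm]
  have h4 : ∑ p ∈ Finset.univ.filter (fun p : Fin n × Fin n => p.1 = p.2), f p.1 * f p.2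
      = ∑ i, f i ^ 2 := by
    simp only [Finset.sum_filter, Fintype.sum_prod_type]
    refine Finset.sum_congr rfl fun i _ => ?_
    simp [pow_two]
  rw [h1, h2, h3, h4]; ring

/-- The exact preparation of a Gaussian in a weighted sum of bits. -/
theorem exists_prepare_gaussian {n W : ℕ} (hW : 3 * n + 6 ≤ W) (v : Fin n → ℝ)
    (hv : ∀ i, 0 ≤ v i) (a : ℝ) (ha : 0 ≤ a)
    (hp : 1 / 4 * ∏ i, (1 + Real.exp (-(a * v i ^ 2)) ^ 2) ≤
      ∑ x : Fin n → Bool, if ∀ i, x i = true then 0 else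
        Real.exp (-(a * (∑ i, v i * bitVal (x i)) ^ 2)) ^ 2) :
    ∃ M : Op (Core n → Bool), CleanSynth W (1000 * (n + 1) ^ 2) M ∧
      M *ᵥ zeroKet (Core n) = fun z => if ∀ f, z (Sum.inr f) = false then
        ((if ∀ i, z (Sum.inl i) = true then 0 else
          Real.exp (-(a * (∑ i, v i * bitVal (z (Sum.inl i))) ^ 2)) /
          Real.sqrt (∑ x : Fin n → Bool, if ∀ i, x i = true then 0 else
            Real.exp (-(a * (∑ i, v i * bitVal (x i)) ^ 2)) ^ 2) : ℝ) : ℂ) else 0 := by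
  set e : Fin n → ℝ := fun i => Real.exp (-(a * v i ^ 2)) with he
  set D : ℝ := ∏ i, Real.sqrt (1 + e i ^ 2) with hD
  have hDpos : 0 < D := Finset.prod_pos fun i _ => Real.sqrt_pos.2 (by positivity)
  have hD2 : D ^ 2 = ∏ i, (1 + e i ^ 2) := by
    rw [hD, ← Finset.prod_pow]
    exact Finset.prod_congr rfl fun i _ => Real.sq_sqrt (by positivity)
  set g : (Fin n → Bool) → ℝ := fun x => if ∀ i, x i = true then 0 else
    Real.exp (-(a * (∑ i, v i * bitVal (x i)) ^ 2)) with hg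
  have hgsq : ∀ x, (if ∀ i, x i = true then 0 else
        Real.exp (-(a * (∑ i, v i * bitVal (x i)) ^ 2)) ^ 2) = g x ^ 2 := by
    intro x; simp only [hg]; split_ifs <;> simp
  simp only [hgsq] at hp ⊢
  set G : ℝ := ∑ x, g x ^ 2 with hG
  -- The single-bit factors become qubit states of angle `arctan (e i)`, whose normalisations are
  -- collected in `D`. As `a` and the `v i` are nonnegative, each pair factor is at most 1 and hence
  -- a cosine.
  have hA : ∀ x : Fin n → Bool, g x / D
      = (∏ p ∈ Finset.univ.filter (fun p : Fin n × Fin n => p.1 < p.2),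
        if x p.1 = true ∧ x p.2 = true then
          Real.cos (Real.arccos (Real.exp (-(2 * a * (v p.1 * v p.2))))) else 1) *
      if ∀ i, x i = true then 0 else
        ∏ i, if x i then Real.sin (Real.arctan (e i)) else Real.cos (Real.arctan (e i)) := by
    intro x
    simp only [hg]
    split_ifs with hx
    · simp
    · have h1 : ∀ i, (if x i = true then Real.sin (Real.arctan (e i)) else
          Real.cos (Real.arctan (e i)))
          = Real.exp (-(a * (v i * bitVal (x i)) ^ 2)) / Real.sqrt (1 + e i ^ 2) := by
        intro i
        rw [Real.sin_arctan, Real.cos_arctan]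
        cases x i <;> simp [bitVal, he]
      have h2 : ∀ p : Fin n × Fin n, (if x p.1 = true ∧ x p.2 = true then
          Real.cos (Real.arccos (Real.exp (-(2 * a * (v p.1 * v p.2))))) else 1)
          = Real.exp (-(2 * a * (v p.1 * bitVal (x p.1) * (v p.2 * bitVal (x p.2))))) := by
        intro p
        have hle : Real.exp (-(2 * a * (v p.1 * v p.2))) ≤ 1 := by
          rw [Real.exp_le_one_iff]
          have := mul_nonneg (hv p.1) (hv p.2)
          nlinarith [mul_nonneg ha this]
        rw [Real.cos_arccos (by linarith [Real.exp_pos (-(2 * a * (v p.1 * v p.2)))]) hle]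
        cases x p.1 <;> cases x p.2 <;> simp [bitVal]
      rw [Finset.prod_congr rfl fun i _ => h1 i, Finset.prod_congr rfl fun p _ => h2 p,
        Finset.prod_div_distrib, ← Real.exp_sum, ← Real.exp_sum, ← hD, ← mul_div_assoc,
        ← Real.exp_add, sq_sum_eq_sum_lt]
      congr 2
      rw [Finset.sum_neg_distrib, Finset.sum_neg_distrib, ← Finset.mul_sum, ← Finset.mul_sum]
      ring
  have hsum : ∑ x, (g x / D) ^ 2 = G / D ^ 2 := by
    simp only [div_pow]
    rw [← Finset.sum_div]
  obtain ⟨M, hM, hM'⟩ := Core.exists_prepare hW (fun i => Real.arctan (e i))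
    (fun p => Real.arccos (Real.exp (-(2 * a * (v p.1 * v p.2))))) (fun x => g x / D) hA (by
      rw [hsum, hD2, le_div_iff₀ (by rw [← hD2]; positivity)]
      exact hp)
  refine ⟨M, hM, ?_⟩
  rw [hM', hsum, Real.sqrt_div' _ (by positivity), Real.sqrt_sq hDpos.le]
  funext z
  split_ifs with h1 h2
  · simp [hg, h2]
  · have : g (z ∘ Sum.inl) = Real.exp (-(a * (∑ i, v i * bitVal (z (Sum.inl i))) ^ 2)) := by
      simp only [hg, Function.comp_apply]
      rw [if_neg h2]
    rw [this, div_div_div_cancel_right₀ hDpos.ne']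
  · rfl

/-- The decay rate of the amplitudes of the resource state, in units of the index. -/
def decay (m : ℕ) (γ : ℝ) : ℝ := 4 * Real.pi ^ 2 * γ ^ 2 * step m ^ 2

/-- The prefactors of `gaussHat` and the step cancel against `normConst`; the state depends on `γ`
and `m` only through the decay rate per index. -/
theorem resourceState_eq (m : ℕ) {γ : ℝ} (hγ : 0 < γ) (l : Readout m) :
    resourceState m γ l = ((if l.val = 0 then 0 else
      Real.exp (-(decay m γ * centred m l ^ 2)) /
        Real.sqrt (∑ l : Readout m, if l.val = 0 then 0 else
          Real.exp (-(decay m γ * centred m l ^ 2)) ^ 2) : ℝ) : ℂ) := by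
  unfold resourceState
  split_ifs with hl
  · simp
  · congr 1
    have hstep : 0 < step m := by unfold step; positivity
    have hc : (0 : ℝ) < 2 * Real.sqrt (2 * Real.pi) * γ := by positivity
    have hg : ∀ l : Readout m, gaussHat γ (node m l)
        = Real.sqrt (2 * Real.sqrt (2 * Real.pi) * γ) * Real.exp (-(decay m γ * centred m l ^ 2)) := by
      intro l
      unfold gaussHat node decay
      congr 2; ring
    have hn : normConst m γ = Real.sqrt (step m) * Real.sqrt (2 * Real.sqrt (2 * Real.pi) * γ) *
        Real.sqrt (∑ l : Readout m, if l.val = 0 then 0 else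
          Real.exp (-(decay m γ * centred m l ^ 2)) ^ 2) := by
      unfold normConst
      rw [← Real.sqrt_mul hstep.le, ← Real.sqrt_mul (by positivity)]
      congr 1
      rw [mul_assoc, Finset.mul_sum (Finset.univ) _ (2 * Real.sqrt (2 * Real.pi) * γ)]
      congr 1
      refine Finset.sum_congr rfl fun l _ => ?_
      split_ifs
      · simp
      · rw [hg, mul_pow, Real.sq_sqrt hc.le]
    rw [hn, hg, ← mul_assoc, mul_div_mul_left]
    positivity

end Gaussian

end GQPE

end

/-! ### Preparation of the resource state -/

noncomputable section

namespace GQPE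

/-- Flip the data qubits `s` when the data qubit `c` is set. -/
def flipMap {n : ℕ} (c : Fin n) (s : Finset (Fin n)) (z : Core n → Bool) : Core n → Bool :=
  Sum.elim (fun p => if p ∈ s then xor (z (Sum.inl p)) (z (Sum.inl c)) else z (Sum.inl p))
    (fun f => z (Sum.inr f))

theorem exists_cleanSynth_flips {n W : ℕ} (c : Fin n) (s : Finset (Fin n)) (hc : c ∉ s) :
    ∃ M : Op (Core n → Bool), CleanSynth W s.card M ∧
      ∀ ψ z, (M *ᵥ ψ) z = ψ (flipMap c s z) := by
  induction s using Finset.induction_on with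
  | empty =>
    refine ⟨1, CleanSynth.one, fun ψ z => ?_⟩
    rw [Matrix.one_mulVec]
    congr 1
    funext q
    rcases q with q | q <;> simp [flipMap]
  | insert p s hp ih =>
    simp only [Finset.mem_insert, not_or] at hc
    obtain ⟨M, hM, hM'⟩ := ih hc.2
    have hcp : (Sum.inl c : Core n) ≠ Sum.inl p := by simpa using hc.1
    refine ⟨_, (hM.mul (CleanSynth.flip hcp true)).mono
      (by rw [Finset.card_insert_of_notMem hp]), fun ψ z => ?_⟩
    rw [← Matrix.mulVec_mulVec, hM', flipOp_mulVec]
    congr 1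
    funext q
    rcases q with q | q
    · by_cases hq : q = p
      · subst hq
        simp [flipMap, hp, hc.2]
      · simp [flipMap, hq]
    · simp [flipMap]

/-- The hypothesis `hp` says that the unamplified success probability is at least `1/4`: the left
product is the normalisation of the product state, the right sum the squared norm of the
unnormalised Gaussian. -/
theorem exists_synth_resource {m : ℕ} (hm : 0 < m) {γ : ℝ} (hγ : 0 < γ)
    (hp : 1 / 4 * ∏ p, (1 + Real.exp (-(decay m γ * signWeight m p ^ 2)) ^ 2) ≤
      ∑ l : Readout m, if l.val = 0 then 0 else Real.exp (-(decay m γ * centred m l ^ 2)) ^ 2) :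
    ∃ M : Op (Fin (2 * m) ⊕ Fin (10 * m + 8) → Bool), Synth (1000 * (2 * m + 1) ^ 2 + 2 * m) M ∧
      ∀ z, M z (fun _ => false) = ∑ l : Readout m,
        if z = Sum.elim (encBits m l) (fun _ => false) then resourceState m γ l else 0 := by
  have hm2 : 0 < 2 * m := by omega
  have ha : 0 ≤ decay m γ := by unfold decay; positivity
  let c : Fin (2 * m) := ⟨0, hm2⟩
  let σ := Equiv.ofBijective _ (signBits_bijective hm2)
  have hsum : (∑ x : Fin (2 * m) → Bool, if ∀ i, x i = true then 0 else
        Real.exp (-(decay m γ * (∑ i, signWeight m i * bitVal (x i)) ^ 2)) ^ 2)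
      = ∑ l : Readout m, if l.val = 0 then 0 else
        Real.exp (-(decay m γ * centred m l ^ 2)) ^ 2 := by
    symm
    refine Fintype.sum_equiv σ _ _ fun l => ?_
    have h1 : σ l = signBits m hm2 l := rfl
    rw [h1, sq_sum_signBits]
    exact if_congr (signBits_all_iff hm2 l).symm rfl rfl
  obtain ⟨M₁, hM₁, hM₁'⟩ := exists_prepare_gaussian (n := 2 * m) (W := 3 * (2 * m) + 6) le_rfl
    (signWeight m) (by intro i; unfold signWeight; split_ifs <;> positivity) (decay m γ) ha
    (by rw [hsum]; exact hp)
  -- Flips controlled by the sign bit undo the complementation and turn sign and magnitude into the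
  -- digits `encBits`.
  obtain ⟨M₂, hM₂, hM₂'⟩ := exists_cleanSynth_flips (W := 3 * (2 * m) + 6) c
    (Finset.univ.erase c) (by simp)
  have hM := hM₂.mul hM₁
  have hvec : ∀ z, ((M₂ * M₁) *ᵥ zeroKet (Core (2 * m))) z = ∑ l : Readout m,
      if z = Sum.elim (encBits m l) (fun _ => false) then resourceState m γ l else 0 := by
    intro z
    rw [← Matrix.mulVec_mulVec, hM₂', hM₁', hsum]
    beta_reduce
    by_cases hf : ∀ f, z (Sum.inr f) = false
    · have hf' : ∀ f, flipMap c (Finset.univ.erase c) z (Sum.inr f) = false := by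
        intro f; simpa [flipMap] using hf f
      simp only [if_pos hf']
      obtain ⟨l, hl⟩ := (signBits_bijective hm2).2
        fun i => flipMap c (Finset.univ.erase c) z (Sum.inl i)
      have hl' : ∀ i, flipMap c (Finset.univ.erase c) z (Sum.inl i) = signBits m hm2 l i :=
        fun i => (congrFun hl i).symm
      simp only [hl', signBits_all_iff, sq_sum_signBits]
      have hz : z = Sum.elim (encBits m l) (fun _ => false) := by
        have hc : z (Sum.inl c) = encBits m l c := by
          have := hl' c
          simpa [flipMap, signBits, c] using this
        funext q
        rcases q with q | q
        · by_cases hq : q = c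
          · rw [hq, hc]; rfl
          · have hq0 : q.val ≠ 0 := fun h => hq (Fin.ext h)
            have := hl' q
            simp only [flipMap, signBits, Sum.elim_inl, Finset.mem_erase, Finset.mem_univ,
              and_true, ne_eq, hq, not_false_eq_true, if_true, if_neg hq0, hc] at this
            rw [Sum.elim_inl]
            generalize encBits m l q = u at *
            change xor _ (encBits m l c) = xor u (encBits m l c) at this
            exact Bool.xor_left_inj.1 this
        · simpa using hf q
      symm
      rw [Finset.sum_eq_single l]
      · rw [if_pos hz, resourceState_eq m hγ]
      · intro l' _ hne
        rw [if_neg]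
        intro h
        apply hne
        rw [hz] at h
        have henc : encBits m l = encBits m l' := by
          funext q; simpa using congrFun h (Sum.inl q)
        apply (signBits_bijective hm2).1
        funext q
        simp [signBits, henc]
      · simp
    · have hf' : ¬ ∀ f, flipMap c (Finset.univ.erase c) z (Sum.inr f) = false := by
        simpa [flipMap] using hf
      rw [if_neg hf']
      symm
      refine Finset.sum_eq_zero fun l _ => ?_
      rw [if_neg]
      intro h
      apply hf
      intro f; rw [h]; rfl
  obtain ⟨_, ⟨N, hN, hN'⟩, _⟩ := hM
  -- These are `4m + 2` flags, for `n = 2m`, and `6m + 6` work qubits.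
  have hcard : Fintype.card (Flag (2 * m) ⊕ Fin (3 * (2 * m) + 6)) = 10 * m + 8 := by
    simp; ring
  let f := Fintype.equivFinOfCardEq hcard
  let e : (Core (2 * m) ⊕ Fin (3 * (2 * m) + 6)) ≃ (Fin (2 * m) ⊕ Fin (10 * m + 8)) :=
    (Equiv.sumAssoc _ _ _).trans (Equiv.sumCongr (Equiv.refl _) f)
  have hS := hN.relabel e
  refine ⟨_, hS.mono ?_, ?_⟩
  · rw [Finset.card_erase_of_mem (Finset.mem_univ _)]
    simp
    omega
  · intro z
    rw [Matrix.of_apply, hN' _ _ (fun _ => rfl)]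
    have hcol : ∀ y, (M₂ * M₁) y ((fun _ => false : Fin (2 * m) ⊕ Fin (10 * m + 8) → Bool) ∘ e ∘ Sum.inl)
        = ((M₂ * M₁) *ᵥ zeroKet (Core (2 * m))) y := by
      intro y
      simp [zeroKet]
    have hcol' := hcol ((z ∘ e) ∘ Sum.inl)
    rw [hvec] at hcol'
    have hst : ∀ l, (z = Sum.elim (encBits m l) (fun _ => false)) ↔
        ((∀ j, (z ∘ e) (Sum.inr j) = false) ∧
          (z ∘ e) ∘ Sum.inl = Sum.elim (encBits m l) (fun _ => false)) := by
      intro l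
      constructor
      · rintro rfl
        refine ⟨fun j => rfl, ?_⟩
        funext q
        rcases q with q | q <;> rfl
      · rintro ⟨h1, h2⟩
        funext q
        rcases q with q | q
        · exact congrFun h2 (Sum.inl q)
        · obtain ⟨q', rfl⟩ := f.surjective q
          rcases q' with q' | q'
          · exact congrFun h2 (Sum.inr q')
          · exact h1 q'
    split_ifs with hw
    · refine hcol'.trans (Finset.sum_congr rfl fun l _ => if_congr ?_ rfl rfl)
      rw [hst l]
      exact ⟨fun h => ⟨hw, h⟩, fun h => h.2⟩
    · symm
      refine Finset.sum_eq_zero fun l _ => if_neg ?_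
      rw [hst l]
      exact fun h => hw h.1

end GQPE

end

noncomputable section

namespace GQPE

/-! ### Assembling the circuit -/

section Assembly

variable {S Q : Type} [Fintype S] [DecidableEq S] [Fintype Q] [DecidableEq Q]

theorem circuitOp_append (O : Op S) (c c' : List (Instr Q)) :
    circuitOp O (c ++ c') = circuitOp O c' * circuitOp O c := by
  induction c with
  | nil => simp [circuitOp]
  | cons g c ih => simp [circuitOp, ih, Matrix.mul_assoc]

/-- A gate as an instruction. -/
def Gate.toInstr (g : Gate Q) : Instr Q := .gate g.1 g.2

theorem circuitOp_gates (O : Op S) (l : List (Gate Q)) :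
    circuitOp O (l.map Gate.toInstr) = (1 : Op S) ⊗ₖ gateProd l := by
  induction l with
  | nil => simp [circuitOp, gateProd]
  | cons g l ih =>
    simp only [List.map_cons, circuitOp, ih, gateProd, Gate.toInstr, Instr.toOp]
    rw [← Matrix.mul_kronecker_mul, Matrix.one_mul]

omit [Fintype Q] [DecidableEq Q] in
theorem circuitTime_gates (l : List (Gate Q)) : circuitTime (l.map Gate.toInstr) = 0 := by
  unfold circuitTime
  induction l with
  | nil => simp
  | cons g l ih => simpa [Gate.toInstr, Instr.time] using ih

omit [Fintype Q] [DecidableEq Q] in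
theorem circuitTime_append (c c' : List (Instr Q)) :
    circuitTime (c ++ c') = circuitTime c + circuitTime c' := by
  simp [circuitTime]

theorem evolution_add (s t : ℝ) (O : Op S) :
    evolution (s + t) O = evolution s O * evolution t O := by
  unfold evolution
  rw [← Matrix.exp_add_of_commute]
  · rw [← add_smul]; congr 2; push_cast; ring
  · exact ((Commute.refl O).smul_left _).smul_right _

theorem evolution_zero (O : Op S) : evolution 0 O = 1 := by
  simp [evolution]

theorem evolution_smul (t c : ℝ) (O : Op S) :
    evolution t ((c : ℂ) • O) = evolution (t * c) O := by
  unfold evolution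
  rw [smul_smul]; congr 2; push_cast; ring

/-- The evolutions are all generated by the same `O`, so for a fixed ancilla string their times add.
-/
theorem circuitOp_ctrlEvolve {ι : Type} (O : Op S) (l : List ι) (f : ι → Q) (τ : ι → ℝ) :
    circuitOp O (l.map fun p => Instr.ctrlEvolve (f p) (τ p))
      = Matrix.blockDiagonal fun z =>
        evolution ((l.map fun p => bitVal (z (f p)) * τ p).sum) O := by
  induction l with
  | nil =>
    simp only [List.map_nil, circuitOp, List.sum_nil, evolution_zero]
    exact Matrix.blockDiagonal_one.symm
  | cons p l ih =>
    simp only [List.map_cons, circuitOp, ih, Instr.toOp, List.sum_cons]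
    rw [← Matrix.blockDiagonal_mul]
    congr 1
    funext z
    rw [add_comm, evolution_add]
    congr 1
    cases z (f p) <;> simp [bitVal, evolution_zero]

theorem kronecker_one_mul_apply (A : Op (Q → Bool)) (M : Op (S × (Q → Bool))) (x y : S)
    (z z' : Q → Bool) :
    ((1 : Op S) ⊗ₖ A * M) (x, z) (y, z') = ∑ u, A z u * M (x, u) (y, z') := by
  rw [Matrix.mul_apply, Fintype.sum_prod_type, Finset.sum_eq_single x]
  · simp [Matrix.kroneckerMap_apply]
  · intro x' _ hx'
    refine Finset.sum_eq_zero fun u _ => ?_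
    simp [Matrix.kroneckerMap_apply, Matrix.one_apply_ne hx'.symm]
  · simp

theorem blockDiagonal_mul_kronecker_apply (E : (Q → Bool) → Op S) (B : Op (Q → Bool)) (x y : S)
    (z z' : Q → Bool) :
    (Matrix.blockDiagonal E * (1 : Op S) ⊗ₖ B) (x, z) (y, z') = E z x y * B z z' := by
  rw [Matrix.mul_apply, Fintype.sum_prod_type, Finset.sum_eq_single y]
  · rw [Finset.sum_eq_single z]
    · simp [Matrix.kroneckerMap_apply, Matrix.blockDiagonal_apply]
    · intro u _ hu
      simp [Matrix.blockDiagonal_apply, hu.symm]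
    · simp
  · intro x' _ hx'
    refine Finset.sum_eq_zero fun u _ => ?_
    simp [Matrix.kroneckerMap_apply, Matrix.one_apply_ne hx']
  · simp

theorem mul_flipOp_apply (M : Op (Q → Bool)) (t : Q) (g : (Q → Bool) → Bool) (hg : IndepOf t g)
    (z z' : Q → Bool) :
    (M * flipOp t g) z z' = M z (Function.update z' t (xor (z' t) (g z'))) := by
  have h := flipOp_mul_apply t g Mᴴ z' z
  rw [← flipOp_conjTranspose t g hg, ← Matrix.conjTranspose_mul, Matrix.conjTranspose_apply,
    Matrix.conjTranspose_apply] at h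
  exact star_injective h

theorem algKraus_apply (m : ℕ) (γ κ : ℝ) (O : Op S) (j : Readout m) (x y : S) :
    algKraus m γ κ O j x y = ∑ l : Readout m, shiftedQFT m j l *
      evolution (2 * Real.pi * node m l * κ⁻¹) O x y * resourceState m γ l := by
  unfold algKraus
  rw [Matrix.of_apply]
  refine Finset.sum_congr rfl fun l _ => ?_
  congr 1
  rw [Matrix.mul_apply, Fintype.sum_prod_type, Finset.sum_eq_single x]
  · rw [Finset.sum_eq_single l]
    · simp only [Matrix.kroneckerMap_apply, selectEvolution, Matrix.blockDiagonal_apply,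
        Matrix.one_apply_eq, one_mul, if_true]
      rw [evolution_smul]
    · intro u _ hu
      simp [selectEvolution, Matrix.blockDiagonal_apply, hu]
    · simp
  · intro x' _ hx'
    refine Finset.sum_eq_zero fun u _ => ?_
    simp [Matrix.kroneckerMap_apply, Matrix.one_apply_ne hx'.symm]
  · simp

end Assembly

/-- The controlled evolutions of the algorithm. -/
def selectCircuit (m w : ℕ) (κ : ℝ) : List (Instr (Fin (2 * m) ⊕ Fin w)) :=
  (List.finRange (2 * m)).map fun p =>
    Instr.ctrlEvolve (Sum.inl p) (2 * Real.pi * step m * κ⁻¹ * selectWeight m p)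

/-- The weights are powers of two up to sign, with absolute values summing to `N - 1`, and `h N =
2^m`. -/
theorem selectCircuit_time (m w : ℕ) {κ : ℝ} (hκ : 0 < κ) :
    circuitTime (selectCircuit m w κ) ≤ 2 * Real.pi * 2 ^ m * κ⁻¹ := by
  have hstep : 0 < step m := by unfold step; positivity
  have h1 : circuitTime (selectCircuit m w κ)
      = ∑ p : Fin (2 * m), 2 * Real.pi * step m * κ⁻¹ * 2 ^ (2 * m - 1 - p.val) := by
    unfold circuitTime selectCircuit
    rw [List.map_map, ← List.ofFn_eq_map, List.sum_ofFn]
    refine Finset.sum_congr rfl fun p _ => ?_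
    simp only [Function.comp_apply, Instr.time, selectWeight]
    have hc : 0 ≤ 2 * Real.pi * step m * κ⁻¹ := by positivity
    rw [abs_mul, abs_of_nonneg hc, abs_mul, abs_of_nonneg (a := (2 : ℝ) ^ _) (by positivity)]
    split_ifs <;> simp
  rw [h1, ← Finset.mul_sum, sum_pow_weights]
  have h2 : step m * (2 : ℝ) ^ (2 * m) = 2 ^ m := by
    unfold step
    rw [two_mul m, pow_add]
    field_simp
  have h3 : 2 * Real.pi * step m * κ⁻¹ * ((2 : ℝ) ^ (2 * m) - 1)
      = 2 * Real.pi * 2 ^ m * κ⁻¹ - 2 * Real.pi * step m * κ⁻¹ := by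
    rw [← h2]; ring
  rw [h3]
  have : 0 ≤ 2 * Real.pi * step m * κ⁻¹ := by positivity
  linarith

/-- The circuit of the algorithm. -/
theorem exists_circuit {m : ℕ} (hm : 0 < m) {γ κ : ℝ} (hγ : 0 < γ) (hκ : 0 < κ)
    (hp : 1 / 4 * ∏ p, (1 + Real.exp (-(decay m γ * signWeight m p ^ 2)) ^ 2) ≤
      ∑ l : Readout m, if l.val = 0 then 0 else Real.exp (-(decay m γ * centred m l ^ 2)) ^ 2) :
    ∃ c : List (Instr (Fin (2 * m) ⊕ Fin (10 * m + 8))),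
      circuitTime c ≤ 2 * Real.pi * 2 ^ m * κ⁻¹ ∧ c.length ≤ 10000 * m ^ 2 ∧
      ∀ {S : Type} [Fintype S] [DecidableEq S] (O : Op S),
        Implements m (10 * m + 8) c O (algKraus m γ κ O) := by
  have hm2 : 0 < 2 * m := by omega
  obtain ⟨P, ⟨l₁, hl₁, rfl⟩, hP⟩ := exists_synth_resource hm hγ hp
  have hX : Synth 1 (flipOp (Sum.inl ⟨0, hm2⟩ : Fin (2 * m) ⊕ Fin (10 * m + 8)) fun _ => true) :=
    Synth.block (c := Sum.inr ⟨0, by omega⟩) (by simp) (fun _ => flipMat) (fun _ => flipMat_mem)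
  have : Nonempty (Fin (10 * m + 8)) := ⟨⟨0, by omega⟩⟩
  have hF := fourierPartial_synth (n := 2 * m) (R := Fin (10 * m + 8)) (2 * m) le_rfl
  -- The flip acts first. It restores the leading digit that `encBits` negates, so the Fourier
  -- layers receive `inBits`.
  obtain ⟨l₂, hl₂, hl₂'⟩ := hF.mul hX
  refine ⟨l₁.map Gate.toInstr ++ (selectCircuit m (10 * m + 8) κ ++ l₂.map Gate.toInstr), ?_, ?_, ?_⟩
  · rw [circuitTime_append, circuitTime_append, circuitTime_gates, circuitTime_gates]
    have := selectCircuit_time m (10 * m + 8) hκ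
    linarith
  · simp only [List.length_append, List.length_map, selectCircuit, List.length_finRange]
    nlinarith
  · intro S _ _ O x y z
    rw [circuitOp_append, circuitOp_append, circuitOp_gates, circuitOp_gates, Matrix.mul_assoc,
      kronecker_one_mul_apply]
    have hsel : circuitOp O (selectCircuit m (10 * m + 8) κ) = Matrix.blockDiagonal fun z =>
        evolution (∑ p, bitVal (z (Sum.inl p)) * (2 * Real.pi * step m * κ⁻¹ * selectWeight m p)) O := by
      unfold selectCircuit
      rw [circuitOp_ctrlEvolve]
      refine congrArg Matrix.blockDiagonal (funext fun z => ?_)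
      rw [← List.ofFn_eq_map, List.sum_ofFn]
    rw [hsel]
    simp_rw [blockDiagonal_mul_kronecker_apply, hP]
    have h1 : ∀ l : Readout m, gateProd l₂ z (Sum.elim (encBits m l) fun _ => false)
        = ∑ j : Readout m, if z = ancillaString m (10 * m + 8) j then shiftedQFT m j l else 0 := by
      intro l
      rw [hl₂', mul_flipOp_apply _ _ _ (fun _ _ => rfl)]
      obtain ⟨j, hj⟩ := (bitsOf_bijective m).2 (z ∘ Sum.inl)
      rw [fourierPartial_apply hm j l _ _ hj.symm]
      · have hiff : ∀ j', z = ancillaString m (10 * m + 8) j' ↔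
            (j' = j ∧ ∀ i, z (Sum.inr i) = false) := by
          intro j'
          constructor
          · rintro rfl
            refine ⟨?_, fun i => rfl⟩
            apply bitsOf_injective m
            rw [hj]; rfl
          · rintro ⟨rfl, h⟩
            funext q
            rcases q with q | q
            · exact (congrFun hj q).symm
            · exact h q
        simp_rw [hiff]
        by_cases hz : ∀ i, z (Sum.inr i) = false
        · rw [if_pos (by simpa using hz)]
          simp [hz]
        · rw [if_neg (by simpa using hz)]
          simp only [hz, and_false, if_false, Finset.sum_const_zero]
      · funext p
        by_cases hp0 : p = ⟨0, hm2⟩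
        · subst hp0
          rw [Function.comp_apply, Function.update_self, Sum.elim_inl, encBits, if_pos rfl,
            Bool.xor_true, Bool.not_not]
        · have hp1 : p.val ≠ 0 := fun h => hp0 (Fin.ext h)
          rw [Function.comp_apply, Function.update_of_ne (fun h => hp0 (Sum.inl.inj h)),
            Sum.elim_inl, encBits, if_neg hp1]
    have h2 : ∀ l : Readout m, evolution (∑ p, bitVal
        ((Sum.elim (encBits m l) (fun _ => false) : Fin (2 * m) ⊕ Fin (10 * m + 8) → Bool) (Sum.inl p)) *
          (2 * Real.pi * step m * κ⁻¹ * selectWeight m p)) O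
        = evolution (2 * Real.pi * node m l * κ⁻¹) O := by
      intro l
      congr 1
      unfold node
      rw [← sum_encBits hm2 l, Finset.sum_mul, Finset.mul_sum, Finset.sum_mul]
      refine Finset.sum_congr rfl fun p _ => ?_
      simp only [Sum.elim_inl]
      ring
    calc ∑ u, gateProd l₂ z u * (evolution (∑ p, bitVal (u (Sum.inl p)) *
            (2 * Real.pi * step m * κ⁻¹ * selectWeight m p)) O x y *
            ∑ l : Readout m, if u = Sum.elim (encBits m l) (fun _ => false) then
              resourceState m γ l else 0)
        = ∑ l : Readout m, ∑ u, if u = Sum.elim (encBits m l) (fun _ => false) then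
            gateProd l₂ z u * (evolution (∑ p, bitVal (u (Sum.inl p)) *
            (2 * Real.pi * step m * κ⁻¹ * selectWeight m p)) O x y * resourceState m γ l) else 0 := by
          rw [Finset.sum_comm]
          refine Finset.sum_congr rfl fun u _ => ?_
          rw [Finset.mul_sum, Finset.mul_sum]
          refine Finset.sum_congr rfl fun l _ => ?_
          split_ifs <;> simp
      _ = ∑ l : Readout m, ∑ j : Readout m, (if z = ancillaString m (10 * m + 8) j then
            shiftedQFT m j l * evolution (2 * Real.pi * node m l * κ⁻¹) O x y *
              resourceState m γ l else 0) := by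
          refine Finset.sum_congr rfl fun l _ => ?_
          rw [Finset.sum_ite_eq' Finset.univ, if_pos (Finset.mem_univ _), h1, h2, Finset.sum_mul]
          refine Finset.sum_congr rfl fun j _ => ?_
          split_ifs
          · ring
          · simp
      _ = _ := by
          rw [Finset.sum_comm]
          refine Finset.sum_congr rfl fun j _ => ?_
          split_ifs
          · rw [algKraus_apply]
          · simp

end GQPE

end

noncomputable section
namespace GQPE

/-! ### Mean, variance and covariance of a mixture -/

section Statistics

variable {I J : Type} [Fintype I] [Fintype J] {q lam : I → ℝ} {p : I → J → ℝ} {u : J → ℝ}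

theorem abs_mixture_le {a : I → ℝ} {δ : ℝ} (hq : ∀ i, 0 ≤ q i) (hq1 : ∑ i, q i = 1)
    (ha : ∀ i, |a i| ≤ δ) : |∑ i, q i * a i| ≤ δ := by
  calc |∑ i, q i * a i| ≤ ∑ i, |q i * a i| := Finset.abs_sum_le_sum_abs _ _
    _ ≤ ∑ i, q i * δ := Finset.sum_le_sum fun i _ => by
        rw [abs_mul, abs_of_nonneg (hq i)]
        exact mul_le_mul_of_nonneg_left (ha i) (hq i)
    _ = δ := by rw [← Finset.sum_mul, hq1, one_mul]

theorem mixture_swap (v : J → ℝ) :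
    ∑ j, v j * ∑ i, q i * p i j = ∑ i, q i * ∑ j, v j * p i j := by
  simp_rw [Finset.mul_sum]
  rw [Finset.sum_comm]
  exact Finset.sum_congr rfl fun i _ => Finset.sum_congr rfl fun j _ => by ring

theorem mixture_mean_error {δ : ℝ} (hq : ∀ i, 0 ≤ q i) (hq1 : ∑ i, q i = 1)
    (hδ : ∀ i, |∑ j, u j * p i j - lam i| ≤ δ) :
    |∑ j, u j * ∑ i, q i * p i j - ∑ i, q i * lam i| ≤ δ := by
  rw [mixture_swap, ← Finset.sum_sub_distrib]
  simp_rw [← mul_sub]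
  exact abs_mixture_le hq hq1 hδ

/-- The second moment of each component is off by at most `v + 2κδ`, and the square of the overall
mean by at most `2κδ + δ²`. -/
theorem mixture_variance_error {δ v κ : ℝ} (hq : ∀ i, 0 ≤ q i) (hq1 : ∑ i, q i = 1)
    (hp : ∀ i j, 0 ≤ p i j) (hp1 : ∀ i, ∑ j, p i j = 1) (hlam : ∀ i, |lam i| ≤ κ)
    (hδ : ∀ i, |∑ j, u j * p i j - lam i| ≤ δ) (hv : ∀ i, ∑ j, (u j - lam i) ^ 2 * p i j ≤ v) :
    |∑ j, (u j - ∑ k, u k * ∑ i, q i * p i k) ^ 2 * ∑ i, q i * p i j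
      - (∑ i, q i * (lam i * lam i) - (∑ i, q i * lam i) ^ 2)| ≤ v + 4 * κ * δ + δ ^ 2 := by
  set E := ∑ k, u k * ∑ i, q i * p i k with hE
  set Λ := ∑ i, q i * lam i with hΛ
  have hEΛ : |E - Λ| ≤ δ := mixture_mean_error hq hq1 hδ
  have hΛκ : |Λ| ≤ κ := abs_mixture_le hq hq1 hlam
  have hκ : 0 ≤ κ := (abs_nonneg _).trans hΛκ
  have hδ0 : 0 ≤ δ := (abs_nonneg _).trans hEΛ
  have h1 : ∑ j, ∑ i, q i * p i j = 1 := by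
    rw [Finset.sum_comm]
    simp_rw [← Finset.mul_sum, hp1, mul_one, hq1]
  have h2 : ∑ j, (u j - E) ^ 2 * ∑ i, q i * p i j
      = ∑ i, q i * (∑ j, u j ^ 2 * p i j) - E ^ 2 := by
    have : ∀ j, (u j - E) ^ 2 * ∑ i, q i * p i j = u j ^ 2 * (∑ i, q i * p i j)
        - 2 * E * (u j * ∑ i, q i * p i j) + E ^ 2 * ∑ i, q i * p i j := fun j => by ring
    simp_rw [this]
    rw [Finset.sum_add_distrib, Finset.sum_sub_distrib, ← Finset.mul_sum, ← Finset.mul_sum, h1,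
      ← hE, mixture_swap]
    ring
  have h3 : ∀ i, |∑ j, u j ^ 2 * p i j - lam i * lam i| ≤ v + 2 * κ * δ := by
    intro i
    have : ∑ j, u j ^ 2 * p i j - lam i * lam i
        = ∑ j, (u j - lam i) ^ 2 * p i j + 2 * lam i * (∑ j, u j * p i j - lam i) := by
      have : ∀ j, (u j - lam i) ^ 2 * p i j = u j ^ 2 * p i j - 2 * lam i * (u j * p i j)
          + lam i ^ 2 * p i j := fun j => by ring
      simp_rw [this]
      rw [Finset.sum_add_distrib, Finset.sum_sub_distrib, ← Finset.mul_sum, ← Finset.mul_sum,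
        hp1]
      ring
    rw [this]
    refine (abs_add_le _ _).trans (add_le_add ?_ ?_)
    · rw [abs_of_nonneg (Finset.sum_nonneg fun j _ => mul_nonneg (sq_nonneg _) (hp i j))]
      exact hv i
    · rw [abs_mul, abs_mul, abs_two]
      exact mul_le_mul (mul_le_mul_of_nonneg_left (hlam i) (by norm_num)) (hδ i) (abs_nonneg _)
        (by positivity)
  have h4 : |∑ i, q i * (∑ j, u j ^ 2 * p i j) - ∑ i, q i * (lam i * lam i)|
      ≤ v + 2 * κ * δ := by
    rw [← Finset.sum_sub_distrib]
    simp_rw [← mul_sub]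
    exact abs_mixture_le hq hq1 h3
  have h5 : |E ^ 2 - Λ ^ 2| ≤ 2 * κ * δ + δ ^ 2 := by
    have : E ^ 2 - Λ ^ 2 = (E - Λ) * (E - Λ) + 2 * Λ * (E - Λ) := by ring
    rw [this]
    refine (abs_add_le _ _).trans ?_
    rw [abs_mul, abs_mul, abs_mul, abs_two]
    nlinarith [abs_nonneg (E - Λ), abs_nonneg Λ,
      mul_le_mul hΛκ hEΛ (abs_nonneg _) hκ, mul_le_mul hEΛ hEΛ (abs_nonneg _) hδ0]
  rw [h2]
  have : ∑ i, q i * (∑ j, u j ^ 2 * p i j) - E ^ 2 - (∑ i, q i * (lam i * lam i) - Λ ^ 2)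
      = (∑ i, q i * (∑ j, u j ^ 2 * p i j) - ∑ i, q i * (lam i * lam i)) - (E ^ 2 - Λ ^ 2) := by
    ring
  rw [this]
  refine (abs_sub _ _).trans ?_
  linarith

/-- Within a component the two outcomes are independent, so the double sum is the mixture of the
squared component means of `v`. Cauchy–Schwarz bounds each by the second moment. -/
theorem mixture_covariance_le (hq : ∀ i, 0 ≤ q i)
    (hp : ∀ i j, 0 ≤ p i j) (hp1 : ∀ i, ∑ j, p i j = 1) (v : J → ℝ) :
    |∑ j, ∑ k, v j * v k * ∑ i, q i * (p i j * p i k)| ≤ ∑ j, v j ^ 2 * ∑ i, q i * p i j := by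
  have h1 : ∑ j, ∑ k, v j * v k * ∑ i, q i * (p i j * p i k)
      = ∑ i, q i * (∑ j, v j * p i j) ^ 2 := by
    have : ∀ i, q i * (∑ j, v j * p i j) ^ 2
        = ∑ j, ∑ k, v j * v k * (q i * (p i j * p i k)) := fun i => by
      rw [sq, Finset.sum_mul_sum, Finset.mul_sum]
      refine Finset.sum_congr rfl fun j _ => ?_
      rw [Finset.mul_sum]
      exact Finset.sum_congr rfl fun k _ => by ring
    simp_rw [this]
    symm
    rw [Finset.sum_comm]
    refine Finset.sum_congr rfl fun j _ => ?_
    rw [Finset.sum_comm]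
    exact Finset.sum_congr rfl fun k _ => (Finset.mul_sum _ _ _).symm
  rw [h1, mixture_swap, abs_of_nonneg
    (Finset.sum_nonneg fun i _ => mul_nonneg (hq i) (sq_nonneg _))]
  refine Finset.sum_le_sum fun i _ => mul_le_mul_of_nonneg_left ?_ (hq i)
  have := Finset.sum_mul_sq_le_sq_mul_sq Finset.univ (fun j => v j * Real.sqrt (p i j))
    (fun j => Real.sqrt (p i j))
  simp only [mul_pow, Real.sq_sqrt (hp i _), hp1, mul_one, mul_assoc,
    Real.mul_self_sqrt (hp i _)] at this
  exact this

end Statistics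

/-! ### Functions of a Hermitian operator -/

section Spectral

variable {S : Type} [Fintype S] [DecidableEq S]

/-- The operator with eigenvalues `g` in the orthonormal basis given by the columns of `U`. -/
def specOp (U : Op S) (g : S → ℂ) : Op S := U * Matrix.diagonal g * Uᴴ

theorem specOp_mul {U : Op S} (hU : Uᴴ * U = 1) (f g : S → ℂ) :
    specOp U f * specOp U g = specOp U fun i => f i * g i := by
  unfold specOp
  calc U * Matrix.diagonal f * Uᴴ * (U * Matrix.diagonal g * Uᴴ)
      = U * Matrix.diagonal f * (Uᴴ * U) * Matrix.diagonal g * Uᴴ := by simp only [mul_assoc]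
    _ = _ := by rw [hU, mul_one, mul_assoc U, Matrix.diagonal_mul_diagonal]

omit [Fintype S] [DecidableEq S] in
theorem star_ofReal_comp (g : S → ℝ) :
    star (fun i => (g i : ℂ)) = fun i => (g i : ℂ) := by
  ext i; simp

theorem specOp_ofReal_conjTranspose (U : Op S) (g : S → ℝ) :
    (specOp U fun i => (g i : ℂ))ᴴ = specOp U fun i => (g i : ℂ) := by
  unfold specOp
  rw [Matrix.conjTranspose_mul, Matrix.conjTranspose_mul, Matrix.conjTranspose_conjTranspose,
    Matrix.diagonal_conjTranspose, star_ofReal_comp, mul_assoc]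

theorem specOp_one {U : Op S} (hU : U * Uᴴ = 1) : specOp U (fun _ => 1) = 1 := by
  unfold specOp
  rw [Matrix.diagonal_one, mul_one, hU]

theorem specOp_sum {J : Type} [Fintype J] (U : Op S) (g : J → S → ℂ) :
    ∑ j, specOp U (g j) = specOp U fun i => ∑ j, g j i := by
  unfold specOp
  rw [← Finset.sum_mul, ← Finset.mul_sum]
  congr 2
  ext a b
  rw [Matrix.sum_apply]
  by_cases h : a = b
  · subst h; simp
  · simp [Matrix.diagonal_apply_ne _ h]

theorem specOp_smul (U : Op S) (c : ℂ) (g : S → ℂ) :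
    c • specOp U g = specOp U fun i => c * g i := by
  unfold specOp
  rw [← Matrix.smul_mul, ← Matrix.mul_smul, ← Matrix.diagonal_smul]
  rfl

theorem trace_specOp_mul (U : Op S) (g : S → ℝ) (ρ : Op S) :
    (Matrix.trace (specOp U (fun i => (g i : ℂ)) * ρ)).re = ∑ i, ((Uᴴ * ρ * U) i i).re * g i := by
  unfold specOp
  have : Matrix.trace (U * Matrix.diagonal (fun i => (g i : ℂ)) * Uᴴ * ρ)
      = Matrix.trace (Matrix.diagonal (fun i => (g i : ℂ)) * (Uᴴ * ρ * U)) := by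
    rw [mul_assoc, mul_assoc, Matrix.trace_mul_comm]
    simp only [mul_assoc]
  rw [this, Matrix.trace, Complex.re_sum]
  refine Finset.sum_congr rfl fun i _ => ?_
  rw [Matrix.diag_apply, Matrix.diagonal_mul, Complex.re_ofReal_mul, mul_comm]

theorem specOp_exp {U : Op S} (hU : Uᴴ * U = 1) (g : S → ℂ) :
    NormedSpace.exp (specOp U g) = specOp U fun i => Complex.exp (g i) := by
  have hinv : U⁻¹ = Uᴴ := Matrix.inv_eq_left_inv hU
  have hu : IsUnit U := (Matrix.isUnit_iff_isUnit_det _).2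
    (Matrix.isUnit_det_of_left_inverse hU)
  unfold specOp
  rw [← hinv, Matrix.exp_conj _ _ hu, Matrix.exp_diagonal]
  congr 3
  ext i
  rw [Pi.coe_exp, Complex.exp_eq_exp_ℂ]

theorem exists_specOp {A : Op S} (hA : A.IsHermitian) :
    ∃ (U : Op S) (lam : S → ℝ), Uᴴ * U = 1 ∧ U * Uᴴ = 1 ∧ A = specOp U (fun i => (lam i : ℂ)) ∧
      ∀ i, |lam i| ≤ opNorm A := by
  refine ⟨hA.eigenvectorUnitary, hA.eigenvalues, ?_, ?_, ?_, fun i => ?_⟩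
  · exact Matrix.mem_unitaryGroup_iff'.1 hA.eigenvectorUnitary.2
  · exact Matrix.mem_unitaryGroup_iff.1 hA.eigenvectorUnitary.2
  · have := hA.spectral_theorem
    rw [Unitary.conjStarAlgAut_apply] at this
    exact this
  · have h := hA.mulVec_eigenvectorBasis i
    have h2 : Matrix.toEuclideanCLM (n := S) (𝕜 := ℂ) A (hA.eigenvectorBasis i)
        = (hA.eigenvalues i : ℂ) • hA.eigenvectorBasis i := by
      apply (WithLp.equiv 2 _).injective
      refine h.trans ?_
      ext k
      simp
    have h3 := (Matrix.toEuclideanCLM (n := S) (𝕜 := ℂ) A).le_opNorm (hA.eigenvectorBasis i)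
    rw [h2, norm_smul, hA.eigenvectorBasis.norm_eq_one, mul_one, mul_one] at h3
    rw [opNorm]
    simpa using h3

end Spectral

end GQPE
end

noncomputable section
namespace GQPE

/-! ### Gibbs states and detailed balance -/

section Gibbs

open scoped ComplexOrder

variable {S : Type} [Fintype S] [DecidableEq S]

theorem trace_specOp {U : Op S} (hU : Uᴴ * U = 1) (g : S → ℂ) :
    Matrix.trace (specOp U g) = ∑ i, g i := by
  unfold specOp
  rw [mul_assoc, Matrix.trace_mul_comm, mul_assoc, hU, mul_one, Matrix.trace_diagonal]

theorem gibbs_eq_specOp {H : Op S} (hH : H.IsHermitian) (β : ℝ) :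
    ∃ (V : Op S) (μ : S → ℝ), Vᴴ * V = 1 ∧ gibbs β H = specOp V fun i =>
      ((Real.exp (-β * μ i) / ∑ k, Real.exp (-β * μ k) : ℝ) : ℂ) := by
  obtain ⟨V, μ, h1, -, h3, -⟩ := exists_specOp hH
  refine ⟨V, μ, h1, ?_⟩
  have h4 : NormedSpace.exp ((-(β : ℂ)) • H)
      = specOp V fun i => ((Real.exp (-β * μ i) : ℝ) : ℂ) := by
    rw [h3, specOp_smul, specOp_exp h1]
    congr 1; ext i; push_cast; rfl
  unfold gibbs
  rw [h4, trace_specOp h1, specOp_smul]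
  congr 1; ext i; push_cast; rw [div_eq_inv_mul]

theorem gibbs_posSemidef {H : Op S} (hH : H.IsHermitian) (β : ℝ) : (gibbs β H).PosSemidef := by
  obtain ⟨V, μ, -, h⟩ := gibbs_eq_specOp hH β
  rw [h]
  refine Matrix.PosSemidef.mul_mul_conjTranspose_same
    (Matrix.posSemidef_diagonal_iff.2 fun i => ?_) V
  rw [Complex.zero_le_real]
  positivity

theorem trace_gibbs [Nonempty S] {H : Op S} (hH : H.IsHermitian) (β : ℝ) :
    Matrix.trace (gibbs β H) = 1 := by
  obtain ⟨V, μ, h1, h⟩ := gibbs_eq_specOp hH β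
  have : (0 : ℝ) < ∑ k, Real.exp (-β * μ k) :=
    Finset.sum_pos (fun i _ => Real.exp_pos _) Finset.univ_nonempty
  rw [h, trace_specOp h1, ← Complex.ofReal_sum, ← Finset.sum_div, div_self this.ne',
    Complex.ofReal_one]

/-- The populations of `ρ` in the basis given by the columns of `U`. -/
def population (U ρ : Op S) (i : S) : ℝ := ((Uᴴ * ρ * U) i i).re

omit [DecidableEq S] in
theorem population_nonneg {ρ : Op S} (hρ : ρ.PosSemidef) (U : Op S) (i : S) :
    0 ≤ population U ρ i :=
  (Complex.le_def.1 ((hρ.conjTranspose_mul_mul_same U).diag_nonneg (i := i))).1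

theorem sum_population {U ρ : Op S} (hU : U * Uᴴ = 1) (hρ : Matrix.trace ρ = 1) :
    ∑ i, population U ρ i = 1 := by
  have : ∑ i, population U ρ i = (Matrix.trace (Uᴴ * ρ * U)).re := by
    rw [Matrix.trace, Complex.re_sum]; rfl
  rw [this, Matrix.trace_mul_comm, ← mul_assoc, hU, one_mul, hρ, Complex.one_re]

theorem commute_gibbs {K H : Op S} (h : Commute K H) (β : ℝ) : Commute K (gibbs β H) :=
  ((h.smul_right _).exp_right).smul_right _

theorem commute_opPow {K ρ : Op S} (h : Commute K ρ) (s : ℝ) : Commute K (opPow ρ s) :=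
  (h.symm.cfc_real _).symm

/-- Each `K j` commutes with the powers of `ρ`, so cyclicity of the trace carries it from `B` over
to `A`. The weights are real but of any sign, so the channel and its centred version are both
covered. -/
theorem detailedBalance_of_commute {J : Type} [Fintype J] {ρ : Op S} {K : J → Op S}
    (hK : ∀ j, (K j)ᴴ = K j) (hc : ∀ j, Commute (K j) ρ) (w : J → ℝ) (s : ℝ) :
    DetailedBalance ρ s w K := by
  intro A B
  unfold weightedInner krausDual
  simp only [hK, Matrix.conjTranspose_sum, Matrix.conjTranspose_smul, Matrix.conjTranspose_mul,
    Finset.mul_sum, Finset.sum_mul, Matrix.trace_sum, Matrix.mul_smul, Matrix.smul_mul,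
    Matrix.trace_smul]
  refine Finset.sum_congr rfl fun j _ => ?_
  have h1 := commute_opPow (hc j) (1 - s)
  have h2 := commute_opPow (hc j) s
  have : Matrix.trace (Aᴴ * opPow ρ (1 - s) * (K j * B * K j) * opPow ρ s)
      = Matrix.trace (K j * (Aᴴ * K j) * opPow ρ (1 - s) * B * opPow ρ s) := by
    calc _ = Matrix.trace (Aᴴ * (opPow ρ (1 - s) * K j) * B * (K j * opPow ρ s)) := by
          simp only [mul_assoc]
      _ = Matrix.trace (Aᴴ * (K j * opPow ρ (1 - s)) * B * (opPow ρ s * K j)) := by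
          rw [h1.eq, h2.eq]
      _ = Matrix.trace (Aᴴ * (K j * opPow ρ (1 - s)) * B * opPow ρ s * K j) := by
          simp only [mul_assoc]
      _ = _ := by rw [Matrix.trace_mul_comm]; simp only [mul_assoc]
  rw [this]
  simp

end Gibbs

/-! ### Measurements diagonal in one eigenbasis -/

section SpectralMeasurement

open scoped ComplexOrder

variable {S J : Type} [Fintype S] [DecidableEq S] [Fintype J] {M : Measurement S J} {U : Op S}
  {f : S → J → ℝ}

theorem Measurement.isComplete_of_specOp (hU : Uᴴ * U = 1) (hU' : U * Uᴴ = 1)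
    (hM : ∀ j, M.kraus j = specOp U fun i => (f i j : ℂ)) (hf : ∀ i, ∑ j, f i j ^ 2 = 1) :
    M.IsComplete := by
  unfold Measurement.IsComplete
  have : ∀ j, (M.kraus j)ᴴ * M.kraus j = specOp U fun i => ((f i j ^ 2 : ℝ) : ℂ) := fun j => by
    rw [hM, specOp_ofReal_conjTranspose, specOp_mul hU]
    congr 1; ext i; push_cast; ring
  simp_rw [this]
  rw [specOp_sum, ← specOp_one hU']
  congr 1; ext i; rw [← Complex.ofReal_sum, hf, Complex.ofReal_one]

omit [Fintype J] in
theorem Measurement.prob_of_specOp (hU : Uᴴ * U = 1)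
    (hM : ∀ j, M.kraus j = specOp U fun i => (f i j : ℂ)) (ρ : Op S) (j : J) :
    M.prob ρ j = ∑ i, population U ρ i * f i j ^ 2 := by
  unfold Measurement.prob
  rw [Matrix.trace_mul_comm, ← mul_assoc, hM, specOp_ofReal_conjTranspose, specOp_mul hU]
  simp_rw [← Complex.ofReal_mul, ← sq]
  exact trace_specOp_mul U _ ρ

omit [Fintype J] in
-- Both measurements are diagonal in the same basis, so on each eigenvector the probabilities
-- multiply.
theorem Measurement.prob₂_of_specOp (hU : Uᴴ * U = 1)
    (hM : ∀ j, M.kraus j = specOp U fun i => (f i j : ℂ)) (ρ : Op S) (j k : J) :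
    M.prob₂ ρ j k = ∑ i, population U ρ i * (f i j ^ 2 * f i k ^ 2) := by
  unfold Measurement.prob₂
  have : M.kraus k * M.kraus j * ρ * (M.kraus j)ᴴ * (M.kraus k)ᴴ
      = (M.kraus k * M.kraus j * ρ) * ((M.kraus j)ᴴ * (M.kraus k)ᴴ) := by rw [← mul_assoc]
  rw [this, Matrix.trace_mul_comm, ← mul_assoc, ← mul_assoc, hM, hM, specOp_ofReal_conjTranspose,
    specOp_ofReal_conjTranspose, specOp_mul hU, specOp_mul hU, specOp_mul hU]
  have h : ∀ i, (f i j : ℂ) * f i k * f i k * f i j = ((f i j ^ 2 * f i k ^ 2 : ℝ) : ℂ) :=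
    fun i => by push_cast; ring
  simp_rw [h]
  exact trace_specOp_mul U _ ρ

theorem obsExp_specOp (g : S → ℝ) (ρ : Op S) :
    obsExp ρ (specOp U fun i => (g i : ℂ)) = ∑ i, population U ρ i * g i := by
  unfold obsExp
  rw [Matrix.trace_mul_comm]
  exact trace_specOp_mul U g ρ

theorem Measurement.channel_of_commute (hM : M.IsComplete) {ρ : Op S}
    (hs : ∀ j, (M.kraus j)ᴴ = M.kraus j) (hc : ∀ j, Commute (M.kraus j) ρ) :
    M.channel ρ = ρ := by
  unfold Measurement.channel krausMap
  have : ∀ j, ((1 : ℝ) : ℂ) • (M.kraus j * ρ * (M.kraus j)ᴴ)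
      = ρ * ((M.kraus j)ᴴ * M.kraus j) := fun j => by
    rw [Complex.ofReal_one, one_smul, (hc j).eq, hs, mul_assoc]
  simp_rw [this]
  rw [← Finset.mul_sum]
  rw [Measurement.IsComplete] at hM
  rw [hM, mul_one]

/-- Statistics of a measurement with commuting Kraus operators `∑ᵢ fᵢⱼ |i⟩⟨i|`, whose outcome
approximates the eigenvalue `lam i` of `O` on each common eigenvector. -/
theorem Measurement.statistics_of_specOp (hU : Uᴴ * U = 1) (hU' : U * Uᴴ = 1)
    (hM : ∀ j, M.kraus j = specOp U fun i => (f i j : ℂ)) (hf : ∀ i, ∑ j, f i j ^ 2 = 1)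
    {ρ O : Op S} (hρ : ρ.PosSemidef) (hρ1 : Matrix.trace ρ = 1) {lam : S → ℝ} {κ δ v : ℝ}
    (hO : O = specOp U fun i => (lam i : ℂ)) (hlam : ∀ i, |lam i| ≤ κ)
    (hδ : ∀ i, |∑ j, M.outcome j * f i j ^ 2 - lam i| ≤ δ)
    (hv : ∀ i, ∑ j, (M.outcome j - lam i) ^ 2 * f i j ^ 2 ≤ v) :
    |M.expect ρ - obsExp ρ O| ≤ δ ∧
    |M.variance ρ - obsVar ρ O| ≤ v + 4 * κ * δ + δ ^ 2 ∧
    |M.covariance ρ| ≤ M.variance ρ := by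
  have hq := population_nonneg hρ U
  have hq1 := sum_population hU' hρ1
  have hE : M.expect ρ = ∑ j, M.outcome j * ∑ i, population U ρ i * f i j ^ 2 := by
    unfold Measurement.expect
    simp_rw [M.prob_of_specOp hU hM]
  have hO1 : obsExp ρ O = ∑ i, population U ρ i * lam i := by rw [hO, obsExp_specOp]
  have hO2 : obsExp ρ (O * O) = ∑ i, population U ρ i * (lam i * lam i) := by
    rw [hO, specOp_mul hU]
    simp_rw [← Complex.ofReal_mul]
    rw [obsExp_specOp]
  refine ⟨?_, ?_, ?_⟩
  · rw [hE, hO1]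
    exact mixture_mean_error hq hq1 hδ
  · unfold Measurement.variance obsVar
    rw [hE, hO1, hO2]
    simp_rw [M.prob_of_specOp hU hM]
    exact mixture_variance_error hq hq1 (fun i j => sq_nonneg _) hf hlam hδ hv
  · unfold Measurement.covariance Measurement.variance
    simp_rw [M.prob_of_specOp hU hM, M.prob₂_of_specOp hU hM]
    exact mixture_covariance_le hq (fun i j => sq_nonneg _) hf _

end SpectralMeasurement

end GQPE
end

noncomputable section
namespace GQPE

/-! ### Readout amplitudes on an eigenvector -/

section Amplitudes

variable {m : ℕ}

/-- The real amplitudes of the Gaussian resource state. -/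
def resourceAmp (m : ℕ) (γ : ℝ) (l : Readout m) : ℝ :=
  if l.val = 0 then 0 else Real.sqrt (step m) * gaussHat γ (node m l) / normConst m γ

theorem resourceState_eq_ofReal (m : ℕ) (γ : ℝ) (l : Readout m) :
    resourceState m γ l = (resourceAmp m γ l : ℂ) := by
  unfold resourceState resourceAmp
  split_ifs <;> simp

/-- The amplitude of the readout `j` on an eigenvector of `O / κ` with eigenvalue `t`. -/
def ampl (m : ℕ) (γ t : ℝ) (j : Readout m) : ℝ :=
  (Real.sqrt ((2 : ℝ) ^ (2 * m)))⁻¹ *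
    ∑ l, resourceAmp m γ l * Real.cos (2 * Real.pi * (node m l * (node m j - t)))

theorem centred_neg (l : Readout m) (hl : l.val ≠ 0) : centred m (-l) = -centred m l := by
  have h1 : (-l).val = 2 ^ (2 * m) - l.val := by
    rw [Fin.val_neg', Nat.mod_eq_of_lt]
    have := l.isLt
    omega
  unfold centred
  rw [h1, Nat.cast_sub l.isLt.le]
  push_cast
  ring

theorem neg_val_eq_zero (l : Readout m) : (-l).val = 0 ↔ l.val = 0 := by
  rw [Fin.val_eq_zero_iff, Fin.val_eq_zero_iff, neg_eq_zero]

/-- Negation in `Fin N` reflects the centred index when `ℓ ≠ 0`, while `ℓ = 0` is its own negative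
and carries no amplitude. The weights are thus even. This cancellation makes the Kraus operators
Hermitian. -/
theorem sum_resourceAmp_sin (γ y : ℝ) :
    ∑ l : Readout m, resourceAmp m γ l * Real.sin (2 * Real.pi * (node m l * y)) = 0 := by
  have h := Equiv.sum_comp (Equiv.neg (Readout m))
    fun l => resourceAmp m γ l * Real.sin (2 * Real.pi * (node m l * y))
  have h2 : ∀ l : Readout m, resourceAmp m γ (-l) * Real.sin (2 * Real.pi * (node m (-l) * y))
      = -(resourceAmp m γ l * Real.sin (2 * Real.pi * (node m l * y))) := by
    intro l
    unfold resourceAmp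
    by_cases hl : l.val = 0
    · rw [if_pos hl, if_pos ((neg_val_eq_zero l).2 hl)]; simp
    · rw [if_neg hl, if_neg fun h => hl ((neg_val_eq_zero l).1 h)]
      have h3 : node m (-l) = -node m l := by
        unfold node; rw [centred_neg l hl]; ring
      have h4 : gaussHat γ (-node m l) = gaussHat γ (node m l) := by
        unfold gaussHat; rw [neg_sq]
      rw [h3, h4, neg_mul, mul_neg, Real.sin_neg, mul_neg]
  simp only [Equiv.neg_apply, h2, Finset.sum_neg_distrib] at h
  linarith

theorem step_sq (m : ℕ) : step m * step m = ((2 : ℝ) ^ (2 * m))⁻¹ := by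
  unfold step
  rw [← mul_inv, ← pow_add, two_mul]

theorem ampl_eq_sum (γ t : ℝ) (j : Readout m) :
    (ampl m γ t j : ℂ) = ∑ l, shiftedQFT m j l *
      (Complex.exp (-(2 * Real.pi * Complex.I * (node m l * t : ℝ))) * resourceState m γ l) := by
  have h : ∀ l, shiftedQFT m j l *
      (Complex.exp (-(2 * Real.pi * Complex.I * (node m l * t : ℝ))) * resourceState m γ l)
      = (((Real.sqrt ((2 : ℝ) ^ (2 * m)))⁻¹ : ℝ) : ℂ) *
        ((resourceAmp m γ l * Real.cos (2 * Real.pi * (node m l * (node m j - t))) : ℝ) +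
        ((resourceAmp m γ l * Real.sin (2 * Real.pi * (node m l * (node m j - t))) : ℝ) : ℂ)
          * Complex.I) := by
    intro l
    have h1 : (centred m l * centred m j / (2 : ℝ) ^ (2 * m) : ℝ) = node m l * node m j := by
      unfold node
      rw [div_eq_mul_inv, ← step_sq]; ring
    simp only [shiftedQFT, Matrix.of_apply]
    rw [h1, resourceState_eq_ofReal]
    have h2 : Complex.exp (2 * Real.pi * Complex.I * (node m l * node m j : ℝ)) *
        Complex.exp (-(2 * Real.pi * Complex.I * (node m l * t : ℝ)))
        = Complex.cos ((2 * Real.pi * (node m l * (node m j - t)) : ℝ))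
          + Complex.sin ((2 * Real.pi * (node m l * (node m j - t)) : ℝ)) * Complex.I := by
      rw [← Complex.exp_add, ← Complex.exp_mul_I]
      congr 1; push_cast; ring
    rw [one_div]
    calc _ = (((Real.sqrt ((2 : ℝ) ^ (2 * m)))⁻¹ : ℝ) : ℂ) * (resourceAmp m γ l : ℂ) *
          (Complex.exp (2 * Real.pi * Complex.I * (node m l * node m j : ℝ)) *
        Complex.exp (-(2 * Real.pi * Complex.I * (node m l * t : ℝ)))) := by ring
      _ = _ := by rw [h2]; push_cast; ring
  simp_rw [h]
  rw [← Finset.mul_sum, Finset.sum_add_distrib, ← Finset.sum_mul, ← Complex.ofReal_sum,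
    ← Complex.ofReal_sum, sum_resourceAmp_sin, ampl]
  push_cast
  ring

theorem normConst_sq (m : ℕ) (γ : ℝ) : normConst m γ ^ 2 =
    step m * ∑ l : Readout m, if l.val = 0 then 0 else gaussHat γ (node m l) ^ 2 := by
  unfold normConst
  rw [Real.sq_sqrt]
  refine mul_nonneg (by unfold step; positivity) (Finset.sum_nonneg fun l _ => ?_)
  split_ifs
  · exact le_rfl
  · positivity

/-- Only the central term `ℓ = N/2` is kept. -/
theorem le_normConst_sq (hm : 0 < m) {γ : ℝ} (hγ : 0 < γ) :
    step m * (2 * Real.sqrt (2 * Real.pi) * γ) ≤ normConst m γ ^ 2 := by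
  rw [normConst_sq]
  refine mul_le_mul_of_nonneg_left ?_ (by unfold step; positivity)
  have hlt : 2 ^ (2 * m - 1) < 2 ^ (2 * m) := Nat.pow_lt_pow_right (by norm_num) (by omega)
  set l₀ : Readout m := ⟨2 ^ (2 * m - 1), hlt⟩
  have h0 : node m l₀ = 0 := by
    unfold node centred
    have : ((l₀.val : ℕ) : ℝ) = 2 ^ (2 * m) / 2 := by
      rw [eq_div_iff (by norm_num)]
      simp only [l₀]
      push_cast
      rw [← pow_succ]; congr 1; omega
    rw [this]; ring
  have hne : l₀.val ≠ 0 := by simp only [l₀]; positivity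
  have h := Finset.single_le_sum (f := fun l : Readout m =>
    if l.val = 0 then 0 else gaussHat γ (node m l) ^ 2) (s := Finset.univ)
    (fun l _ => by split_ifs <;> positivity) (Finset.mem_univ l₀)
  refine le_trans (le_of_eq ?_) h
  simp only [hne, if_false, h0]
  unfold gaussHat
  rw [mul_pow, Real.sq_sqrt (by positivity)]
  simp

theorem normConst_sq_pos (hm : 0 < m) {γ : ℝ} (hγ : 0 < γ) : 0 < normConst m γ ^ 2 := by
  refine lt_of_lt_of_le ?_ (le_normConst_sq hm hγ)
  unfold step; positivity

theorem sum_resourceAmp_sq (hm : 0 < m) {γ : ℝ} (hγ : 0 < γ) :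
    ∑ l, resourceAmp m γ l ^ 2 = 1 := by
  have h : ∀ l, resourceAmp m γ l ^ 2
      = step m * (if l.val = 0 then 0 else gaussHat γ (node m l) ^ 2) / normConst m γ ^ 2 := by
    intro l
    unfold resourceAmp
    split_ifs
    · simp
    · rw [div_pow, mul_pow, Real.sq_sqrt (by unfold step; positivity)]
  simp_rw [h]
  rw [← Finset.sum_div, ← Finset.mul_sum, ← normConst_sq,
    div_self (normConst_sq_pos hm hγ).ne']

/-- For `l ≠ l'` the terms form a geometric series in an `N`-th root of unity, which is not 1
because `0 < |l' - l| < N`. -/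
theorem sum_star_shiftedQFT_mul (l l' : Readout m) :
    ∑ j, star (shiftedQFT m j l) * shiftedQFT m j l' = if l = l' then 1 else 0 := by
  set N : ℝ := 2 ^ (2 * m) with hN
  have hNpos : 0 < N := by positivity
  set d : ℤ := (l'.val : ℤ) - l.val with hd
  have h1 : ∀ j : Readout m, star (shiftedQFT m j l) * shiftedQFT m j l'
      = ((N⁻¹ : ℝ) : ℂ) * unitPhase (-(d / 2)) * unitPhase (d / N) ^ j.val := by
    intro j
    have hp : ∀ t : ℝ, Complex.exp (2 * Real.pi * Complex.I * (t : ℂ)) = unitPhase t := fun t => by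
      unfold unitPhase; congr 1; push_cast; ring
    have hs : ∀ t : ℝ, star (unitPhase t) = unitPhase (-t) := fun t => by
      unfold unitPhase
      rw [Complex.star_def, ← Complex.exp_conj]
      rw [map_mul, Complex.conj_ofReal, Complex.conj_I]
      congr 1
      push_cast; ring
    have hpow : ∀ (t : ℝ) (k : ℕ), unitPhase t ^ k = unitPhase (k * t) := fun t k => by
      unfold unitPhase
      rw [← Complex.exp_nat_mul]; congr 1; push_cast; ring
    simp only [shiftedQFT, Matrix.of_apply, hp]
    rw [star_mul', hs, hpow, Complex.star_def, Complex.conj_ofReal]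
    have h2 : ((1 / Real.sqrt N : ℝ) : ℂ) * ((1 / Real.sqrt N : ℝ) : ℂ) = ((N⁻¹ : ℝ) : ℂ) := by
      rw [← Complex.ofReal_mul, div_mul_div_comm, Real.mul_self_sqrt hNpos.le, one_mul, one_div]
    have h3 : -(centred m l * centred m j / N) + centred m l' * centred m j / N
        = -((d : ℝ) / 2) + j.val * (d / N) := by
      unfold centred
      rw [← hN, hd]
      push_cast
      field_simp
      ring
    calc _ = (((1 / Real.sqrt N : ℝ) : ℂ) * ((1 / Real.sqrt N : ℝ) : ℂ)) *
          (unitPhase (-(centred m l * centred m j / N)) *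
            unitPhase (centred m l' * centred m j / N)) := by
            ring
      _ = _ := by rw [h2, ← unitPhase_add, h3, unitPhase_add]; ring
  simp_rw [h1]
  rw [← Finset.mul_sum, Fin.sum_univ_eq_sum_range (fun k => unitPhase (d / N) ^ k) (2 ^ (2 * m))]
  split_ifs with h
  · have hd0 : d = 0 := by rw [hd, h]; simp
    rw [hd0]
    simp only [Int.cast_zero, zero_div, neg_zero, unitPhase_zero, one_pow, Finset.sum_const,
      Finset.card_range, nsmul_eq_mul, mul_one, hN]
    push_cast
    rw [inv_mul_cancel₀ (pow_ne_zero _ two_ne_zero)]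
  · have hz : unitPhase (d / N) ≠ 1 := by
      intro hz
      unfold unitPhase at hz
      rw [Complex.exp_eq_one_iff] at hz
      obtain ⟨n, hn⟩ := hz
      have h2 : (d : ℝ) / N = n := by
        have hne : (2 * Real.pi * Complex.I : ℂ) ≠ 0 := Complex.two_pi_I_ne_zero
        have : ((d / N : ℝ) : ℂ) * (2 * Real.pi * Complex.I) = n * (2 * Real.pi * Complex.I) := by
          rw [← hn]; push_cast; ring
        have := mul_right_cancel₀ hne this
        exact_mod_cast this
      rw [div_eq_iff hNpos.ne', hN] at h2
      have h3 : d = n * 2 ^ (2 * m) := by exact_mod_cast h2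
      have hl := l.isLt
      have hl' := l'.isLt
      have hne : l.val ≠ l'.val := fun hh => h (Fin.ext hh)
      have hl2 : (l.val : ℤ) < 2 ^ (2 * m) := by exact_mod_cast hl
      have hl2' : (l'.val : ℤ) < 2 ^ (2 * m) := by exact_mod_cast hl'
      have hdvd : (2 ^ (2 * m) : ℤ) ∣ d := ⟨n, by rw [h3]; ring⟩
      have hz := Int.eq_zero_of_abs_lt_dvd hdvd (by rw [abs_lt]; constructor <;> omega)
      omega
    have hzN : unitPhase (d / N) ^ (2 ^ (2 * m)) = 1 := by
      have : unitPhase (d / N) ^ (2 ^ (2 * m)) = unitPhase d := by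
        unfold unitPhase
        rw [← Complex.exp_nat_mul]
        congr 1
        have : (N : ℂ) ≠ 0 := by exact_mod_cast hNpos.ne'
        have hN' : (N : ℂ) = 2 ^ (2 * m) := by rw [hN]; push_cast; rfl
        push_cast
        rw [← hN']
        field_simp
      rw [this, unitPhase_int]
    rw [geom_sum_eq hz, hzN]
    simp

/-- Parseval: the evolution multiplies the resource amplitudes by phases, and the columns of the
transform are orthonormal. -/
theorem sum_ampl_sq (hm : 0 < m) {γ : ℝ} (hγ : 0 < γ) (t : ℝ) :
    ∑ j, ampl m γ t j ^ 2 = 1 := by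
  set v : Readout m → ℂ := fun l =>
    Complex.exp (-(2 * Real.pi * Complex.I * (node m l * t : ℝ))) * resourceState m γ l with hv
  have h1 : ∀ j, ((ampl m γ t j ^ 2 : ℝ) : ℂ)
      = ∑ l, ∑ l', star (v l) * v l' * (star (shiftedQFT m j l) * shiftedQFT m j l') := by
    intro j
    have h2 : (ampl m γ t j : ℂ) = ∑ l, shiftedQFT m j l * v l := ampl_eq_sum γ t j
    have h3 : (ampl m γ t j : ℂ) = ∑ l, star (shiftedQFT m j l) * star (v l) := by
      have := congrArg star h2
      rw [star_sum] at this
      simp only [star_mul', Complex.star_def, Complex.conj_ofReal] at this ⊢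
      exact this
    rw [sq, Complex.ofReal_mul]
    nth_rewrite 1 [h3]
    rw [h2, Finset.sum_mul_sum]
    exact Finset.sum_congr rfl fun l _ => Finset.sum_congr rfl fun l' _ => by ring
  have h4 : ∀ l, star (v l) * v l = ((resourceAmp m γ l ^ 2 : ℝ) : ℂ) := by
    intro l
    have hp : Complex.exp (-(2 * Real.pi * Complex.I * (node m l * t : ℝ)))
        = unitPhase (-(node m l * t)) := by
      unfold unitPhase; congr 1; push_cast; ring
    simp only [hv]
    rw [hp, resourceState_eq_ofReal, star_mul', Complex.star_def,
      Complex.conj_ofReal]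
    have := unitPhase_mul_star (-(node m l * t))
    rw [Complex.star_def] at this
    rw [Complex.ofReal_pow]
    linear_combination (resourceAmp m γ l : ℂ) ^ 2 * this
  have : ((∑ j, ampl m γ t j ^ 2 : ℝ) : ℂ) = 1 := by
    rw [Complex.ofReal_sum]
    simp_rw [h1]
    rw [Finset.sum_comm]
    simp_rw [Finset.sum_comm (s := (Finset.univ : Finset (Readout m)))
      (f := fun j l' => star (v _) * v l' * (star (shiftedQFT m j _) * shiftedQFT m j l')),
      ← Finset.mul_sum, sum_star_shiftedQFT_mul]
    simp only [mul_ite, mul_one, mul_zero, Finset.sum_ite_eq, Finset.mem_univ, if_true, h4]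
    rw [← Complex.ofReal_sum, sum_resourceAmp_sq hm hγ, Complex.ofReal_one]
  exact_mod_cast this

end Amplitudes

/-! ### Kraus operators as functions of the observable -/

section KrausOperators

variable {S : Type} [Fintype S] [DecidableEq S] {m : ℕ}

theorem evolution_specOp {U : Op S} (hU : Uᴴ * U = 1) (lam : S → ℝ) (τ : ℝ) :
    evolution τ (specOp U fun i => (lam i : ℂ))
      = specOp U fun i => Complex.exp (-(Complex.I * τ) * lam i) := by
  unfold evolution
  rw [specOp_smul, specOp_exp hU]

theorem algKraus_eq_sum (γ κ : ℝ) (O : Op S) (j : Readout m) :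
    algKraus m γ κ O j = ∑ l : Readout m, (shiftedQFT m j l * resourceState m γ l) •
      evolution (2 * Real.pi * node m l * κ⁻¹) O := by
  ext x y
  rw [algKraus_apply, Matrix.sum_apply]
  exact Finset.sum_congr rfl fun l _ => by rw [Matrix.smul_apply, smul_eq_mul]; ring

theorem algKraus_specOp {U : Op S} (hU : Uᴴ * U = 1) (lam : S → ℝ) (γ κ : ℝ) (j : Readout m) :
    algKraus m γ κ (specOp U fun i => (lam i : ℂ)) j
      = specOp U fun i => (ampl m γ (κ⁻¹ * lam i) j : ℂ) := by
  rw [algKraus_eq_sum]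
  simp_rw [evolution_specOp hU, specOp_smul]
  rw [specOp_sum]
  congr 1
  ext i
  rw [ampl_eq_sum]
  refine Finset.sum_congr rfl fun l _ => ?_
  have : -(Complex.I * ((2 * Real.pi * node m l * κ⁻¹ : ℝ) : ℂ)) * lam i
      = -(2 * Real.pi * Complex.I * (node m l * (κ⁻¹ * lam i) : ℝ)) := by push_cast; ring
  rw [this]; ring

theorem commute_algKraus {O H : Op S} (h : Commute O H) (γ κ : ℝ) (j : Readout m) :
    Commute (algKraus m γ κ O j) H := by
  rw [algKraus_eq_sum]
  refine Commute.sum_left _ _ _ fun l _ => ?_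
  exact ((h.smul_left _).exp_left).smul_left _

end KrausOperators

end GQPE
end

noncomputable section
namespace GQPE

/-! ### Theta series and Poisson summation -/

section GaussianSums

theorem hasSum_exp_neg_sq {b : ℝ} (hb : 0 < b) (s : ℝ) :
    HasSum (fun n : ℤ => Real.exp (-(b * (n + s) ^ 2)))
      (HurwitzZeta.evenKernel s (b / Real.pi)) := by
  have h := HurwitzZeta.hasSum_int_evenKernel s (t := b / Real.pi) (by positivity)
  refine h.congr_fun fun n => ?_
  congr 1
  have := Real.pi_ne_zero
  field_simp

theorem hasSum_cos_mul_exp_neg_sq {b : ℝ} (hb : 0 < b) (s : ℝ) :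
    HasSum (fun n : ℤ => Real.cos (2 * Real.pi * (n * s)) * Real.exp (-(b * n ^ 2)))
      (HurwitzZeta.cosKernel s (b / Real.pi)) := by
  have h := HurwitzZeta.hasSum_int_cosKernel s (t := b / Real.pi) (by positivity)
  have h2 := Complex.hasSum_re h
  rw [Complex.ofReal_re] at h2
  refine h2.congr_fun fun n => ?_
  have h3 : (2 * Real.pi * Complex.I * s * n : ℂ)
      = ((2 * Real.pi * (n * s) : ℝ) : ℂ) * Complex.I := by push_cast; ring
  rw [Complex.re_mul_ofReal, h3, Complex.exp_ofReal_mul_I_re]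
  congr 2
  have := Real.pi_ne_zero
  field_simp

theorem cosKernel_eq_evenKernel {t : ℝ} (ht : 0 < t) (s : ℝ) :
    HurwitzZeta.cosKernel s t = Real.sqrt t⁻¹ * HurwitzZeta.evenKernel s t⁻¹ := by
  have h := HurwitzZeta.evenKernel_functional_equation s t⁻¹
  have h2 : (0 : ℝ) < (t⁻¹) ^ (1 / 2 : ℝ) := by positivity
  rw [Real.sqrt_eq_rpow, h, one_div t⁻¹, inv_inv]
  field_simp

/-- Poisson summation for a Gaussian. -/
theorem hasSum_cos_mul_exp_neg_sq_poisson {b : ℝ} (hb : 0 < b) (s : ℝ) :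
    HasSum (fun n : ℤ => Real.cos (2 * Real.pi * (n * s)) * Real.exp (-(b * n ^ 2)))
      (Real.sqrt (Real.pi / b) *
        ∑' n : ℤ, Real.exp (-(Real.pi ^ 2 / b * (n + s) ^ 2))) := by
  have h := hasSum_cos_mul_exp_neg_sq hb s
  rw [cosKernel_eq_evenKernel (by positivity), inv_div] at h
  have h2 := (hasSum_exp_neg_sq (b := Real.pi ^ 2 / b) (by positivity) s).tsum_eq
  have h3 : Real.pi ^ 2 / b / Real.pi = Real.pi / b := by field_simp
  rw [h3] at h2
  rwa [h2]

theorem hasSum_exp_neg_mul_abs {b : ℝ} (hb : 0 < b) :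
    HasSum (fun n : ℤ => Real.exp (-(b * |(n : ℝ)|))) (2 * (1 - Real.exp (-b))⁻¹ - 1) := by
  have h1 : HasSum (fun n : ℕ => Real.exp (-(b * |((n : ℤ) : ℝ)|))) (1 - Real.exp (-b))⁻¹ := by
    refine (hasSum_geometric_of_lt_one (Real.exp_pos (-b)).le
      (by rw [Real.exp_lt_one_iff]; linarith)).congr_fun fun n => ?_
    rw [← Real.exp_nat_mul]
    congr 1
    simp [mul_comm]
  have h2 : HasSum (fun n : ℕ => Real.exp (-(b * |((-(n : ℤ) : ℤ) : ℝ)|)))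
      (1 - Real.exp (-b))⁻¹ := by
    refine h1.congr_fun fun n => ?_
    simp
  have h3 := HasSum.of_nat_of_neg (f := fun n : ℤ => Real.exp (-(b * |(n : ℝ)|))) h1 h2
  have h4 : (1 - Real.exp (-b))⁻¹ + (1 - Real.exp (-b))⁻¹ - Real.exp (-(b * |((0 : ℤ) : ℝ)|))
      = 2 * (1 - Real.exp (-b))⁻¹ - 1 := by
    rw [Int.cast_zero, abs_zero, mul_zero, neg_zero, Real.exp_zero]; ring
  rwa [h4] at h3

/-- On the integers `n² ≥ |n|`, which leaves a geometric series. -/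
theorem tsum_exp_neg_sq_zero_le {b : ℝ} (hb : 0 < b) :
    ∑' n : ℤ, Real.exp (-(b * (n + 0) ^ 2)) ≤ 1 + 2 / b := by
  have h1 := hasSum_exp_neg_mul_abs hb
  have h2 := hasSum_exp_neg_sq hb 0
  refine (h2.summable.tsum_le_tsum (fun n => ?_) h1.summable).trans ?_
  · rw [Real.exp_le_exp, neg_le_neg_iff]
    refine mul_le_mul_of_nonneg_left ?_ hb.le
    rw [add_zero, ← sq_abs (n : ℝ)]
    rcases eq_or_ne n 0 with rfl | hn
    · simp
    · have : (1 : ℝ) ≤ |(n : ℝ)| := by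
        rw [← Int.cast_abs]; exact_mod_cast Int.one_le_abs hn
      nlinarith
  · rw [h1.tsum_eq]
    have h3 : 0 < 1 - Real.exp (-b) := by
      rw [sub_pos, Real.exp_lt_one_iff]; linarith
    have h4 : (1 - Real.exp (-b))⁻¹ ≤ 1 + 1 / b := by
      rw [inv_le_comm₀ h3 (by positivity)]
      have h5 : (1 + 1 / b)⁻¹ = 1 - (1 + b)⁻¹ := by field_simp; ring
      rw [h5]
      have h6 : Real.exp (-b) ≤ (1 + b)⁻¹ := by
        rw [Real.exp_neg]
        exact inv_anti₀ (by positivity) (by linarith [Real.add_one_le_exp b])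
      linarith
    have : 2 / b = 2 * (1 / b) := by ring
    linarith

/-- By Poisson summation the shifted sum is a cosine series with positive coefficients, so it is
largest without a shift. -/
theorem tsum_exp_neg_sq_le {b : ℝ} (hb : 0 < b) (s : ℝ) :
    ∑' n : ℤ, Real.exp (-(b * (n + s) ^ 2)) ≤ 1 + 2 / b := by
  refine le_trans ?_ (tsum_exp_neg_sq_zero_le hb)
  have hb' : 0 < Real.pi ^ 2 / b := by positivity
  have e : Real.pi ^ 2 / (Real.pi ^ 2 / b) = b := by field_simp
  have h1 := hasSum_cos_mul_exp_neg_sq_poisson hb' s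
  have h2 := hasSum_cos_mul_exp_neg_sq_poisson hb' 0
  rw [e] at h1 h2
  have h3 := h1.summable.tsum_le_tsum (fun n => ?_) h2.summable
  · rw [h1.tsum_eq, h2.tsum_eq] at h3
    exact le_of_mul_le_mul_left h3 (by positivity)
  · refine mul_le_mul_of_nonneg_right ?_ (Real.exp_pos _).le
    rw [mul_zero, mul_zero, Real.cos_zero]
    exact Real.cos_le_one _

theorem summable_exp_neg_sq {b : ℝ} (hb : 0 < b) (s : ℝ) :
    Summable fun n : ℤ => Real.exp (-(b * (n + s) ^ 2)) := (hasSum_exp_neg_sq hb s).summable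

theorem abs_mul_exp_le (x : ℝ) : |x| ≤ Real.exp (x ^ 2 / 2) := by
  have := Real.add_one_le_exp (x ^ 2 / 2)
  have h : x ^ 2 = |x| ^ 2 := (sq_abs x).symm
  nlinarith [sq_nonneg (|x| - 1)]

/-- The first moment of a wide Gaussian on a shifted lattice is tiny. -/
theorem exists_hasSum_mul_exp_neg_sq {b : ℝ} (hb : 0 < b) (hb3 : 3 ≤ Real.pi ^ 2 / b) (s : ℝ) :
    ∃ v : ℝ, HasSum (fun n : ℤ => (n + s) * Real.exp (-(b * (n + s) ^ 2))) v ∧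
      |v| ≤ (Real.pi / b) ^ (3 / 2 : ℝ) * (3 * Real.exp (-(Real.pi ^ 2 / (2 * b)))) := by
  have hpi := Real.pi_pos
  refine ⟨HurwitzZeta.oddKernel s (b / Real.pi), ?_, ?_⟩
  · refine (HurwitzZeta.hasSum_int_oddKernel s (x := b / Real.pi) (by positivity)).congr_fun
      fun n => ?_
    congr 2
    field_simp
  · rw [HurwitzZeta.oddKernel_functional_equation, one_div, ← Real.inv_rpow (by positivity),
      one_div, inv_div, abs_mul, abs_of_nonneg (by positivity)]
    refine mul_le_mul_of_nonneg_left ?_ (by positivity)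
    have h1 := HurwitzZeta.hasSum_int_sinKernel s (t := Real.pi / b) (by positivity)
    have h2 : HasSum (fun n : ℤ => Real.exp (-(Real.pi ^ 2 / (2 * b))) *
        Real.exp (-(1 * ((n : ℝ) + 0) ^ 2)))
        (Real.exp (-(Real.pi ^ 2 / (2 * b))) * ∑' n : ℤ, Real.exp (-(1 * ((n : ℝ) + 0) ^ 2))) :=
      (summable_exp_neg_sq one_pos 0).hasSum.mul_left _
    have h3 := h1.norm_le_of_bounded h2 fun n => ?_
    · rw [Complex.norm_real, Real.norm_eq_abs] at h3
      refine h3.trans ?_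
      have h4 := tsum_exp_neg_sq_le one_pos 0
      nlinarith [Real.exp_pos (-(Real.pi ^ 2 / (2 * b)))]
    · have h5 : (2 * Real.pi * Complex.I * s * n : ℂ)
          = ((2 * Real.pi * (n * s) : ℝ) : ℂ) * Complex.I := by push_cast; ring
      rw [h5, norm_mul, norm_mul, norm_mul, Complex.norm_exp_ofReal_mul_I, norm_neg,
        Complex.norm_I, one_mul, mul_one, Complex.norm_intCast, Complex.norm_real,
        Real.norm_of_nonneg (Real.exp_pos _).le, ← Real.exp_add]
      rcases eq_or_ne n 0 with rfl | hn
      · simp; positivity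
      · have hn1 : (1 : ℝ) ≤ (n : ℝ) ^ 2 := by
          rw [← sq_abs, ← Int.cast_abs]
          exact_mod_cast one_le_pow₀ (Int.one_le_abs hn)
        -- With `t = π²/b ≥ 3` and `n² ≥ 1` one has `n²/2 - t n² ≤ -t/2 - n²`: the factor `n` is
        -- absorbed, and the bound retains both the small constant and a summable term.
        refine (mul_le_mul_of_nonneg_right (abs_mul_exp_le _) (Real.exp_pos _).le).trans ?_
        rw [← Real.exp_add, Real.exp_le_exp]
        have e1 : Real.pi ^ 2 / (2 * b) = Real.pi ^ 2 / b / 2 := by field_simp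
        have e2 : -Real.pi * (n : ℝ) ^ 2 * (Real.pi / b) = -(Real.pi ^ 2 / b * n ^ 2) := by ring
        rw [e1, e2]
        nlinarith

theorem abs_sub_sum_le_tsum {ι : Type} {f g : ι → ℝ} {v : ℝ} (hf : HasSum f v) (hg : Summable g)
    (hg0 : ∀ i, 0 ≤ g i) (F : Finset ι) (h : ∀ i, i ∉ F → |f i| ≤ g i) :
    |∑ i ∈ F, f i - v| ≤ ∑' i, g i := by
  classical
  have h1 : HasSum (fun i => if i ∈ F then f i else 0) (∑ i ∈ F, f i) := by
    rw [← Finset.sum_congr rfl fun i hi => if_pos hi]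
    exact hasSum_sum_of_ne_finset_zero fun i hi => if_neg hi
  have h2 := (h1.sub hf).norm_le_of_bounded hg.hasSum fun i => ?_
  · exact h2
  · split_ifs with hi
    · simpa using hg0 i
    · simpa using h i hi

end GaussianSums

end GQPE
end

noncomputable section
namespace GQPE

/-! ### The truncated Fourier series of the filter -/

section FilterSum

variable {m : ℕ}

/-- The truncated Fourier series of the Gaussian filter. -/
def gaussSum (m : ℕ) (a y : ℝ) : ℝ :=
  ∑ l : Readout m, (if l.val = 0 then 0 else Real.exp (-(a * centred m l ^ 2))) *
    Real.cos (2 * Real.pi * (node m l * y))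

/-- The centred index as an integer. -/
def centredIdx (m : ℕ) (l : Readout m) : ℤ := (l.val : ℤ) - 2 ^ (2 * m - 1)

theorem centredIdx_injective : Function.Injective (centredIdx m) := by
  intro l l' h
  unfold centredIdx at h
  exact Fin.ext (by omega)

theorem centredIdx_cast (hm : 0 < m) (l : Readout m) :
    ((centredIdx m l : ℤ) : ℝ) = centred m l := by
  unfold centredIdx centred
  push_cast
  congr 1
  rw [eq_div_iff (by norm_num), ← pow_succ]
  congr 1; omega

theorem exists_centredIdx_eq (hm : 0 < m) {n : ℤ} (hn : |(n : ℝ)| < 2 ^ (2 * m) / 2) :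
    ∃ l : Readout m, l.val ≠ 0 ∧ centredIdx m l = n := by
  have e : ((2 : ℝ) ^ (2 * m)) / 2 = ((2 ^ (2 * m - 1) : ℤ) : ℝ) := by
    push_cast
    rw [div_eq_iff (by norm_num), ← pow_succ]
    congr 1; omega
  rw [e, ← Int.cast_abs] at hn
  have h1 : |n| < 2 ^ (2 * m - 1) := by exact_mod_cast hn
  rw [abs_lt] at h1
  have h2 : (2 : ℤ) ^ (2 * m) = 2 * 2 ^ (2 * m - 1) := by
    rw [← pow_succ']; congr 1; omega
  have h3 : (n + 2 ^ (2 * m - 1)).toNat < 2 ^ (2 * m) := by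
    zify
    rw [Int.toNat_of_nonneg (by omega), h2]
    omega
  refine ⟨⟨(n + 2 ^ (2 * m - 1)).toNat, h3⟩, ?_, ?_⟩
  · have := h1.1
    simp only [ne_eq]
    omega
  · unfold centredIdx
    simp only
    rw [Int.toNat_of_nonneg (by omega)]
    ring

/-- The omitted indices satisfy `n² ≥ N²/4`. Half of the exponent `a n²` yields the factor
`exp(-aN²/8)` and the other half remains for summation; the full series is evaluated by Poisson
summation. -/
theorem abs_gaussSum_sub_le (hm : 0 < m) {a : ℝ} (ha : 0 < a) (y : ℝ) :
    |gaussSum m a y - Real.sqrt (Real.pi / a) *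
        ∑' n : ℤ, Real.exp (-(Real.pi ^ 2 / a * (n + step m * y) ^ 2))|
      ≤ Real.exp (-(a * ((2 : ℝ) ^ (2 * m)) ^ 2 / 8)) * (1 + 4 / a) := by
  classical
  have h := hasSum_cos_mul_exp_neg_sq_poisson ha (step m * y)
  set F : Finset ℤ := (Finset.univ.filter fun l : Readout m => l.val ≠ 0).image (centredIdx m)
  have hF : gaussSum m a y = ∑ n ∈ F,
      Real.cos (2 * Real.pi * (n * (step m * y))) * Real.exp (-(a * (n : ℝ) ^ 2)) := by
    rw [Finset.sum_image fun l _ l' _ h => centredIdx_injective h, Finset.sum_filter]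
    unfold gaussSum
    refine Finset.sum_congr rfl fun l _ => ?_
    by_cases hl : l.val = 0
    · simp [hl]
    · rw [if_neg hl, if_pos hl, centredIdx_cast hm, node]
      rw [mul_comm, mul_assoc (centred m l)]
  set c := Real.exp (-(a * ((2 : ℝ) ^ (2 * m)) ^ 2 / 8)) with hc
  have hs := summable_exp_neg_sq (b := a / 2) (by positivity) 0
  rw [hF]
  refine (abs_sub_sum_le_tsum h (hs.mul_left c) (fun n => by positivity) F fun n hn => ?_).trans ?_
  · rw [abs_mul, abs_of_pos (Real.exp_pos _)]
    refine (mul_le_of_le_one_left (Real.exp_pos _).le (Real.abs_cos_le_one _)).trans ?_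
    rw [hc, ← Real.exp_add, Real.exp_le_exp]
    have h2 : (2 : ℝ) ^ (2 * m) / 2 ≤ |(n : ℝ)| := by
      by_contra! hlt
      obtain ⟨l, hl, hln⟩ := exists_centredIdx_eq hm hlt
      exact hn (Finset.mem_image.2 ⟨l, Finset.mem_filter.2 ⟨Finset.mem_univ _, hl⟩, hln⟩)
    have h3 : ((2 : ℝ) ^ (2 * m) / 2) ^ 2 ≤ (n : ℝ) ^ 2 := by
      rw [← sq_abs (n : ℝ)]
      exact pow_le_pow_left₀ (by positivity) h2 2
    nlinarith
  · rw [tsum_mul_left]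
    refine mul_le_mul_of_nonneg_left ?_ (Real.exp_pos _).le
    refine (tsum_exp_neg_sq_le (by positivity) 0).trans (le_of_eq ?_)
    field_simp; norm_num

/-- Again the exponent is halved: one half is at least `D` off `F`, and `b ≥ 2` bounds the series
formed by the other half by 3. -/
theorem abs_sum_sub_tsum_exp_le {b D : ℝ} (hb : 2 ≤ b) (s : ℝ) (F : Finset ℤ)
    (hF : ∀ n : ℤ, n ∉ F → 2 * D ≤ b * (n + s) ^ 2) :
    |∑ n ∈ F, Real.exp (-(b * (n + s) ^ 2)) - ∑' n : ℤ, Real.exp (-(b * (n + s) ^ 2))|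
      ≤ 3 * Real.exp (-D) := by
  have hb0 : 0 < b := by linarith
  have hs := summable_exp_neg_sq (b := b / 2) (by positivity) s
  refine (abs_sub_sum_le_tsum (hasSum_exp_neg_sq hb0 s |>.summable.hasSum)
    (hs.mul_left (Real.exp (-D))) (fun n => by positivity) F fun n hn => ?_).trans ?_
  · rw [abs_of_pos (Real.exp_pos _), ← Real.exp_add, Real.exp_le_exp]
    linarith [hF n hn]
  · rw [tsum_mul_left, mul_comm]
    refine mul_le_mul_of_nonneg_right ?_ (Real.exp_pos _).le
    refine (tsum_exp_neg_sq_le (by positivity) s).trans ?_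
    have : 2 / (b / 2) ≤ 2 := by rw [div_le_iff₀ (by positivity)]; linarith
    linarith

/-- The normalisation `Z` is needed only through `Z ≥ 1`, which its central term provides, because
only upper bounds are drawn from this formula. -/
theorem ampl_eq_gaussSum (hm : 0 < m) {γ : ℝ} (hγ : 0 < γ) (t : ℝ) :
    ∃ Z : ℝ, 1 ≤ Z ∧ ∀ j, ampl m γ t j ^ 2
      = step m ^ 2 * gaussSum m (decay m γ) (node m j - t) ^ 2 / Z := by
  refine ⟨∑ l : Readout m, if l.val = 0 then 0 else
          Real.exp (-(decay m γ * centred m l ^ 2)) ^ 2, ?_, fun j => ?_⟩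
  · obtain ⟨l₀, hl₀, h0⟩ := exists_centredIdx_eq hm (n := 0) (by simp)
    have hc : centred m l₀ = 0 := by rw [← centredIdx_cast hm, h0, Int.cast_zero]
    have h := Finset.single_le_sum (f := fun l : Readout m =>
      if l.val = 0 then 0 else Real.exp (-(decay m γ * centred m l ^ 2)) ^ 2) (s := Finset.univ)
      (fun l _ => by split_ifs <;> positivity) (Finset.mem_univ l₀)
    refine le_trans (le_of_eq ?_) h
    simp [hl₀, hc]
  · set Z := ∑ l : Readout m, if l.val = 0 then 0 else
          Real.exp (-(decay m γ * centred m l ^ 2)) ^ 2 with hZ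
    have hZ0 : 0 ≤ Z := Finset.sum_nonneg fun l _ => by split_ifs <;> positivity
    have h1 : ∀ l, resourceAmp m γ l
        = (if l.val = 0 then 0 else Real.exp (-(decay m γ * centred m l ^ 2))) / Real.sqrt Z := by
      intro l
      have h2 := resourceState_eq m hγ l
      rw [resourceState_eq_ofReal] at h2
      rw [Complex.ofReal_inj.1 h2]
      split_ifs
      · simp
      · rfl
    have h2 : ampl m γ t j = step m * gaussSum m (decay m γ) (node m j - t) / Real.sqrt Z := by
      unfold ampl gaussSum
      simp_rw [h1, div_mul_eq_mul_div]
      rw [← Finset.sum_div, mul_div_assoc]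
      congr 1
      rw [step, mul_comm 2 m, pow_mul, Real.sqrt_sq (by positivity)]
    rw [h2, div_pow, mul_pow, Real.sq_sqrt hZ0]

end FilterSum

end GQPE
end

noncomputable section
namespace GQPE

/-! ### Truncation, aliases and tails of the filter -/

section FilterBounds

/-- The width of the filter, for which `decay` is half an inverse power of four. -/
def filterWidth (r : ℕ) : ℝ := (2 * Real.sqrt 2 * Real.pi * 2 ^ r)⁻¹

theorem filterWidth_pos (r : ℕ) : 0 < filterWidth r := by
  unfold filterWidth; positivity

theorem decay_filterWidth (r q : ℕ) :
    decay (r + q) (filterWidth r) = (2 * (((2 : ℝ) ^ r) ^ 2 * 2 ^ q) ^ 2)⁻¹ := by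
  unfold decay filterWidth step
  have h2 : Real.sqrt 2 ^ 2 = 2 := Real.sq_sqrt (by norm_num)
  have : (2 * Real.sqrt 2 * Real.pi * 2 ^ r) ^ 2 = 8 * Real.pi ^ 2 * ((2 : ℝ) ^ r) ^ 2 := by
    rw [mul_pow, mul_pow, mul_pow, h2]; ring
  rw [inv_pow, this, inv_pow, pow_add]
  have hpi := Real.pi_ne_zero
  field_simp
  norm_num

theorem node_bounds {m : ℕ} (j : Readout m) : -(2 ^ m / 2) ≤ node m j ∧ node m j ≤ 2 ^ m / 2 := by
  have h1 : (0 : ℝ) ≤ j.val := Nat.cast_nonneg _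
  have h2 : (j.val : ℝ) ≤ 2 ^ (2 * m) := by exact_mod_cast j.isLt.le
  have h3 : (0 : ℝ) < 2 ^ m := by positivity
  have h4 : (2 : ℝ) ^ (2 * m) = 2 ^ m * 2 ^ m := by rw [two_mul, pow_add]
  unfold node centred step
  rw [← div_eq_mul_inv, le_div_iff₀ h3, div_le_iff₀ h3, h4]
  rw [h4] at h2
  constructor <;> nlinarith

variable {r q : ℕ} {κ δ x : ℝ}

/-- The integers `n` label the aliases of the Gaussian, spaced by the grid length `2^m`, and `F` is
the set of those retained. Truncation costs `aN²/8 = (2^q)²/16` in the exponent; the dropped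
aliases, at distance at least `1/κ`, cost `π²(2^r)²/κ²`. The set `{0}` gives the Gaussian
approximation, and the empty set the bound far from the eigenvalue. -/
theorem abs_gaussSum_sub_sum_le (hm : 4 ≤ (2 : ℝ) ^ (r + q))
    (hδ : Real.exp (-(Real.pi ^ 2 * (2 ^ r) ^ 2 / κ ^ 2)) ≤ δ)
    (hδ' : Real.exp (-((2 ^ q) ^ 2 / 16)) ≤ δ) (y : ℝ) (F : Finset ℤ)
    (hF : ∀ n : ℤ, n ∉ F → 1 / κ ^ 2 ≤ (n * 2 ^ (r + q) + y) ^ 2) :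
    |gaussSum (r + q) (decay (r + q) (filterWidth r)) y
      - Real.sqrt (2 * Real.pi) * ((2 ^ r) ^ 2 * 2 ^ q) *
        ∑ n ∈ F, Real.exp (-(2 * Real.pi ^ 2 * (2 ^ r) ^ 2 * (n * 2 ^ (r + q) + y) ^ 2))|
      ≤ 18 * ((2 ^ r) ^ 2 * 2 ^ q) ^ 2 * δ := by
  have hrq : 0 < r + q := by
    by_contra! h
    rw [Nat.le_zero.1 h] at hm
    norm_num at hm
  have hpi := Real.pi_pos
  have hpi3 := Real.pi_gt_three
  have hpi4 := Real.pi_lt_four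
  set R : ℝ := 2 ^ r with hR
  set Q : ℝ := 2 ^ q with hQ
  have hR1 : 1 ≤ R := one_le_pow₀ (by norm_num)
  have hQ1 : 1 ≤ Q := one_le_pow₀ (by norm_num)
  have hM : (2 : ℝ) ^ (r + q) = R * Q := pow_add _ _ _
  set W := R ^ 2 * Q with hW
  have hW1 : 1 ≤ W := one_le_mul_of_one_le_of_one_le (one_le_pow₀ hR1) hQ1
  have ha : decay (r + q) (filterWidth r) = (2 * W ^ 2)⁻¹ := decay_filterWidth r q
  rw [ha]
  have h1 := abs_gaussSum_sub_le hrq (a := (2 * W ^ 2)⁻¹) (by positivity) y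
  have e1 : Real.sqrt (Real.pi / (2 * W ^ 2)⁻¹) = Real.sqrt (2 * Real.pi) * W := by
    rw [div_inv_eq_mul, show Real.pi * (2 * W ^ 2) = 2 * Real.pi * W ^ 2 by ring,
      Real.sqrt_mul (by positivity), Real.sqrt_sq (by positivity)]
  have e2 : (2 * W ^ 2)⁻¹ * ((2 : ℝ) ^ (2 * (r + q))) ^ 2 / 8 = Q ^ 2 / 16 := by
    have : (2 : ℝ) ^ (2 * (r + q)) = (R * Q) ^ 2 := by rw [← hM, ← pow_mul, mul_comm]
    rw [this, hW]
    field_simp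
    norm_num
  have e3 : ∀ n : ℤ, Real.pi ^ 2 / (2 * W ^ 2)⁻¹ * (n + step (r + q) * y) ^ 2
      = 2 * Real.pi ^ 2 * R ^ 2 * (n * 2 ^ (r + q) + y) ^ 2 := by
    intro n
    have : step (r + q) = (R * Q)⁻¹ := by rw [step, hM]
    rw [this, hM, hW]
    field_simp
  rw [e1, e2] at h1
  have h2 := abs_sum_sub_tsum_exp_le (b := Real.pi ^ 2 / (2 * W ^ 2)⁻¹)
    (D := Real.pi ^ 2 * R ^ 2 / κ ^ 2)
    (by rw [div_inv_eq_mul]; nlinarith [one_le_pow₀ hW1 (n := 2)])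
    (step (r + q) * y) F fun n hn => by
      rw [e3]
      have := mul_le_mul_of_nonneg_left (hF n hn) (a := 2 * Real.pi ^ 2 * R ^ 2) (by positivity)
      refine le_trans (le_of_eq ?_) this
      ring
  simp_rw [e3] at h1 h2
  set T := ∑' n : ℤ, Real.exp (-(2 * Real.pi ^ 2 * R ^ 2 * (n * 2 ^ (r + q) + y) ^ 2)) with hT
  set P := ∑ n ∈ F, Real.exp (-(2 * Real.pi ^ 2 * R ^ 2 * (n * 2 ^ (r + q) + y) ^ 2)) with hP
  have hs : Real.sqrt (2 * Real.pi) ≤ 3 := by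
    rw [Real.sqrt_le_left (by norm_num)]; linarith
  have hδ0 : 0 < δ := lt_of_lt_of_le (Real.exp_pos _) hδ
  have h3 : |gaussSum (r + q) (2 * W ^ 2)⁻¹ y - Real.sqrt (2 * Real.pi) * W * T|
      ≤ 9 * W ^ 2 * δ := by
    refine h1.trans ?_
    rw [div_inv_eq_mul]
    have := mul_le_mul hδ' (show 1 + 4 * (2 * W ^ 2) ≤ 9 * W ^ 2 by
      nlinarith [one_le_pow₀ hW1 (n := 2)]) (by positivity) hδ0.le
    linarith
  have h4 : |Real.sqrt (2 * Real.pi) * W * (P - T)| ≤ 9 * W ^ 2 * δ := by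
    rw [abs_mul, abs_of_nonneg (by positivity)]
    have h5 : |P - T| ≤ 3 * δ := h2.trans (by linarith)
    have h6 : Real.sqrt (2 * Real.pi) * W ≤ 3 * W ^ 2 := by
      calc Real.sqrt (2 * Real.pi) * W ≤ 3 * W := by gcongr
        _ ≤ 3 * W ^ 2 := by nlinarith
    calc _ ≤ 3 * W ^ 2 * (3 * δ) := mul_le_mul h6 h5 (abs_nonneg _) (by positivity)
      _ = _ := by ring
  have : gaussSum (r + q) (2 * W ^ 2)⁻¹ y - Real.sqrt (2 * Real.pi) * W * P
      = (gaussSum (r + q) (2 * W ^ 2)⁻¹ y - Real.sqrt (2 * Real.pi) * W * T)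
        - Real.sqrt (2 * Real.pi) * W * (P - T) := by ring
  rw [this]
  refine (abs_sub _ _).trans ?_
  linarith

/-- Grid points lie within `2^m/2` of the origin, so a nonzero alias is displaced by at least `2^m/2
- 1 ≥ 1`. -/
theorem one_div_sq_le_shift (hm : 4 ≤ (2 : ℝ) ^ (r + q)) (hκ : 1 ≤ κ) (hx : |x| ≤ 1)
    (j : Readout (r + q)) {n : ℤ} (hn : n ≠ 0) :
    1 / κ ^ 2 ≤ ((n : ℝ) * 2 ^ (r + q) + (node (r + q) j - x)) ^ 2 := by
  obtain ⟨h1, h2⟩ := node_bounds j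
  obtain ⟨h3, h4⟩ := abs_le.1 hx
  have h5 : 1 / κ ^ 2 ≤ 1 := by
    rw [div_le_one (by positivity)]; exact one_le_pow₀ hκ
  refine h5.trans ?_
  have h6 : n ≤ -1 ∨ 1 ≤ n := by omega
  rcases h6 with h6 | h6
  · have h7 : (n : ℝ) ≤ -1 := by exact_mod_cast h6
    have h8 : (n : ℝ) * 2 ^ (r + q) + (node (r + q) j - x) ≤ -1 := by nlinarith
    nlinarith
  · have h7 : (1 : ℝ) ≤ n := by exact_mod_cast h6
    have h8 : 1 ≤ (n : ℝ) * 2 ^ (r + q) + (node (r + q) j - x) := by nlinarith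
    nlinarith

theorem abs_gaussSum_sub_gauss_le (hm : 4 ≤ (2 : ℝ) ^ (r + q)) (hκ : 1 ≤ κ) (hx : |x| ≤ 1)
    (hδ : Real.exp (-(Real.pi ^ 2 * (2 ^ r) ^ 2 / κ ^ 2)) ≤ δ)
    (hδ' : Real.exp (-((2 ^ q) ^ 2 / 16)) ≤ δ) (j : Readout (r + q)) :
    |gaussSum (r + q) (decay (r + q) (filterWidth r)) (node (r + q) j - x)
      - Real.sqrt (2 * Real.pi) * ((2 ^ r) ^ 2 * 2 ^ q) *
        Real.exp (-(2 * Real.pi ^ 2 * (2 ^ r) ^ 2 * (node (r + q) j - x) ^ 2))|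
      ≤ 18 * ((2 ^ r) ^ 2 * 2 ^ q) ^ 2 * δ := by
  have := abs_gaussSum_sub_sum_le hm hδ hδ' (node (r + q) j - x) {0} fun n hn =>
    one_div_sq_le_shift hm hκ hx j (by simpa using hn)
  simpa using this

theorem abs_gaussSum_le_of_far (hm : 4 ≤ (2 : ℝ) ^ (r + q)) (hκ : 1 ≤ κ) (hx : |x| ≤ 1)
    (hδ : Real.exp (-(Real.pi ^ 2 * (2 ^ r) ^ 2 / κ ^ 2)) ≤ δ)
    (hδ' : Real.exp (-((2 ^ q) ^ 2 / 16)) ≤ δ) (j : Readout (r + q))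
    (hj : 1 / κ < |node (r + q) j - x|) :
    |gaussSum (r + q) (decay (r + q) (filterWidth r)) (node (r + q) j - x)|
      ≤ 18 * ((2 ^ r) ^ 2 * 2 ^ q) ^ 2 * δ := by
  have := abs_gaussSum_sub_sum_le hm hδ hδ' (node (r + q) j - x) ∅ fun n _ => by
    by_cases hn : n = 0
    · rw [hn, Int.cast_zero, zero_mul, zero_add, ← sq_abs (node _ _ - x), ← _root_.one_div_pow]
      exact pow_le_pow_left₀ (by positivity) hj.le 2
    · exact one_div_sq_le_shift hm hκ hx j hn
  simpa using this

end FilterBounds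

end GQPE
end

noncomputable section
namespace GQPE

/-! ### Far readouts and the lattice first moment -/

section Moments

variable {r q : ℕ} {κ δ x : ℝ}

theorem step_pos (m : ℕ) : 0 < step m := by unfold step; positivity

theorem card_mul_step_sq (m : ℕ) : (Fintype.card (Readout m) : ℝ) * step m ^ 2 = 1 := by
  rw [Fintype.card_fin, sq, step_sq]
  push_cast
  rw [mul_inv_cancel₀ (by positivity)]

/-- The probability of a readout far from the eigenvalue. -/
theorem far_probability_le (hm : 4 ≤ (2 : ℝ) ^ (r + q)) (hκ : 1 ≤ κ) (hx : |x| ≤ 1)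
    (hδ : Real.exp (-(Real.pi ^ 2 * (2 ^ r) ^ 2 / κ ^ 2)) ≤ δ)
    (hδ' : Real.exp (-((2 ^ q) ^ 2 / 16)) ≤ δ) (hrq : 0 < r + q) :
    ∑ j : Readout (r + q), (if |node (r + q) j - x| ≤ 1 / κ then 0
      else ampl (r + q) (filterWidth r) x j ^ 2)
      ≤ (18 * ((2 ^ r) ^ 2 * 2 ^ q) ^ 2 * δ) ^ 2 := by
  set η := 18 * (((2 : ℝ) ^ r) ^ 2 * 2 ^ q) ^ 2 * δ with hη
  obtain ⟨Z, hZ, h⟩ := ampl_eq_gaussSum hrq (filterWidth_pos r) x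
  -- A bound uniform in `j` is enough, because the `N` readouts satisfy `N h² = 1`.
  have h1 : ∀ j : Readout (r + q), (if |node (r + q) j - x| ≤ 1 / κ then 0
      else ampl (r + q) (filterWidth r) x j ^ 2) ≤ step (r + q) ^ 2 * η ^ 2 := by
    intro j
    split_ifs with hj
    · positivity
    · rw [h]
      refine (div_le_self (by positivity) hZ).trans ?_
      refine mul_le_mul_of_nonneg_left ?_ (by positivity)
      rw [← sq_abs]
      exact pow_le_pow_left₀ (abs_nonneg _)
        (abs_gaussSum_le_of_far hm hκ hx hδ hδ' j (not_le.1 hj)) 2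
  refine (Finset.sum_le_sum fun j _ => h1 j).trans (le_of_eq ?_)
  rw [Finset.sum_const, nsmul_eq_mul, Finset.card_univ, ← mul_assoc, card_mul_step_sq, one_mul]

set_option maxHeartbeats 1000000 in
/-- The first moment of the Gaussian over the grid points near `x`. -/
theorem abs_sum_near_gauss_le (hm : 8 ≤ (2 : ℝ) ^ (r + q)) (hκ : 1 ≤ κ) (hx : |x| ≤ 1)
    (hδ : Real.exp (-(Real.pi ^ 2 * (2 ^ r) ^ 2 / κ ^ 2)) ≤ δ)
    (hδ' : Real.exp (-((2 ^ q) ^ 2 / 16)) ≤ δ) (hq : 2 ≤ q) (hrq : 0 < r + q) :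
    |∑ j : Readout (r + q), (if |node (r + q) j - x| ≤ 1 / κ then (node (r + q) j - x) *
      Real.exp (-(4 * Real.pi ^ 2 * (2 ^ r) ^ 2 * (node (r + q) j - x) ^ 2)) else 0)|
      ≤ 5 * (2 ^ q) ^ 3 * δ := by
  classical
  have hpi := Real.pi_pos
  have hpi3 := Real.pi_gt_three
  set R : ℝ := 2 ^ r with hR
  set Q : ℝ := 2 ^ q with hQ
  set h := step (r + q) with hh
  have hR1 : 1 ≤ R := one_le_pow₀ (by norm_num)
  have hQ4 : 4 ≤ Q := by
    rw [hQ, show (4 : ℝ) = 2 ^ 2 by norm_num]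
    exact pow_le_pow_right₀ (by norm_num) hq
  have hM : (2 : ℝ) ^ (r + q) = R * Q := pow_add _ _ _
  have hh' : h = (R * Q)⁻¹ := by rw [hh, step, hM]
  have hpos : 0 < h := step_pos _
  have hδ0 : 0 < δ := lt_of_lt_of_le (Real.exp_pos _) hδ
  set s := -(x / h) with hs
  have hys : ∀ n : ℝ, n * h - x = h * (n + s) := by intro n; rw [hs]; field_simp; ring
  -- In lattice units the Gaussian is `exp(-B(n+s)²)`, and `π²/B = Q²/4 ≥ 4` makes it wide enough
  -- for the first moment estimate.
  set B := 4 * Real.pi ^ 2 / Q ^ 2 with hB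
  have hBpos : 0 < B := by positivity
  have hBy : ∀ n : ℝ, 4 * Real.pi ^ 2 * R ^ 2 * (n * h - x) ^ 2 = B * (n + s) ^ 2 := by
    intro n; rw [hys, hB, hh']; field_simp
  have hβ : Real.pi ^ 2 / B = Q ^ 2 / 4 := by rw [hB]; field_simp
  obtain ⟨v, hv, hvle⟩ := exists_hasSum_mul_exp_neg_sq hBpos (by rw [hβ]; nlinarith) s
  set F : Finset ℤ := (Finset.univ.filter fun j : Readout (r + q) =>
    |node (r + q) j - x| ≤ 1 / κ).image (centredIdx (r + q))
  have h1 : ∑ j : Readout (r + q), (if |node (r + q) j - x| ≤ 1 / κ then (node (r + q) j - x) *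
      Real.exp (-(4 * Real.pi ^ 2 * R ^ 2 * (node (r + q) j - x) ^ 2)) else 0)
      = h * ∑ n ∈ F, ((n + s) * Real.exp (-(B * (n + s) ^ 2))) := by
    rw [Finset.sum_image fun l _ l' _ h => centredIdx_injective h, Finset.mul_sum,
      Finset.sum_filter]
    refine Finset.sum_congr rfl fun j _ => ?_
    refine if_congr Iff.rfl ?_ rfl
    rw [centredIdx_cast hrq, node, ← hh, hBy, hys, mul_assoc]
  have hsum := summable_exp_neg_sq (b := B / 4) (by positivity) s
  have h2 := abs_sub_sum_le_tsum hv (hsum.mul_left (R * Q * δ)) (fun n => by positivity) F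
    fun n hn => by
      have hfar : 1 / κ < |(n : ℝ) * h - x| := by
        by_contra! hle
        -- A lattice point within `1/κ` of `x` has `|nh| ≤ 2 < 2^m/2` and so is a readout index.
        -- Everything missing from `F` is therefore far from `x`.
        have hlt : |(n : ℝ)| < 2 ^ (2 * (r + q)) / 2 := by
          have h3 : |(n : ℝ) * h| ≤ 2 := by
            have h4 : (n : ℝ) * h = (n * h - x) + x := by ring
            rw [h4]
            refine (abs_add_le _ _).trans ?_
            have : 1 / κ ≤ 1 := by rw [div_le_one (by positivity)]; exact hκ
            linarith
          rw [abs_mul, abs_of_pos hpos, hh', ← div_eq_mul_inv, div_le_iff₀ (by positivity)] at h3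
          rw [two_mul, pow_add, hM]
          rw [hM] at hm
          nlinarith
        obtain ⟨l, -, hln⟩ := exists_centredIdx_eq hrq hlt
        refine hn (Finset.mem_image.2 ⟨l, Finset.mem_filter.2 ⟨Finset.mem_univ _, ?_⟩, hln⟩)
        rw [node, ← centredIdx_cast hrq, hln]
        exact hle
      set y := (n : ℝ) * h - x with hy
      have hn' : (n : ℝ) + s = R * Q * y := by
        rw [hy, hys, hh']; field_simp
      have hyκ : (1 / κ) ^ 2 ≤ y ^ 2 := by
        rw [← sq_abs y]; exact pow_le_pow_left₀ (by positivity) hfar.le 2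
      have e1 : B / 4 * (n + s) ^ 2 = Real.pi ^ 2 * R ^ 2 * y ^ 2 := by
        have := hBy n; rw [← hy] at this; linarith
      have e2 : B * (n + s) ^ 2 = 4 * (Real.pi ^ 2 * R ^ 2 * y ^ 2) := by linarith
      rw [e1, e2, hn', abs_mul, abs_of_pos (Real.exp_pos _), abs_mul, abs_of_nonneg (by positivity),
        mul_assoc, mul_assoc (R * Q)]
      refine mul_le_mul_of_nonneg_left ?_ (by positivity)
      set b := Real.pi ^ 2 * R ^ 2 * y ^ 2 with hb
      -- The exponent `4b` is shared out: `b` absorbs the factor `y`, `2b` yields `δ`, and `b` is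
      -- left for summation.
      calc |y| * Real.exp (-(4 * b)) ≤ Real.exp b * Real.exp (-(4 * b)) := by
            refine mul_le_mul_of_nonneg_right ((abs_mul_exp_le y).trans ?_) (Real.exp_pos _).le
            rw [Real.exp_le_exp, hb]
            have : 1 ≤ Real.pi ^ 2 * R ^ 2 := one_le_mul_of_one_le_of_one_le
              (one_le_pow₀ (by linarith)) (one_le_pow₀ hR1)
            nlinarith [sq_nonneg y]
        _ = Real.exp (-(2 * b)) * Real.exp (-b) := by
            rw [← Real.exp_add, ← Real.exp_add]; congr 1; ring
        _ ≤ δ * Real.exp (-b) := by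
            refine mul_le_mul_of_nonneg_right (le_trans ?_ hδ) (Real.exp_pos _).le
            rw [Real.exp_le_exp, neg_le_neg_iff, hb]
            have := mul_le_mul_of_nonneg_left hyκ (a := Real.pi ^ 2 * R ^ 2) (by positivity)
            have e : Real.pi ^ 2 * R ^ 2 / κ ^ 2 = Real.pi ^ 2 * R ^ 2 * (1 / κ) ^ 2 := by ring
            rw [e]
            have : 0 ≤ Real.pi ^ 2 * R ^ 2 * y ^ 2 := by positivity
            linarith
  rw [tsum_mul_left] at h2
  have h3 := tsum_exp_neg_sq_le (b := B / 4) (by positivity) s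
  have h4 : 2 / (B / 4) ≤ Q ^ 2 := by
    rw [hB, div_le_iff₀ (by positivity)]
    have : Q ^ 2 * (4 * Real.pi ^ 2 / Q ^ 2 / 4) = Real.pi ^ 2 := by field_simp
    rw [this]; nlinarith
  have h5 : |v| ≤ 3 * Q ^ 3 * δ := by
    refine hvle.trans ?_
    have e1 : Real.pi / B ≤ Q ^ 2 := by
      rw [hB, div_le_iff₀ (by positivity)]
      have : Q ^ 2 * (4 * Real.pi ^ 2 / Q ^ 2) = 4 * Real.pi ^ 2 := by field_simp
      rw [this]; nlinarith
    have e2 : (Real.pi / B) ^ (3 / 2 : ℝ) ≤ Q ^ 3 := by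
      refine (Real.rpow_le_rpow (by positivity) e1 (by norm_num)).trans (le_of_eq ?_)
      rw [← Real.rpow_natCast Q 2, ← Real.rpow_mul (by positivity), ← Real.rpow_natCast Q 3]
      norm_num
    have e3 : Real.exp (-(Real.pi ^ 2 / (2 * B))) ≤ δ := by
      refine le_trans ?_ hδ'
      rw [Real.exp_le_exp, neg_le_neg_iff]
      have : Real.pi ^ 2 / (2 * B) = Q ^ 2 / 8 := by
        rw [mul_comm, ← div_div, hβ]; ring
      rw [this]; nlinarith [sq_nonneg Q]
    calc _ ≤ Q ^ 3 * (3 * δ) := mul_le_mul e2 (by linarith) (by positivity) (by positivity)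
      _ = _ := by ring
  rw [h1, abs_mul, abs_of_pos hpos]
  set P := ∑ n ∈ F, ((n : ℝ) + s) * Real.exp (-(B * (n + s) ^ 2)) with hP
  have h6 : |P| ≤ R * Q * δ * (2 * Q ^ 2) + 3 * Q ^ 3 * δ := by
    have : P = (P - v) + v := by ring
    rw [this]
    refine (abs_add_le _ _).trans (add_le_add (h2.trans ?_) h5)
    refine mul_le_mul_of_nonneg_left ?_ (by positivity)
    nlinarith
  calc h * |P| ≤ h * (R * Q * δ * (2 * Q ^ 2) + 3 * Q ^ 3 * δ) :=
        mul_le_mul_of_nonneg_left h6 hpos.le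
    _ = (R * Q)⁻¹ * (R * Q) * (2 * Q ^ 2 * δ) + (R * Q)⁻¹ * (3 * Q ^ 3 * δ) := by rw [hh']; ring
    _ ≤ 1 * (2 * Q ^ 3 * δ) + 1 * (3 * Q ^ 3 * δ) := by
        have e1 : (R * Q)⁻¹ ≤ 1 := inv_le_one_of_one_le₀
          (one_le_mul_of_one_le_of_one_le hR1 (by linarith))
        rw [inv_mul_cancel₀ (by positivity)]
        have e2 : Q ^ 2 ≤ Q ^ 3 := pow_le_pow_right₀ (by linarith) (by norm_num)
        gcongr
    _ = 5 * Q ^ 3 * δ := by ring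

end Moments

end GQPE
end

noncomputable section
namespace GQPE

/-! ### Moments of the raw outcome -/

section OutcomeMoments

variable {r q : ℕ} {κ δ x : ℝ}

/-- The squared Fourier sum is replaced by a squared Gaussian. Its first moment is small by
cancellation on the lattice; the replacement error is small pointwise, and `N h² = 1` sums it
without cancellation. The constant covers `35 + 108 + 324`. -/
theorem abs_near_moment_le (hm : 8 ≤ (2 : ℝ) ^ (r + q)) (hκ : 1 ≤ κ) (hx : |x| ≤ 1)
    (hδ : Real.exp (-(Real.pi ^ 2 * (2 ^ r) ^ 2 / κ ^ 2)) ≤ δ)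
    (hδ' : Real.exp (-((2 ^ q) ^ 2 / 16)) ≤ δ) (hδ1 : δ ≤ 1) (hq : 2 ≤ q) (hrq : 0 < r + q) :
    |∑ j : Readout (r + q), (if |node (r + q) j - x| ≤ 1 / κ then
      (node (r + q) j - x) * ampl (r + q) (filterWidth r) x j ^ 2 else 0)|
      ≤ 500 * ((2 ^ r) ^ 2 * 2 ^ q) ^ 4 * δ := by
  obtain ⟨Z, hZ, hampl⟩ := ampl_eq_gaussSum hrq (filterWidth_pos r) x
  have hgauss := abs_gaussSum_sub_gauss_le (x := x) (by linarith) hκ hx hδ hδ'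
  have hnear := abs_sum_near_gauss_le hm hκ hx hδ hδ' hq hrq
  have hδ0 : 0 < δ := lt_of_lt_of_le (Real.exp_pos _) hδ
  have hpi := Real.pi_pos
  have hpi4 : 2 * Real.pi ≤ 7 := by linarith [Real.pi_lt_d2]
  set R : ℝ := 2 ^ r with hR
  set Q : ℝ := 2 ^ q with hQ
  have hR1 : 1 ≤ R := one_le_pow₀ (by norm_num)
  have hQ1 : 1 ≤ Q := one_le_pow₀ (by norm_num)
  have hM : (2 : ℝ) ^ (r + q) = R * Q := pow_add _ _ _
  set W := R ^ 2 * Q with hW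
  have hW1 : 1 ≤ W := one_le_mul_of_one_le_of_one_le (one_le_pow₀ hR1) hQ1
  set η := 18 * W ^ 2 * δ with hη
  set G := Real.sqrt (2 * Real.pi) * W with hG
  have hG2 : G ^ 2 = 2 * Real.pi * W ^ 2 := by rw [hG, mul_pow, Real.sq_sqrt (by positivity)]
  have hG0 : 0 ≤ G := by positivity
  have hG3 : G ≤ 3 * W := by
    refine mul_le_mul_of_nonneg_right ?_ (by positivity)
    rw [Real.sqrt_le_left (by norm_num)]; linarith
  set h := step (r + q) with hh
  have hh' : h = (R * Q)⁻¹ := by rw [hh, step, hM]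
  have hcard : (Fintype.card (Readout (r + q)) : ℝ) * h ^ 2 = 1 := card_mul_step_sq _
  set y : Readout (r + q) → ℝ := fun j => node (r + q) j - x with hy
  set e : Readout (r + q) → ℝ := fun j => Real.exp (-(2 * Real.pi ^ 2 * R ^ 2 * y j ^ 2)) with he
  set s : Readout (r + q) → ℝ := fun j =>
    gaussSum (r + q) (decay (r + q) (filterWidth r)) (y j) with hs
  have he2 : ∀ j, e j ^ 2 = Real.exp (-(4 * Real.pi ^ 2 * R ^ 2 * y j ^ 2)) := fun j => by
    rw [he]; simp only; rw [← Real.exp_nat_mul]; congr 1; push_cast; ring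
  have hsq : ∀ j, |s j ^ 2 - (G * e j) ^ 2| ≤ η * (6 * W + η) := by
    intro j
    have h1 : |s j - G * e j| ≤ η := hgauss j
    have he1 : e j ≤ 1 := by
      rw [he]; simp only
      rw [Real.exp_le_one_iff, neg_nonpos]; positivity
    have he0 : 0 < e j := Real.exp_pos _
    have h2 : |s j + G * e j| ≤ 6 * W + η := by
      have : s j + G * e j = (s j - G * e j) + 2 * (G * e j) := by ring
      rw [this]
      refine (abs_add_le _ _).trans ?_
      rw [abs_of_nonneg (show 0 ≤ 2 * (G * e j) by positivity)]
      nlinarith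
    have : s j ^ 2 - (G * e j) ^ 2 = (s j - G * e j) * (s j + G * e j) := by ring
    rw [this, abs_mul]
    exact mul_le_mul h1 h2 (abs_nonneg _) (by positivity)
  have hsplit : ∑ j : Readout (r + q), (if |y j| ≤ 1 / κ then
      y j * ampl (r + q) (filterWidth r) x j ^ 2 else 0)
      = Z⁻¹ * (h ^ 2 * (G ^ 2 * ∑ j, (if |y j| ≤ 1 / κ then
        y j * Real.exp (-(4 * Real.pi ^ 2 * R ^ 2 * y j ^ 2)) else 0)
        + ∑ j, (if |y j| ≤ 1 / κ then y j * (s j ^ 2 - (G * e j) ^ 2) else 0))) := by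
    rw [Finset.mul_sum, ← Finset.sum_add_distrib, Finset.mul_sum, Finset.mul_sum]
    refine Finset.sum_congr rfl fun j _ => ?_
    split_ifs
    · rw [hampl, ← he2]; ring
    · ring
  change |∑ j : Readout (r + q), (if |y j| ≤ 1 / κ then
      y j * ampl (r + q) (filterWidth r) x j ^ 2 else 0)| ≤ _
  have hA : |G ^ 2 * ∑ j, (if |y j| ≤ 1 / κ then
        y j * Real.exp (-(4 * Real.pi ^ 2 * R ^ 2 * y j ^ 2)) else 0)|
        ≤ 7 * W ^ 2 * (5 * Q ^ 3 * δ) := by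
    rw [abs_mul, abs_of_nonneg (sq_nonneg G), hG2]
    exact mul_le_mul (mul_le_mul_of_nonneg_right hpi4 (by positivity)) hnear (abs_nonneg _)
      (by positivity)
  have hB : |∑ j, (if |y j| ≤ 1 / κ then y j * (s j ^ 2 - (G * e j) ^ 2) else 0)|
      ≤ Fintype.card (Readout (r + q)) * (η * (6 * W + η)) := by
    refine (Finset.abs_sum_le_sum_abs _ _).trans ?_
    rw [← Finset.card_univ, ← nsmul_eq_mul]
    refine Finset.sum_le_card_nsmul _ _ _ fun j _ => ?_
    split_ifs with hj
    · rw [abs_mul]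
      have : |y j| ≤ 1 := hj.trans (by rw [div_le_one (by positivity)]; exact hκ)
      calc _ ≤ 1 * (η * (6 * W + η)) := mul_le_mul this (hsq j) (abs_nonneg _) (by norm_num)
        _ = _ := one_mul _
    · rw [abs_zero]; positivity
  rw [hsplit, abs_mul, abs_mul, abs_of_nonneg (sq_nonneg h), abs_of_nonneg (by positivity)]
  have hZ1 : Z⁻¹ ≤ 1 := inv_le_one_of_one_le₀ hZ
  refine (mul_le_of_le_one_left (by positivity) hZ1).trans ?_
  have h1 : h ^ 2 * W ^ 2 = R ^ 2 := by rw [hh', hW]; field_simp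
  have hRQ : R ^ 2 * Q ^ 3 ≤ W ^ 4 := by
    have e1 : W ^ 4 = (R ^ 2 * Q ^ 3) * (R ^ 6 * Q) := by rw [hW]; ring
    rw [e1]
    exact le_mul_of_one_le_right (by positivity)
      (one_le_mul_of_one_le_of_one_le (one_le_pow₀ hR1) hQ1)
  have hW34 : W ^ 3 ≤ W ^ 4 := pow_le_pow_right₀ hW1 (by norm_num)
  calc _ ≤ h ^ 2 * (7 * W ^ 2 * (5 * Q ^ 3 * δ)
        + Fintype.card (Readout (r + q)) * (η * (6 * W + η))) :=
        mul_le_mul_of_nonneg_left ((abs_add_le _ _).trans (add_le_add hA hB)) (sq_nonneg h)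
    _ = 35 * (h ^ 2 * W ^ 2) * Q ^ 3 * δ
        + (Fintype.card (Readout (r + q)) * h ^ 2) * (η * (6 * W + η)) := by ring
    _ = 35 * (R ^ 2 * Q ^ 3) * δ + 108 * W ^ 3 * δ + 324 * W ^ 4 * (δ * δ) := by
        rw [h1, hcard, hη]; ring
    _ ≤ 35 * W ^ 4 * δ + 108 * W ^ 4 * δ + 324 * W ^ 4 * (1 * δ) := by gcongr
    _ ≤ 500 * W ^ 4 * δ := by
        have : 0 ≤ W ^ 4 * δ := by positivity
        linarith

theorem rawOutcome_eq_node {m : ℕ} {j : Readout m} (hκ : 1 ≤ κ) (hx : |x| ≤ 1)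
    (hj : |node m j - x| ≤ 1 / κ) : rawOutcome m j = node m j := by
  have h1 : 1 / κ ≤ 1 := by rw [div_le_one (by positivity)]; exact hκ
  obtain ⟨h2, h3⟩ := abs_le.1 hj
  obtain ⟨h4, h5⟩ := abs_le.1 hx
  exact if_pos ⟨by linarith, by linarith⟩

theorem abs_rawOutcome_sub_le {m : ℕ} (j : Readout m) (hx : |x| ≤ 1) :
    |rawOutcome m j - x| ≤ 3 := by
  obtain ⟨h4, h5⟩ := abs_le.1 hx
  unfold rawOutcome
  rw [abs_le]
  split_ifs with h
  · constructor <;> linarith [h.1, h.2]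
  · constructor <;> linarith

/-- Mean and mean square of the error of the raw outcome on an eigenvector of eigenvalue `x`. -/
theorem rawOutcome_moments (hm : 8 ≤ (2 : ℝ) ^ (r + q)) (hκ : 1 ≤ κ) (hx : |x| ≤ 1)
    (hδ : Real.exp (-(Real.pi ^ 2 * (2 ^ r) ^ 2 / κ ^ 2)) ≤ δ)
    (hδ' : Real.exp (-((2 ^ q) ^ 2 / 16)) ≤ δ) (hδ1 : δ ≤ 1) (hq : 2 ≤ q) :
    |∑ j, rawOutcome (r + q) j * ampl (r + q) (filterWidth r) x j ^ 2 - x|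
      ≤ 1500 * ((2 ^ r) ^ 2 * 2 ^ q) ^ 4 * δ ∧
    ∑ j, (rawOutcome (r + q) j - x) ^ 2 * ampl (r + q) (filterWidth r) x j ^ 2
      ≤ (1 / κ) ^ 2 + 3000 * ((2 ^ r) ^ 2 * 2 ^ q) ^ 4 * δ := by
  have hrq : 0 < r + q := by omega
  have hnear := abs_near_moment_le hm hκ hx hδ hδ' hδ1 hq hrq
  have hfar := far_probability_le (x := x) (by linarith) hκ hx hδ hδ' hrq
  have hsum := sum_ampl_sq hrq (filterWidth_pos r) x
  have hδ0 : 0 < δ := lt_of_lt_of_le (Real.exp_pos _) hδ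
  set W : ℝ := (2 ^ r) ^ 2 * 2 ^ q with hW
  set p : Readout (r + q) → ℝ := fun j => ampl (r + q) (filterWidth r) x j ^ 2 with hp
  have hp0 : ∀ j, 0 ≤ p j := fun j => sq_nonneg _
  set T := ∑ j : Readout (r + q), (if |node (r + q) j - x| ≤ 1 / κ then 0 else p j) with hT
  have hT' : T ≤ 324 * W ^ 4 * δ := by
    refine hfar.trans ?_
    calc (18 * W ^ 2 * δ) ^ 2 = 324 * W ^ 4 * (δ * δ) := by ring
      _ ≤ 324 * W ^ 4 * (1 * δ) := by gcongr
      _ = _ := by ring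
  have hpos : 0 ≤ W ^ 4 * δ := by positivity
  constructor
  · have h1 : ∑ j, rawOutcome (r + q) j * p j - x
        = ∑ j, (if |node (r + q) j - x| ≤ 1 / κ then (node (r + q) j - x) * p j else 0)
        + ∑ j, (if |node (r + q) j - x| ≤ 1 / κ then 0 else (rawOutcome (r + q) j - x) * p j) := by
      have : x = ∑ j, x * p j := by rw [← Finset.mul_sum, hsum, mul_one]
      nth_rewrite 1 [this]
      rw [← Finset.sum_sub_distrib, ← Finset.sum_add_distrib]
      refine Finset.sum_congr rfl fun j _ => ?_
      split_ifs with hj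
      · rw [rawOutcome_eq_node hκ hx hj]; ring
      · ring
    have h2 : |∑ j, (if |node (r + q) j - x| ≤ 1 / κ then 0
        else (rawOutcome (r + q) j - x) * p j)| ≤ 3 * T := by
      rw [hT, Finset.mul_sum]
      refine (Finset.abs_sum_le_sum_abs _ _).trans (Finset.sum_le_sum fun j _ => ?_)
      split_ifs
      · simp
      · rw [abs_mul, abs_of_nonneg (hp0 j)]
        exact mul_le_mul_of_nonneg_right (abs_rawOutcome_sub_le j hx) (hp0 j)
    change |∑ j, rawOutcome (r + q) j * p j - x| ≤ _
    rw [h1]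
    -- Near and far parts give `500 + 3 · 324 ≤ 1500`; in the second moment below, the far part
    -- gives `9 · 324 ≤ 3000`.
    refine (abs_add_le _ _).trans ((add_le_add hnear h2).trans ?_)
    linarith
  · have h1 : ∀ j, (rawOutcome (r + q) j - x) ^ 2 * p j
        ≤ (1 / κ) ^ 2 * p j + 9 * (if |node (r + q) j - x| ≤ 1 / κ then 0 else p j) := by
      intro j
      split_ifs with hj
      · rw [rawOutcome_eq_node hκ hx hj, mul_zero, add_zero, ← sq_abs]
        exact mul_le_mul_of_nonneg_right (pow_le_pow_left₀ (abs_nonneg _) hj 2) (hp0 j)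
      · have h2 : (rawOutcome (r + q) j - x) ^ 2 ≤ 9 := by
          rw [← sq_abs, show (9 : ℝ) = 3 ^ 2 by norm_num]
          exact pow_le_pow_left₀ (abs_nonneg _) (abs_rawOutcome_sub_le j hx) 2
        nlinarith [hp0 j, mul_le_mul_of_nonneg_right h2 (hp0 j),
          mul_nonneg (sq_nonneg (1 / κ)) (hp0 j)]
    refine (Finset.sum_le_sum fun j _ => h1 j).trans ?_
    rw [Finset.sum_add_distrib, ← Finset.mul_sum, ← Finset.mul_sum, hsum, mul_one]
    linarith

end OutcomeMoments

end GQPE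
end

noncomputable section
namespace GQPE

/-! ### Success probability of the preparation -/

section SuccessProbability

/-- Since `e⁻¹ ≤ 2/5` and `4^j ≥ j + 1`, the exponentials are at most `(2/5)^(j+1)`, with sum at
most `2/3 < log 2`. -/
theorem prod_one_add_exp_le (n : ℕ) :
    ∏ j ∈ Finset.range n, (1 + Real.exp (-((2 : ℝ) ^ j) ^ 2)) ≤ 2 := by
  have h1 : ∀ j : ℕ, Real.exp (-((2 : ℝ) ^ j) ^ 2) ≤ (2 / 5) ^ j * (2 / 5) := by
    intro j
    have h2 : Real.exp (-1) ≤ 2 / 5 := by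
      rw [Real.exp_neg, inv_le_comm₀ (Real.exp_pos _) (by norm_num)]
      linarith [Real.exp_one_gt_d9]
    rw [← pow_succ]
    refine le_trans ?_ (pow_le_pow_left₀ (Real.exp_pos _).le h2 (j + 1))
    rw [← Real.exp_nat_mul, Real.exp_le_exp]
    have h3 : ((j + 1 : ℕ) : ℝ) ≤ 2 ^ j := by
      exact_mod_cast Nat.lt_two_pow_self
    have h4 : (1 : ℝ) ≤ 2 ^ j := one_le_pow₀ (by norm_num)
    nlinarith
  have h2 : ∏ j ∈ Finset.range n, (1 + Real.exp (-((2 : ℝ) ^ j) ^ 2))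
      ≤ ∏ j ∈ Finset.range n, Real.exp ((2 / 5) ^ j * (2 / 5)) := by
    refine Finset.prod_le_prod (fun j _ => by positivity) fun j _ => ?_
    have := Real.add_one_le_exp (((2 : ℝ) / 5) ^ j * (2 / 5))
    linarith [h1 j]
  refine h2.trans ?_
  rw [← Real.exp_sum, ← Finset.sum_mul, ← Real.le_log_iff_exp_le (by norm_num)]
  have h3 : ∑ j ∈ Finset.range n, ((2 : ℝ) / 5) ^ j ≤ 5 / 3 := by
    rw [geom_sum_eq (by norm_num)]
    have : (0 : ℝ) < (2 / 5) ^ n := by positivity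
    rw [div_le_iff_of_neg (by norm_num)]
    linarith
  linarith [Real.log_two_gt_d9]

variable {r q : ℕ}

theorem exp_decay_sq (c : ℝ) :
    Real.exp (-(decay (r + q) (filterWidth r) * c ^ 2)) ^ 2
      = Real.exp (-(c / 2 ^ (2 * r + q)) ^ 2) := by
  rw [decay_filterWidth, ← Real.exp_nat_mul]
  congr 1
  rw [show (2 : ℝ) ^ (2 * r + q) = (2 ^ r) ^ 2 * 2 ^ q by rw [pow_add, mul_comm 2 r, pow_mul]]
  push_cast
  field_simp

/-- Let `W = 2^(2r+q)` be the width of the Gaussian in index units. The `2r + q` magnitude bits of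
weight below `W` contribute at most 2 each, all heavier ones together at most 2, and the sign bit at
most 2. -/
theorem prod_signWeight_le (hq : 2 ≤ q) :
    ∏ p, (1 + Real.exp (-(decay (r + q) (filterWidth r) * signWeight (r + q) p ^ 2)) ^ 2)
      ≤ 4 * 2 ^ (2 * r + q) := by
  simp_rw [exp_decay_sq]
  set W : ℝ := 2 ^ (2 * r + q) with hW
  set f : ℕ → ℝ := fun k => 1 + Real.exp (-((2 : ℝ) ^ k / W) ^ 2) with hf
  have hf2 : ∀ c : ℝ, 1 + Real.exp (-(c / W) ^ 2) ≤ 2 := fun c => by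
    have : Real.exp (-(c / W) ^ 2) ≤ 1 := by
      rw [Real.exp_le_one_iff, neg_nonpos]; positivity
    linarith
  have hf0 : ∀ k, 0 ≤ f k := fun k => by simp only [hf]; positivity
  obtain ⟨n, hn⟩ : ∃ n, 2 * (r + q) = n + 1 := ⟨2 * (r + q) - 1, by omega⟩
  have h1 : ∏ p, (1 + Real.exp (-(signWeight (r + q) p / W) ^ 2))
      = (∏ k ∈ Finset.range n, f k) * (1 + Real.exp (-(1 / W) ^ 2)) := by
    unfold signWeight
    rw [Fin.prod_univ_eq_prod_range (fun i => 1 + Real.exp (-((if i = 0 then (1 : ℝ)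
      else 2 ^ (2 * (r + q) - 1 - i)) / W) ^ 2)) (2 * (r + q)), hn, Finset.prod_range_succ']
    simp only [if_true, Nat.succ_ne_zero, if_false]
    rw [← Finset.prod_range_reflect f]
    congr 1
    refine Finset.prod_congr rfl fun i _ => ?_
    simp only [hf]
    rw [show n + 1 - 1 - (i + 1) = n - 1 - i by omega]
  obtain ⟨n', hn'⟩ : ∃ n', n = 2 * r + q + n' := ⟨n - (2 * r + q), by omega⟩
  have h2 : ∏ k ∈ Finset.range n, f k ≤ 2 ^ (2 * r + q) * 2 := by
    rw [hn', Finset.prod_range_add]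
    refine mul_le_mul ?_ ?_ (Finset.prod_nonneg fun k _ => hf0 _) (by positivity)
    · calc ∏ k ∈ Finset.range (2 * r + q), f k ≤ ∏ k ∈ Finset.range (2 * r + q), (2 : ℝ) :=
            Finset.prod_le_prod (fun k _ => hf0 k) fun k _ => hf2 _
        _ = _ := by simp
    · refine le_trans (le_of_eq ?_) (prod_one_add_exp_le n')
      refine Finset.prod_congr rfl fun j _ => ?_
      simp only [hf]
      rw [pow_add, ← hW, mul_div_cancel_left₀ _ (by positivity)]
  rw [h1]
  calc _ ≤ (2 ^ (2 * r + q) * 2) * 2 := mul_le_mul h2 (hf2 1) (by positivity) (by positivity)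
    _ = _ := by rw [hW]; ring

/-- From `exp(-t²) ≥ 1 - t` on `[0, 1]`, the sum dominates a triangle of half-width `W`, whose
values at the integers add up to exactly `W`. The condition `q ≥ 2` keeps the triangle inside the
index range and away from `ℓ = 0`. -/
theorem le_sum_exp_decay_sq (hq : 2 ≤ q) :
    (2 : ℝ) ^ (2 * r + q) ≤ ∑ l : Readout (r + q), if l.val = 0 then 0 else
      Real.exp (-(decay (r + q) (filterWidth r) * centred (r + q) l ^ 2)) ^ 2 := by
  simp_rw [exp_decay_sq]
  set W : ℝ := 2 ^ (2 * r + q) with hW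
  have hW0 : 0 < W := by positivity
  set M : ℕ := 2 ^ (2 * (r + q) - 1) with hM
  have hN : 2 ^ (2 * (r + q)) = M + M := by
    rw [hM, ← two_mul, ← pow_succ']; congr 1; omega
  have hNr : (2 : ℝ) ^ (2 * (r + q)) / 2 = M := by
    have : ((2 : ℝ) ^ (2 * (r + q))) = M + M := by exact_mod_cast hN
    rw [this]; ring
  have hWM : 2 ^ (2 * r + q) < M := Nat.pow_lt_pow_right (by norm_num) (by omega)
  set F : ℕ → ℝ := fun i => if i = 0 then 0 else Real.exp (-(((i : ℝ) - M) / W) ^ 2) with hF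
  have hF0 : ∀ i, 0 ≤ F i := fun i => by
    simp only [hF]; split_ifs <;> positivity
  have hexp : ∀ t : ℝ, 0 ≤ t → t ≤ 1 → 1 - t ≤ Real.exp (-t ^ 2) := fun t h0 h1 => by
    have := Real.add_one_le_exp (-t ^ 2)
    nlinarith
  have h1 : (∑ l : Readout (r + q), if l.val = 0 then 0 else
      Real.exp (-(centred (r + q) l / W) ^ 2))
      = ∑ i ∈ Finset.range M, (F (M - 1 - i) + F (M + i)) := by
    unfold centred
    rw [hNr, Fin.sum_univ_eq_sum_range F (2 ^ (2 * (r + q))), hN, Finset.sum_range_add,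
      Finset.sum_add_distrib, Finset.sum_range_reflect]
  rw [h1]
  calc W = ∑ i ∈ Finset.range (2 ^ (2 * r + q)), ((1 - (i + 1 : ℝ) / W) + (1 - i / W)) := by
        have key : ∀ n : ℕ, ∑ i ∈ Finset.range n, ((1 - (i + 1 : ℝ) / W) + (1 - i / W))
            = 2 * n - n ^ 2 / W := by
          intro n
          induction n with
          | zero => simp
          | succ n ih => rw [Finset.sum_range_succ, ih]; push_cast; ring
        rw [key]
        push_cast
        rw [← hW]
        field_simp
        ring
    _ ≤ ∑ i ∈ Finset.range (2 ^ (2 * r + q)), (F (M - 1 - i) + F (M + i)) := by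
        refine Finset.sum_le_sum fun i hi => ?_
        have hi' := Finset.mem_range.1 hi
        have hiW : (i : ℝ) + 1 ≤ W := by rw [hW]; exact_mod_cast hi'
        have hi0 : (0 : ℝ) ≤ i := Nat.cast_nonneg i
        refine add_le_add ?_ ?_
        · simp only [hF]
          rw [if_neg (by omega), Nat.sub_sub, Nat.cast_sub (by omega)]
          have e : (((M : ℝ) - ((1 + i : ℕ) : ℝ) - M) / W) ^ 2 = ((i + 1 : ℝ) / W) ^ 2 := by
            push_cast; ring
          rw [e]
          exact hexp _ (by positivity) (by rw [div_le_one hW0]; exact hiW)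
        · simp only [hF]
          rw [if_neg (by omega)]
          have e : (((M + i : ℕ) : ℝ) - M) / W = i / W := by push_cast; ring
          rw [e]
          exact hexp _ (by positivity) (by rw [div_le_one hW0]; linarith)
    _ ≤ _ := Finset.sum_le_sum_of_subset_of_nonneg
        (Finset.range_subset_range.2 hWM.le) fun i _ _ => add_nonneg (hF0 _) (hF0 _)

theorem success_probability (hq : 2 ≤ q) :
    1 / 4 * ∏ p, (1 + Real.exp (-(decay (r + q) (filterWidth r) * signWeight (r + q) p ^ 2)) ^ 2)
      ≤ ∑ l : Readout (r + q), if l.val = 0 then 0 else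
        Real.exp (-(decay (r + q) (filterWidth r) * centred (r + q) l ^ 2)) ^ 2 := by
  have h1 := prod_signWeight_le (r := r) hq
  have h2 := le_sum_exp_decay_sq (r := r) hq
  linarith

end SuccessProbability

end GQPE
end

noncomputable section
namespace GQPE

/-! ### Numerical consequences of the parameter choice -/

section Parameters

/-- The logarithmic factor governing the cost. -/
def logFactor (κ ε : ℝ) : ℝ := 1 + Real.log κ + Real.posLog ε⁻¹

variable {κ ε : ℝ}

theorem one_le_logFactor (hκ : 1 ≤ κ) : 1 ≤ logFactor κ ε := by
  have := Real.log_nonneg hκ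
  have := Real.posLog_nonneg (x := ε⁻¹)
  unfold logFactor; linarith

theorem exists_pow_two_between {x : ℝ} (hx : 1 ≤ x) : ∃ n : ℕ, x ≤ 2 ^ n ∧ (2 : ℝ) ^ n ≤ 2 * x := by
  obtain ⟨n, h1, h2⟩ := exists_nat_pow_near hx (by norm_num : (1 : ℝ) < 2)
  exact ⟨n + 1, h2.le, by rw [pow_succ]; linarith⟩

/-- The exponent `2L` exceeds both `log κ + log ε⁻¹` and `2 log κ`; the second is what keeps the
variance error bounded after scaling by `κ²`. -/
theorem exp_neg_logFactor_le (hκ : 1 ≤ κ) (hε : 0 < ε) :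
    κ * Real.exp (-(2 * logFactor κ ε)) ≤ ε ∧ κ * Real.exp (-(2 * logFactor κ ε)) ≤ 1 / κ := by
  have hκ0 : 0 < κ := by linarith
  have h1 : Real.log ε⁻¹ ≤ Real.posLog ε⁻¹ := le_max_right _ _
  have h2 := Real.posLog_nonneg (x := ε⁻¹)
  have h3 := Real.log_nonneg hκ
  rw [Real.log_inv] at h1
  have h4 : κ = Real.exp (Real.log κ) := (Real.exp_log hκ0).symm
  constructor
  · calc κ * Real.exp (-(2 * logFactor κ ε)) = Real.exp (Real.log κ + -(2 * logFactor κ ε)) := by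
          rw [Real.exp_add, Real.exp_log hκ0]
      _ ≤ Real.exp (Real.log ε) := by
          rw [Real.exp_le_exp]; unfold logFactor; linarith
      _ = ε := Real.exp_log hε
  · rw [one_div]
    calc κ * Real.exp (-(2 * logFactor κ ε)) = Real.exp (Real.log κ + -(2 * logFactor κ ε)) := by
          rw [Real.exp_add, Real.exp_log hκ0]
      _ ≤ Real.exp (-Real.log κ) := by
          rw [Real.exp_le_exp]; unfold logFactor; linarith
      _ = κ⁻¹ := by rw [Real.exp_neg, Real.exp_log hκ0]

/-- The fourth power is at most `2^48 κ^8 L^6 ≤ 2^48 exp(14L)`, because `κ` and `L` are at most `exp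
L`. Then `3000 · 2^48 ≤ 2^60 ≤ exp(48L)`, and `14 + 48 - 64 = -2`. -/
theorem filter_error_le {r q : ℕ} (hκ : 1 ≤ κ)
    (hr : (2 : ℝ) ^ r ≤ 8 * κ * Real.sqrt (logFactor κ ε))
    (hq : (2 : ℝ) ^ q ≤ 64 * Real.sqrt (logFactor κ ε)) :
    3000 * (((2 : ℝ) ^ r) ^ 2 * 2 ^ q) ^ 4 * Real.exp (-(64 * logFactor κ ε))
      ≤ Real.exp (-(2 * logFactor κ ε)) := by
  set L := logFactor κ ε with hL
  have hL1 : 1 ≤ L := one_le_logFactor hκ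
  have hs : Real.sqrt L ^ 2 = L := Real.sq_sqrt (by linarith)
  have hκ0 : 0 < κ := by linarith
  have hκL : κ ≤ Real.exp L := by
    rw [← Real.log_le_iff_le_exp hκ0]
    have := Real.posLog_nonneg (x := ε⁻¹)
    rw [hL, logFactor]; linarith
  have hLL : L ≤ Real.exp L := by linarith [Real.add_one_le_exp L]
  have h1 : (((2 : ℝ) ^ r) ^ 2 * 2 ^ q) ^ 4
      ≤ ((8 * κ * Real.sqrt L) ^ 2 * (64 * Real.sqrt L)) ^ 4 := by gcongr
  have h2 : ((8 * κ * Real.sqrt L) ^ 2 * (64 * Real.sqrt L)) ^ 4 = 2 ^ 48 * (κ ^ 8 * L ^ 6) := by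
    calc _ = 2 ^ 48 * (κ ^ 8 * ((Real.sqrt L) ^ 2) ^ 6) := by ring
      _ = _ := by rw [hs]
  have h3 : κ ^ 8 * L ^ 6 ≤ Real.exp L ^ 8 * Real.exp L ^ 6 := by gcongr
  have h4 : (2 : ℝ) ^ 5 ≤ Real.exp 1 ^ 4 := by
    have : (2.7 : ℝ) ^ 4 ≤ Real.exp 1 ^ 4 :=
      pow_le_pow_left₀ (by norm_num) (by linarith [Real.exp_one_gt_d9]) 4
    refine le_trans ?_ this
    norm_num
  have h5 : (2 : ℝ) ^ 60 ≤ Real.exp (48 * L) := by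
    calc (2 : ℝ) ^ 60 = (2 ^ 5) ^ 12 := by norm_num
      _ ≤ (Real.exp 1 ^ 4) ^ 12 := pow_le_pow_left₀ (by norm_num) h4 12
      _ = Real.exp 48 := by rw [← pow_mul, ← Real.exp_nat_mul]; norm_num
      _ ≤ Real.exp (48 * L) := by rw [Real.exp_le_exp]; linarith
  have h6 : Real.exp L ^ 8 * Real.exp L ^ 6 = Real.exp (14 * L) := by
    rw [← pow_add, ← Real.exp_nat_mul]; norm_num
  calc _ ≤ 3000 * (2 ^ 48 * Real.exp (14 * L)) * Real.exp (-(64 * L)) := by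
        rw [← h6]
        gcongr
        calc _ ≤ _ := h1
          _ = _ := h2
          _ ≤ _ := by gcongr
    _ ≤ 2 ^ 60 * (Real.exp (14 * L) * Real.exp (-(64 * L))) := by
        have : 0 < Real.exp (14 * L) * Real.exp (-(64 * L)) := by positivity
        nlinarith
    _ ≤ Real.exp (48 * L) * (Real.exp (14 * L) * Real.exp (-(64 * L))) :=
        mul_le_mul_of_nonneg_right h5 (by positivity)
    _ = _ := by rw [← Real.exp_add, ← Real.exp_add]; congr 1; ring

/-- Multiplying the bounds gives `2^(r+q) ≤ 512 κ L`, and `L ≤ 2 (1 + log κ) max(1, log⁺ ε⁻¹)`.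
Taking logarithms leaves only a double logarithm of `ε⁻¹`; dividing by `log 2 > 2/3` gives the
slopes. -/
theorem register_size_le {r q : ℕ} (hκ : 1 ≤ κ)
    (hr : (2 : ℝ) ^ r ≤ 8 * κ * Real.sqrt (logFactor κ ε))
    (hq : (2 : ℝ) ^ q ≤ 64 * Real.sqrt (logFactor κ ε)) :
    ((r + q : ℕ) : ℝ) ≤ 10 + 3 * Real.log κ + 2 * Real.posLog (Real.posLog ε⁻¹) := by
  have hL1 : 1 ≤ logFactor κ ε := one_le_logFactor hκ
  have hκ0 : 0 < κ := by linarith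
  have hlog := Real.log_nonneg hκ
  have hl0 := Real.posLog_nonneg (x := ε⁻¹)
  set l := Real.posLog ε⁻¹ with hl
  have hpp := Real.posLog_nonneg (x := l)
  have h1 : (2 : ℝ) ^ (r + q) ≤ 2 ^ 10 * κ * ((1 + Real.log κ) * max 1 l) := by
    have hs : Real.sqrt (logFactor κ ε) * Real.sqrt (logFactor κ ε) = logFactor κ ε :=
      Real.mul_self_sqrt (by linarith)
    have h2 : logFactor κ ε ≤ 2 * ((1 + Real.log κ) * max 1 l) := by
      unfold logFactor
      rw [← hl]
      have := le_max_left 1 l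
      have := le_max_right 1 l
      nlinarith
    rw [pow_add]
    calc _ ≤ (8 * κ * Real.sqrt (logFactor κ ε)) * (64 * Real.sqrt (logFactor κ ε)) := by gcongr
      _ = 512 * κ * logFactor κ ε := by linear_combination 512 * κ * hs
      _ ≤ 512 * κ * (2 * ((1 + Real.log κ) * max 1 l)) := by gcongr
      _ = _ := by ring
  have hmax : 0 < max 1 l := lt_of_lt_of_le one_pos (le_max_left _ _)
  have h3 : Real.log ((2 : ℝ) ^ (r + q))
      ≤ 10 * Real.log 2 + Real.log κ + (Real.log (1 + Real.log κ) + Real.log (max 1 l)) := by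
    refine (Real.log_le_log (by positivity) h1).trans (le_of_eq ?_)
    rw [Real.log_mul (by positivity) (by positivity), Real.log_mul (by positivity) hκ0.ne',
      Real.log_mul (by positivity) hmax.ne', Real.log_pow]
    norm_num
  have h4 : Real.log (1 + Real.log κ) ≤ Real.log κ := by
    have := Real.log_le_sub_one_of_pos (show 0 < 1 + Real.log κ by linarith)
    linarith
  have h5 : Real.log (max 1 l) ≤ Real.posLog l := by
    rcases le_total 1 l with h | h
    · rw [max_eq_right h]; exact le_max_right _ _
    · rw [max_eq_left h, Real.log_one]; exact hpp
  rw [Real.log_pow] at h3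
  have h6 := Real.log_two_gt_d9
  by_contra! hcon
  nlinarith

end Parameters

/-! ### From filter moments to the properties of the measurement -/

section Assembly

variable {S : Type} [Fintype S] [DecidableEq S] [Nonempty S]

/-- Statistics, fixed point and detailed balance of the measurement, for an error `D` of the
filter. -/
theorem measurement_properties {m : ℕ} (hm : 0 < m) {γ κ D : ℝ} (hγ : 0 < γ) (hκ : 1 ≤ κ)
    (hD : κ * D ≤ 1 / κ)
    (hmean : ∀ x : ℝ, |x| ≤ 1 → |∑ j, rawOutcome m j * ampl m γ x j ^ 2 - x| ≤ D)
    (hvar : ∀ x : ℝ, |x| ≤ 1 →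
      ∑ j, (rawOutcome m j - x) ^ 2 * ampl m γ x j ^ 2 ≤ (1 / κ) ^ 2 + D)
    {H O : Op S} (β : ℝ) (hH : H.IsHermitian) (hO : O.IsHermitian) (hc : O * H = H * O)
    (hOκ : opNorm O ≤ κ) :
    (measurement m γ κ O).IsComplete ∧
    |(measurement m γ κ O).expect (gibbs β H) - obsExp (gibbs β H) O| ≤ κ * D ∧
    |(measurement m γ κ O).variance (gibbs β H) - obsVar (gibbs β H) O| ≤ 7 ∧
    |(measurement m γ κ O).covariance (gibbs β H)| ≤ (measurement m γ κ O).variance (gibbs β H) ∧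
    (measurement m γ κ O).channel (gibbs β H) = gibbs β H ∧
    ∀ s : ℝ, (measurement m γ κ O).ChannelDetailedBalance (gibbs β H) s ∧
      (measurement m γ κ O).HatDetailedBalance (gibbs β H) s := by
  obtain ⟨U, lam, hU, hU', hOU, hlam⟩ := exists_specOp hO
  have hκ0 : 0 < κ := by linarith
  have hlamκ : ∀ i, |lam i| ≤ κ := fun i => (hlam i).trans hOκ
  have hx : ∀ i, |κ⁻¹ * lam i| ≤ 1 := fun i => by
    rw [abs_mul, abs_of_pos (inv_pos.2 hκ0), inv_mul_le_iff₀ hκ0, mul_one]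
    exact hlamκ i
  set M := measurement m γ κ O with hMdef
  have hM : ∀ j, M.kraus j = specOp U fun i => (ampl m γ (κ⁻¹ * lam i) j : ℂ) := fun j => by
    change algKraus m γ κ O j = _
    rw [hOU, algKraus_specOp hU]
  have hf : ∀ i, ∑ j, ampl m γ (κ⁻¹ * lam i) j ^ 2 = 1 := fun i => sum_ampl_sq hm hγ _
  have hcomp := Measurement.isComplete_of_specOp hU hU' hM hf
  have hself : ∀ j, (M.kraus j)ᴴ = M.kraus j := fun j => by
    rw [hM, specOp_ofReal_conjTranspose]
  have hcomm : ∀ j, Commute (M.kraus j) (gibbs β H) := fun j =>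
    commute_gibbs (commute_algKraus hc γ κ j) β
  have hD0 : 0 ≤ D := (abs_nonneg _).trans (hmean 0 (by simp))
  obtain ⟨h1, h2, h3⟩ := Measurement.statistics_of_specOp (M := M) (δ := κ * D)
    (v := κ ^ 2 * ((1 / κ) ^ 2 + D)) hU hU' hM hf (gibbs_posSemidef hH β) (trace_gibbs hH β) hOU
    hlamκ
    (fun i => by
      have h := hmean _ (hx i)
      have e : ∑ j, M.outcome j * ampl m γ (κ⁻¹ * lam i) j ^ 2 - lam i
          = κ * (∑ j, rawOutcome m j * ampl m γ (κ⁻¹ * lam i) j ^ 2 - κ⁻¹ * lam i) := by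
        rw [mul_sub, mul_inv_cancel_left₀ hκ0.ne', Finset.mul_sum]
        congr 1
        exact Finset.sum_congr rfl fun j _ => mul_assoc _ _ _
      rw [e, abs_mul, abs_of_pos hκ0]
      exact mul_le_mul_of_nonneg_left h hκ0.le)
    (fun i => by
      have h := hvar _ (hx i)
      have e : ∑ j, (M.outcome j - lam i) ^ 2 * ampl m γ (κ⁻¹ * lam i) j ^ 2
          = κ ^ 2 * ∑ j, (rawOutcome m j - κ⁻¹ * lam i) ^ 2 * ampl m γ (κ⁻¹ * lam i) j ^ 2 := by
        rw [Finset.mul_sum]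
        refine Finset.sum_congr rfl fun j _ => ?_
        have : lam i = κ * (κ⁻¹ * lam i) := (mul_inv_cancel_left₀ hκ0.ne' _).symm
        change (κ * rawOutcome m j - lam i) ^ 2 * _ = _
        nth_rewrite 1 [this]
        ring
      rw [e]
      exact mul_le_mul_of_nonneg_left h (by positivity))
  refine ⟨hcomp, h1, h2.trans ?_, h3, M.channel_of_commute hcomp hself hcomm, fun s =>
    ⟨detailedBalance_of_commute hself hcomm _ s, detailedBalance_of_commute hself hcomm _ s⟩⟩
  -- The variance error is at most `1 + κ²D + 4κ²D + (κD)²`, and `κ²D ≤ 1`, `κD ≤ 1` bound it by 7.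
  have h4 : κ * (κ * D) ≤ 1 := by
    have := mul_le_mul_of_nonneg_left hD hκ0.le
    rwa [mul_one_div_cancel hκ0.ne'] at this
  have h5 : κ * D ≤ 1 := hD.trans (by rw [div_le_one hκ0]; exact hκ)
  have h6 : κ ^ 2 * (1 / κ) ^ 2 = 1 := by field_simp
  have h7 : 0 ≤ κ * D := by positivity
  nlinarith

end Assembly

end GQPE
end

/-! ### Choice of parameters and conclusion -/

theorem theorem6p3 :
    ∃ (C : ℝ) (d : ℕ), 0 < C ∧
      ∀ (κ ε : ℝ), 1 ≤ κ → 0 < ε →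
        ∃ (m w : ℕ) (γ : ℝ) (c : List (GQPE.Instr (Fin (2 * m) ⊕ Fin w))),
          1 ≤ m ∧ 0 < γ ∧
          γ⁻¹ ≤ C * κ * Real.sqrt (1 + Real.log κ + Real.posLog ε⁻¹) ∧
          (2 : ℝ) ^ m ≤ C * γ⁻¹ * Real.sqrt (1 + Real.log κ + Real.posLog ε⁻¹) ∧
          ((2 * m + w : ℕ) : ℝ) ≤ C * (1 + Real.log κ + Real.posLog (Real.posLog ε⁻¹)) ∧
          GQPE.circuitTime c ≤ C * (1 + Real.log κ + Real.posLog ε⁻¹) ∧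
          (c.length : ℝ) ≤ C * (m : ℝ) ^ d ∧
          ∀ (n : ℕ) (H O : GQPE.Op (GQPE.QubitBasis n)) (β : ℝ),
            H.IsHermitian → O.IsHermitian → O * H = H * O → GQPE.opNorm O ≤ κ →
              GQPE.Implements m w c O (GQPE.measurement m γ κ O).kraus ∧
              (GQPE.measurement m γ κ O).IsComplete ∧
              |(GQPE.measurement m γ κ O).expect (GQPE.gibbs β H)
                  - GQPE.obsExp (GQPE.gibbs β H) O| ≤ ε ∧
              |(GQPE.measurement m γ κ O).variance (GQPE.gibbs β H)
                  - GQPE.obsVar (GQPE.gibbs β H) O| ≤ C ∧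
              |(GQPE.measurement m γ κ O).covariance (GQPE.gibbs β H)|
                  ≤ (GQPE.measurement m γ κ O).variance (GQPE.gibbs β H) ∧
              (GQPE.measurement m γ κ O).channel (GQPE.gibbs β H) = GQPE.gibbs β H ∧
              ∀ s : ℝ, 0 ≤ s → s ≤ 1 →
                (GQPE.measurement m γ κ O).ChannelDetailedBalance (GQPE.gibbs β H) s ∧
                (GQPE.measurement m γ κ O).HatDetailedBalance (GQPE.gibbs β H) s := by
  refine ⟨10000, 2, by norm_num, fun κ ε hκ hε => ?_⟩
  change ∃ (m w : ℕ) (γ : ℝ) (c : List (GQPE.Instr (Fin (2 * m) ⊕ Fin w))),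
    1 ≤ m ∧ 0 < γ ∧ γ⁻¹ ≤ 10000 * κ * Real.sqrt (GQPE.logFactor κ ε) ∧
    (2 : ℝ) ^ m ≤ 10000 * γ⁻¹ * Real.sqrt (GQPE.logFactor κ ε) ∧ _ ∧
    GQPE.circuitTime c ≤ 10000 * GQPE.logFactor κ ε ∧ _
  have hκ0 : 0 < κ := by linarith
  have hL1 : 1 ≤ GQPE.logFactor κ ε := GQPE.one_le_logFactor hκ
  have hsq : Real.sqrt (GQPE.logFactor κ ε) ^ 2 = GQPE.logFactor κ ε := Real.sq_sqrt (by linarith)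
  have hs1 : 1 ≤ Real.sqrt (GQPE.logFactor κ ε) := Real.one_le_sqrt.2 hL1
  set L := GQPE.logFactor κ ε with hL
  -- The factors 4 and 32 bring both filter errors below `exp(-64L)`: `π² · 4² ≥ 144` and `32²/16 =
  -- 64`. The inverse filter width is proportional to `2^r`, and `m = r + q`.
  obtain ⟨r, hr1, hr2⟩ := GQPE.exists_pow_two_between (x := 4 * κ * Real.sqrt L) (by nlinarith)
  obtain ⟨q, hq1, hq2⟩ := GQPE.exists_pow_two_between (x := 32 * Real.sqrt L) (by linarith)
  have hr3 : (2 : ℝ) ^ r ≤ 8 * κ * Real.sqrt L := by linarith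
  have hq3 : (2 : ℝ) ^ q ≤ 64 * Real.sqrt L := by linarith
  have hq : 2 ≤ q := by
    by_contra! h
    have : (2 : ℝ) ^ q ≤ 2 ^ 1 := pow_le_pow_right₀ (by norm_num) (by omega)
    linarith
  have hm8 : 8 ≤ (2 : ℝ) ^ (r + q) := by
    have : (2 : ℝ) ^ q ≤ 2 ^ (r + q) := pow_le_pow_right₀ (by norm_num) (by omega)
    linarith
  have hpi := Real.pi_pos
  have hpi3 := Real.pi_gt_three
  have hpi4 := Real.pi_lt_four
  have hδ : Real.exp (-(Real.pi ^ 2 * (2 ^ r) ^ 2 / κ ^ 2)) ≤ Real.exp (-(64 * L)) := by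
    rw [Real.exp_le_exp, neg_le_neg_iff, le_div_iff₀ (by positivity)]
    have h1 : (4 * κ * Real.sqrt L) ^ 2 ≤ ((2 : ℝ) ^ r) ^ 2 :=
      pow_le_pow_left₀ (by positivity) hr1 2
    have h2 : (4 * κ * Real.sqrt L) ^ 2 = 16 * κ ^ 2 * L := by rw [mul_pow, hsq]; ring
    have h3 : 0 ≤ κ ^ 2 * L := by positivity
    have h4 : 9 ≤ Real.pi ^ 2 := by nlinarith
    calc 64 * L * κ ^ 2 ≤ 9 * (16 * κ ^ 2 * L) := by linarith
      _ ≤ Real.pi ^ 2 * (2 ^ r) ^ 2 := by rw [← h2]; gcongr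
  have hδ' : Real.exp (-((2 ^ q) ^ 2 / 16)) ≤ Real.exp (-(64 * L)) := by
    rw [Real.exp_le_exp, neg_le_neg_iff]
    have h1 : (32 * Real.sqrt L) ^ 2 ≤ ((2 : ℝ) ^ q) ^ 2 := pow_le_pow_left₀ (by positivity) hq1 2
    have h2 : (32 * Real.sqrt L) ^ 2 = 1024 * L := by rw [mul_pow, hsq]; ring
    linarith
  have herr := GQPE.filter_error_le hκ hr3 hq3
  have hmom := fun x (hx : |x| ≤ 1) => GQPE.rawOutcome_moments hm8 hκ hx hδ hδ'
    (by rw [Real.exp_le_one_iff]; linarith) hq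
  obtain ⟨hε1, hε2⟩ := GQPE.exp_neg_logFactor_le hκ hε
  obtain ⟨c, hc1, hc2, hc3⟩ := GQPE.exists_circuit (m := r + q) (by omega)
    (GQPE.filterWidth_pos r) hκ0 (GQPE.success_probability hq)
  have hsize := GQPE.register_size_le hκ hr3 hq3
  have hlog := Real.log_nonneg hκ
  have hpp := Real.posLog_nonneg (x := Real.posLog ε⁻¹)
  have hinv : (GQPE.filterWidth r)⁻¹ = 2 * Real.sqrt 2 * Real.pi * 2 ^ r := by
    rw [GQPE.filterWidth, inv_inv]
  have h21 : 1 ≤ Real.sqrt 2 := Real.one_le_sqrt.2 (by norm_num)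
  have h22 : Real.sqrt 2 ≤ 2 := by rw [Real.sqrt_le_left (by norm_num)]; norm_num
  refine ⟨r + q, 10 * (r + q) + 8, GQPE.filterWidth r, c, by omega, GQPE.filterWidth_pos r,
    ?_, ?_, ?_, ?_, ?_, ?_⟩
  · rw [hinv]
    calc 2 * Real.sqrt 2 * Real.pi * 2 ^ r ≤ 2 * 2 * 4 * (8 * κ * Real.sqrt L) := by gcongr
      _ ≤ 10000 * κ * Real.sqrt L := by
        have : 0 ≤ κ * Real.sqrt L := by positivity
        linarith
  · rw [hinv, pow_add]
    calc (2 : ℝ) ^ r * 2 ^ q ≤ 2 ^ r * (64 * Real.sqrt L) := by gcongr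
      _ = 64 * (1 * 1 * 1 * 2 ^ r) * Real.sqrt L := by ring
      _ ≤ 10000 * (2 * Real.sqrt 2 * Real.pi * 2 ^ r) * Real.sqrt L := by
        gcongr <;> linarith
  · push_cast at hsize ⊢
    linarith
  · refine hc1.trans ?_
    rw [pow_add]
    calc 2 * Real.pi * (2 ^ r * 2 ^ q) * κ⁻¹
        ≤ 2 * 4 * ((8 * κ * Real.sqrt L) * (64 * Real.sqrt L)) * κ⁻¹ := by gcongr
      _ = 4096 * Real.sqrt L ^ 2 * (κ * κ⁻¹) := by ring
      _ ≤ 10000 * L := by rw [hsq, mul_inv_cancel₀ hκ0.ne']; linarith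
  · exact_mod_cast hc2
  · intro n H O β hH hO hcomm hOκ
    have hexp := Real.exp_pos (-(2 * L))
    obtain ⟨h1, h2, h3, h4, h5, h6⟩ := GQPE.measurement_properties (m := r + q)
      (D := Real.exp (-(2 * L))) (by omega) (GQPE.filterWidth_pos r) hκ hε2
      (fun x hx => (hmom x hx).1.trans (le_trans (by gcongr; norm_num) herr))
      (fun x hx => (hmom x hx).2.trans (add_le_add le_rfl herr)) β hH hO hcomm hOκ
    exact ⟨hc3 O, h1, h2.trans hε1, h3.trans (by norm_num), h4, h5, fun s _ _ => h6 s⟩
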